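/- Let $-3<\gamma<0$ and $\mu(v)=(2\pi)^{-3/2}e^{-|v|^2/2}$ on $\mathbb R^3$, let $$\bar a_{ij}(v)=\int_{\mathbb R^3}\big(\delta_{ij}|v-w|^2-(v_i-w_i)(v_j-w_j)\big)|v-w|^{\gamma}\mu(w)\,dw,\qquad A=(\bar a_{ij})_{1\le i,j\le 3},$$ and let $$\mathcal L f=\nabla\cdot[A(v)\nabla f]-\Big(A(v)\tfrac v2\cdot\tfrac v2\Big)f+\Big(\nabla\cdot\big[A(v)\tfrac v2\big]\Big)f$$ be the linear Landau operator. Set $\langle v\rangle=(1+|v|^2)^{1/2}$, $\|u\|_{2,\gamma/2}=\|\langle v\rangle^{\gamma/2}u\|_{L^2}$ and $\|u\|_A^2=\sum_{j,k}\int_{\mathbb R^3}\big(\bar a_{jk}\,\partial_ju\,\partial_ku+\tfrac14\bar a_{jk}v_jv_ku^2\big)dv$. There are constants $C_0>0$, depending only on $\gamma$, such that $$(\mathcal L u,u)_{L^2}\le-\|u\|_A^2+C_0\|u\|_A\|u\|_{2,\gamma/2}\qquad\text{for all real } u\in\mathcal S(\mathbb R^3).\tag{1}$$ For $T>0$ and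 $f_0\in L^2(\mathbb R^3)$ (real-valued), a weak solution of the Cauchy problem $\partial_tf=\mathcal Lf$, $f|_{t=0}=f_0$, on $[0,T]$ is an $f\in L^\infty([0,T];L^2(\mathbb R^3))$ such that $$\int_0^T\big(f(t),\,\partial_t\varphi(t)+\mathcal L\varphi(t)\big)_{L^2}\,dt+\big(f_0,\varphi(0)\big)_{L^2}=0$$ for every $\varphi\in C^\infty([0,T];\mathcal S(\mathbb R^3))$ with $\varphi(T)=0$. Proposition. For all $T>0$ and $f_0\in L^2(\mathbb R^3)$ the Cauchy problem has exactly one weak solution $f\in L^\infty([0,T];L^2(\mathbb R^3))$. For every constant $C_0>0$ with (1), this solution satisfies $$\|f(t)\|_{L^2(\mathbb R^3)}\le 2e^{2C_0T}\|f_0\|_{L^2(\mathbb R^3)}\qquad\text{for almost every }t\in[0,T].$$ -/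

import Mathlib

open MeasureTheory Set
open scoped SchwartzMap ENNReal

noncomputable section

namespace LinearLandau

/-- The velocity space `ℝ³` with its Euclidean norm and Lebesgue measure. -/
abbrev V3 : Type := EuclideanSpace ℝ (Fin 3)

/-- The `i`-th partial derivative of a real function on `ℝ³`. -/
def pd (i : Fin 3) (g : V3 → ℝ) (v : V3) : ℝ :=
  fderiv ℝ g v (EuclideanSpace.single i 1)

/-- The Japanese bracket `⟨v⟩ = (1 + |v|²)^{1/2}`. -/
def bracket (v : V3) : ℝ := Real.sqrt (1 + ‖v‖ ^ 2)

/-- The absolute Maxwellian `μ(v) = (2π)^{-3/2} e^{-|v|²/2}`. -/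
def maxwellian (v : V3) : ℝ :=
  (2 * Real.pi) ^ (-(3 / 2) : ℝ) * Real.exp (-‖v‖ ^ 2 / 2)

/-- The Landau collision kernel `a_{ij}(z) = (δ_{ij} |z|² - z_i z_j) |z|^γ`. -/
def kernel (γ : ℝ) (i j : Fin 3) (z : V3) : ℝ :=
  ((if i = j then ‖z‖ ^ 2 else 0) - z i * z j) * ‖z‖ ^ γ

/-- The entries `ā_{ij} = a_{ij} * μ` of the diffusion matrix `A(v)`. -/
def abar (γ : ℝ) (i j : Fin 3) (v : V3) : ℝ :=
  ∫ w, kernel γ i j (v - w) * maxwellian w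

/-- The linear Landau operator
`L f = ∇·(A ∇f) - (A v/2 · v/2) f + (∇·(A v/2)) f`.
It is formally self-adjoint in `L²(ℝ³)`. -/
def landau (γ : ℝ) (f : V3 → ℝ) (v : V3) : ℝ :=
  (∑ i, ∑ j, pd i (fun w => abar γ i j w * pd j f w) v)
    - (∑ i, ∑ j, abar γ i j v * (v i / 2) * (v j / 2)) * f v
    + (∑ i, ∑ j, pd i (fun w => abar γ i j w * (w j / 2)) v) * f v

/-- The square of the energy norm,
`‖u‖_A² = ∑_{j,k} ∫ (ā_{jk} ∂_j u ∂_k u + ¼ ā_{jk} v_j v_k u²) dv`. -/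
def normASq (γ : ℝ) (u : V3 → ℝ) : ℝ :=
  ∑ j, ∑ k, ∫ v, (abar γ j k v * pd j u v * pd k u v
    + 1 / 4 * (abar γ j k v * v j * v k * u v ^ 2))

/-- The weighted norm `‖u‖_{2,s} = ‖⟨v⟩^s u‖_{L²}`. -/
def weightedNorm (s : ℝ) (u : V3 → ℝ) : ℝ :=
  Real.sqrt (∫ v, (bracket v ^ s * u v) ^ 2)

/-- `C` is an energy constant of `L` if
`(L u, u)_{L²} ≤ - ‖u‖_A² + C ‖u‖_A ‖u‖_{2,γ/2}` for all Schwartz functions `u`. -/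
def IsEnergyConstant (γ C : ℝ) : Prop :=
  ∀ u : 𝓢(V3, ℝ),
    ∫ v, landau γ u v * u v ≤
      -normASq γ u + C * Real.sqrt (normASq γ u) * weightedNorm (γ / 2) u

/-- A test function `φ ∈ C^∞([0,T]; 𝓢(ℝ³))` with `φ(T) = 0`, given together with its successive
time derivatives: `jet k` is `∂_t^k φ`, the derivatives being taken in the topology of the
Schwartz space (one-sided at the end points). On `[0,T]` all of them are determined by `jet 0`. -/
structure TestFunction (T : ℝ) where
  jet : ℕ → ℝ → 𝓢(V3, ℝ)
  hasDeriv : ∀ k, ∀ t ∈ Icc 0 T, HasDerivWithinAt (jet k) (jet (k + 1) t) (Icc 0 T) t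
  final : jet 0 T = 0

/-- Weak solutions in `L^∞([0,T]; L²(ℝ³))` of `∂_t f = L f`, `f(0) = f₀`:
`∫_0^T (f(t), ∂_t φ(t) + L φ(t))_{L²} dt + (f₀, φ(0))_{L²} = 0` for all
`φ ∈ C^∞([0,T]; 𝓢(ℝ³))` with `φ(T) = 0`. -/
def IsWeakSolution (γ T : ℝ) (f₀ : Lp ℝ 2 (volume : Measure V3))
    (f : Lp (Lp ℝ 2 (volume : Measure V3)) ∞ (volume.restrict (Icc 0 T))) : Prop :=
  ∀ φ : TestFunction T,
    (∫ t in Icc 0 T, ∫ v, f t v * (φ.jet 1 t v + landau γ (φ.jet 0 t) v))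
      + ∫ v, f₀ v * φ.jet 0 0 v = 0

end LinearLandau

end

/-! The heart of the matter is that `L` is dissipative. Since `A` is nonnegative and `∇·(A v/2)` can
be integrated by parts against `u²`, one has `(Lu, u) = -∫ A(∇u + v u/2)·(∇u + v u/2) ≤ 0` for
Schwartz `u` (`integral_landau_mul_self_nonpos`). Dissipativity gives the contraction bound `‖f(t)‖
≤ ‖f₀‖`, which is stronger than the exponential bound for every positive energy constant.

That some energy constant exists comes from `(Lu, u) = -‖u‖_A² + ∫ drift u²` and two bounds for the
last integral: it is at most `‖u‖_A²` by the completed square, and at most `C ‖u‖²_{2,γ/2}` because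
`∇·(A v/2) ≤ C (1+|v|)^γ` (`drift_le`). The geometric mean of the two is the cross term in (1). The
decay of order `γ` uses that the kernel annihilates `z` and that the double divergence of the kernel
is a multiple of `|z|^γ`.

Existence is by duality. For a test function, dissipativity bounds `‖φ(0)‖` by the `L¹` norm in time
of `∂ₜφ + Lφ` (`norm_initial_le`). Hahn–Banach and Riesz then produce a solution, and the `L¹` bound
on the functional becomes an `L^∞` bound on its representative (`exists_weakSolution`).

Uniqueness needs dissipativity for `u ∈ L²` with `Lu = g ∈ L²` only in the sense of distributions
(`integral_mul_nonpos_of_weak_landau`). The test function is `ρ * (χ² (ρ * u))` with a mollifier `ρ`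
and a cut-off `χ`. The Friedrichs commutator pairs the gradient of `χ² (ρ * u)` with an error that
tends to zero; the gradient is absorbed by the Dirichlet form, as `A` is positive definite on
compact sets. The cut-off costs `sup A∇χ·∇χ`, which tends to zero as the radius grows because `γ <
0`. For the difference `d` of two solutions, the second time primitive `K` satisfies `K' = LK`
weakly with `K(0) = 0`, so `‖K‖²` is nonincreasing and `K`, hence `d`, vanishes
(`ae_eq_zero_of_weak`). -/

noncomputable section

namespace LinearLandau

open Filter Topology

/-! ### Convolution with kernels bounded by a power of the norm -/

/-- The singular part of `‖z‖ ^ p`, supported in the unit ball. -/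
def singPart (p : ℝ) : V3 → ℝ := (Metric.closedBall (0 : V3) 1).indicator (fun z => ‖z‖ ^ p)

lemma singPart_nonneg (p : ℝ) (z : V3) : 0 ≤ singPart p z :=
  indicator_nonneg (fun z _ => Real.rpow_nonneg (norm_nonneg z) p) z

lemma finrank_V3 : Module.finrank ℝ V3 = 3 := by simp

lemma integrable_singPart {p : ℝ} (hp : -3 < p) : Integrable (singPart p) := by
  have h : singPart p = fun z : V3 => (Iic (1 : ℝ)).indicator (fun r => r ^ p) ‖z‖ := by
    funext z
    simp [singPart, indicator, Metric.mem_closedBall, dist_zero_right]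
  rw [h, integrable_fun_norm_addHaar, finrank_V3]
  have h1 : IntegrableOn (fun y : ℝ => y ^ (p + 2)) (Ioc 0 1) := by
    have := intervalIntegral.intervalIntegrable_rpow' (a := 0) (b := 1) (r := p + 2) (by linarith)
    rwa [intervalIntegrable_iff_integrableOn_Ioc_of_le zero_le_one] at this
  have h2 : IntegrableOn ((Ioc (0 : ℝ) 1).indicator (fun y : ℝ => y ^ (p + 2))) (Ioi 0) :=
    (h1.integrable_indicator measurableSet_Ioc).integrableOn
  refine h2.congr_fun ?_ measurableSet_Ioi
  intro y hy
  have hy' : 0 < y := hy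
  by_cases h1 : y ≤ 1
  · simp only [indicator, mem_Ioc, hy', h1, and_self, if_true, mem_Iic, smul_eq_mul]
    rw [Real.rpow_add hy', mul_comm]
    norm_num
  · simp [indicator, h1]

lemma one_add_norm_pos (v : V3) : 0 < 1 + ‖v‖ := by positivity

lemma integrable_one_add_norm_rpow {p : ℝ} (hp : p < -3) :
    Integrable (fun w : V3 => (1 + ‖w‖) ^ p) := by
  have := integrable_one_add_norm (E := V3) (μ := volume) (r := -p) (by rw [finrank_V3]; norm_num; linarith)
  simpa using this

/-- Peetre's inequality `1+|v| ≤ (1+|w|)(1+|v-w|)` trades the weight in `v-w` for one in `v` when `p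
< 0`. The constant `8 = 2³` is a bound for `2^(-p)`, the cost of comparing `|z|` with `1+|z|`
outside the unit ball; inside it `singPart` carries the singularity. -/
lemma norm_sub_rpow_le {p : ℝ} (hp : -3 ≤ p) (v w : V3) :
    ‖v - w‖ ^ p ≤ 8 * (1 + ‖v‖) ^ p * (1 + ‖w‖) ^ |p| * (1 + singPart p (v - w)) := by
  have hs := singPart_nonneg p (v - w)
  have hv := one_add_norm_pos v
  have hw := one_add_norm_pos w
  rcases le_or_gt 0 p with h0 | h0
  · rw [abs_of_nonneg h0]
    have h1 : ‖v - w‖ ≤ (1 + ‖v‖) * (1 + ‖w‖) := by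
      nlinarith [norm_sub_le v w, norm_nonneg v, norm_nonneg w, mul_nonneg (norm_nonneg v) (norm_nonneg w)]
    have h2 : ‖v - w‖ ^ p ≤ (1 + ‖v‖) ^ p * (1 + ‖w‖) ^ p := by
      rw [← Real.mul_rpow hv.le hw.le]
      exact Real.rpow_le_rpow (norm_nonneg _) h1 h0
    have h3 : 0 ≤ (1 + ‖v‖) ^ p * (1 + ‖w‖) ^ p := by positivity
    nlinarith [mul_nonneg h3 hs]
  · rw [abs_of_neg h0]
    set z := v - w with hz
    have hz1 := one_add_norm_pos z
    have h1 : (1 + ‖v‖) ≤ (1 + ‖w‖) * (1 + ‖z‖) := by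
      have : ‖v‖ ≤ ‖w‖ + ‖z‖ := by
        have := norm_add_le w z
        rwa [hz, add_sub_cancel] at this
      nlinarith [norm_nonneg z, norm_nonneg w, mul_nonneg (norm_nonneg z) (norm_nonneg w)]
    have h2 : (1 + ‖w‖) ^ p * (1 + ‖z‖) ^ p ≤ (1 + ‖v‖) ^ p := by
      rw [← Real.mul_rpow hw.le hz1.le]
      exact Real.rpow_le_rpow_of_nonpos hv h1 h0.le
    have h3 : (1 + ‖z‖) ^ p ≤ (1 + ‖v‖) ^ p * (1 + ‖w‖) ^ (-p) := by
      have : (1 + ‖w‖) ^ p * (1 + ‖w‖) ^ (-p) = 1 := by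
        rw [← Real.rpow_add hw]; simp
      calc (1 + ‖z‖) ^ p = ((1 + ‖w‖) ^ p * (1 + ‖z‖) ^ p) * (1 + ‖w‖) ^ (-p) := by
            rw [mul_comm ((1 + ‖w‖) ^ p), mul_assoc, this, mul_one]
        _ ≤ _ := by gcongr
    have h8 : (8 : ℝ)⁻¹ ≤ 2 ^ p := by
      calc (8 : ℝ)⁻¹ = 2 ^ (-3 : ℝ) := by rw [Real.rpow_neg (by norm_num)]; norm_num
        _ ≤ 2 ^ p := Real.rpow_le_rpow_of_exponent_le (by norm_num) hp
    have h4 : ‖z‖ ^ p ≤ 8 * (1 + ‖z‖) ^ p * (1 + singPart p z) := by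
      rcases le_or_gt ‖z‖ 1 with hz' | hz'
      · have e : singPart p z = ‖z‖ ^ p := by
          rw [singPart, indicator_of_mem]; simpa using hz'
        have : 2 ^ p ≤ (1 + ‖z‖) ^ p :=
          Real.rpow_le_rpow_of_nonpos hz1 (by linarith) h0.le
        rw [e]
        have hn : 0 ≤ ‖z‖ ^ p := Real.rpow_nonneg (norm_nonneg _) _
        have : 1 ≤ 8 * (1 + ‖z‖) ^ p := by linarith
        nlinarith
      · have : (2 * ‖z‖) ^ p ≤ (1 + ‖z‖) ^ p :=
          Real.rpow_le_rpow_of_nonpos hz1 (by linarith) h0.le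
        rw [Real.mul_rpow (by norm_num) (norm_nonneg _)] at this
        have hn : 0 ≤ ‖z‖ ^ p := Real.rpow_nonneg (norm_nonneg _) _
        have h5 : ‖z‖ ^ p ≤ 8 * (1 + ‖z‖) ^ p := by nlinarith
        have h6 : 0 ≤ 8 * (1 + ‖z‖) ^ p := by positivity
        nlinarith [mul_nonneg h6 hs]
    calc ‖z‖ ^ p ≤ 8 * (1 + ‖z‖) ^ p * (1 + singPart p z) := h4
      _ ≤ 8 * ((1 + ‖v‖) ^ p * (1 + ‖w‖) ^ (-p)) * (1 + singPart p z) := by gcongr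
      _ = _ := by ring

lemma measurable_norm_rpow (p : ℝ) : Measurable (fun z : V3 => ‖z‖ ^ p) :=
  measurable_norm.pow_const p

/-- Of the decay of order 10, at most 5 is spent on `(1+|w|)^|p|`. The remaining order 5 exceeds the
dimension, hence is integrable, and it is at most 1 next to the integrable singular part. -/
lemma riesz_bound {p : ℝ} (hp : -3 < p) (hp' : p ≤ 5) : ∃ C : ℝ, 0 < C ∧ ∀ v : V3,
    Integrable (fun w : V3 => ‖v - w‖ ^ p * (1 + ‖w‖) ^ (-10 : ℝ)) ∧
    ∫ w : V3, ‖v - w‖ ^ p * (1 + ‖w‖) ^ (-10 : ℝ) ≤ C * (1 + ‖v‖) ^ p := by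
  set I5 := ∫ w : V3, (1 + ‖w‖) ^ (-5 : ℝ)
  set Ip := ∫ w : V3, singPart p w
  have i5 : Integrable (fun w : V3 => (1 + ‖w‖) ^ (-5 : ℝ)) := integrable_one_add_norm_rpow (by norm_num)
  have ip := integrable_singPart hp
  have hI5 : 0 ≤ I5 := integral_nonneg fun w => by positivity
  have hIp : 0 ≤ Ip := integral_nonneg fun w => singPart_nonneg p w
  have key : ∀ v w : V3, ‖v - w‖ ^ p * (1 + ‖w‖) ^ (-10 : ℝ) ≤
      8 * (1 + ‖v‖) ^ p * ((1 + ‖w‖) ^ (-5 : ℝ) + singPart p (v - w)) := by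
    intro v w
    have hs := singPart_nonneg p (v - w)
    have hw := one_add_norm_pos w
    have hw1 : 1 ≤ 1 + ‖w‖ := by linarith [norm_nonneg w]
    have a1 : (1 + ‖w‖) ^ |p| * (1 + ‖w‖) ^ (-10 : ℝ) ≤ (1 + ‖w‖) ^ (-5 : ℝ) := by
      rw [← Real.rpow_add hw]
      apply Real.rpow_le_rpow_of_exponent_le hw1
      have : |p| ≤ 5 := abs_le.2 ⟨by linarith, hp'⟩
      linarith
    have a2 : (1 + ‖w‖) ^ (-5 : ℝ) ≤ 1 := Real.rpow_le_one_of_one_le_of_nonpos hw1 (by norm_num)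
    have a3 : 0 ≤ (1 + ‖v‖) ^ p := by positivity
    calc ‖v - w‖ ^ p * (1 + ‖w‖) ^ (-10 : ℝ)
        ≤ (8 * (1 + ‖v‖) ^ p * (1 + ‖w‖) ^ |p| * (1 + singPart p (v - w))) * (1 + ‖w‖) ^ (-10 : ℝ) := by
          gcongr; exact norm_sub_rpow_le hp.le v w
      _ = 8 * (1 + ‖v‖) ^ p * (((1 + ‖w‖) ^ |p| * (1 + ‖w‖) ^ (-10 : ℝ)) * (1 + singPart p (v - w))) := by ring
      _ ≤ 8 * (1 + ‖v‖) ^ p * ((1 + ‖w‖) ^ (-5 : ℝ) * (1 + singPart p (v - w))) := by gcongr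
      _ ≤ _ := by
        gcongr
        nlinarith
  have hint : ∀ v : V3, Integrable (fun w : V3 => 8 * (1 + ‖v‖) ^ p * ((1 + ‖w‖) ^ (-5 : ℝ) + singPart p (v - w))) :=
    fun v => ((i5.add (ip.comp_sub_left v)).const_mul _)
  refine ⟨8 * (I5 + Ip) + 1, by positivity, fun v => ?_⟩
  have hm : AEStronglyMeasurable (fun w : V3 => ‖v - w‖ ^ p * (1 + ‖w‖) ^ (-10 : ℝ)) := by
    apply Measurable.aestronglyMeasurable
    exact ((measurable_norm_rpow p).comp (measurable_const.sub measurable_id)).mul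
      ((measurable_const.add measurable_norm).pow_const _)
  have hi : Integrable (fun w : V3 => ‖v - w‖ ^ p * (1 + ‖w‖) ^ (-10 : ℝ)) := by
    refine (hint v).mono' hm (Filter.Eventually.of_forall fun w => ?_)
    rw [Real.norm_of_nonneg (by positivity)]
    exact key v w
  refine ⟨hi, ?_⟩
  calc _ ≤ ∫ w : V3, 8 * (1 + ‖v‖) ^ p * ((1 + ‖w‖) ^ (-5 : ℝ) + singPart p (v - w)) :=
        integral_mono hi (hint v) (key v)
    _ = 8 * (1 + ‖v‖) ^ p * (I5 + Ip) := by
        rw [integral_const_mul, integral_add i5 (ip.comp_sub_left v), integral_sub_left_eq_self (singPart p)]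
    _ ≤ _ := by
        have a3 : 0 ≤ (1 + ‖v‖) ^ p := by positivity
        nlinarith

/-- `h` is bounded by a multiple of `(1 + ‖w‖)⁻¹⁰`. -/
def Decays {F : Type*} [NormedAddCommGroup F] (h : V3 → F) : Prop :=
  ∃ C : ℝ, ∀ w, ‖h w‖ ≤ C * (1 + ‖w‖) ^ (-10 : ℝ)

/-- `k` is measurable and bounded by a multiple of `‖z‖ ^ p`. -/
def RieszLike (p : ℝ) (k : V3 → ℝ) : Prop :=
  Measurable k ∧ ∃ C : ℝ, ∀ z, |k z| ≤ C * ‖z‖ ^ p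

/-- The convolution of a scalar kernel with a vector valued function. -/
def kconv {F : Type*} [NormedAddCommGroup F] [NormedSpace ℝ F] (k : V3 → ℝ) (h : V3 → F) (v : V3) : F :=
  ∫ w, k (v - w) • h w

section conv
variable {F : Type*} [NormedAddCommGroup F] [NormedSpace ℝ F]

/-- In this form `v` enters only through the regular factor `h`, so that derivatives in `v` never
meet the singularity of `k`. -/
lemma kconv_eq (k : V3 → ℝ) (h : V3 → F) (v : V3) : kconv k h v = ∫ z, k z • h (v - z) := by
  rw [kconv, ← integral_sub_left_eq_self (fun z => k z • h (v - z)) volume v]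
  simp

lemma one_add_norm_rpow_shift {v v₀ : V3} (h : ‖v - v₀‖ ≤ 1) (z : V3) :
    (1 + ‖v - z‖) ^ (-10 : ℝ) ≤ 2 ^ (10 : ℝ) * (1 + ‖v₀ - z‖) ^ (-10 : ℝ) := by
  have h1 : 1 + ‖v₀ - z‖ ≤ 2 * (1 + ‖v - z‖) := by
    have : ‖v₀ - z‖ ≤ ‖v₀ - v‖ + ‖v - z‖ := by simpa using norm_add_le (v₀ - v) (v - z)
    rw [norm_sub_rev v₀ v] at this
    linarith [norm_nonneg (v - z)]
  have h2 := Real.rpow_le_rpow_of_nonpos (one_add_norm_pos (v₀ - z)) h1 (z := -10) (by norm_num)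
  rw [Real.mul_rpow (by norm_num) (by positivity)] at h2
  have h3 : (2 : ℝ) ^ (10 : ℝ) * 2 ^ (-10 : ℝ) = 1 := by
    rw [← Real.rpow_add (by norm_num)]; norm_num
  calc (1 + ‖v - z‖) ^ (-10 : ℝ) = 2 ^ (10 : ℝ) * (2 ^ (-10 : ℝ) * (1 + ‖v - z‖) ^ (-10 : ℝ)) := by
        rw [← mul_assoc, h3, one_mul]
    _ ≤ _ := by gcongr

variable {p : ℝ} {k : V3 → ℝ} {h : V3 → F}

lemma kconv_bound_integrable (hp : -3 < p) (hp' : p ≤ 5) (C : ℝ) (v : V3) :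
    Integrable (fun z : V3 => C * (‖z‖ ^ p * (1 + ‖v - z‖) ^ (-10 : ℝ))) := by
  obtain ⟨_, _, hC⟩ := riesz_bound hp hp'
  have := ((hC v).1.comp_sub_left v).const_mul C
  simpa using this

lemma integrable_kconv (hp : -3 < p) (hp' : p ≤ 5) (hk : RieszLike p k) (hc : Continuous h)
    (hd : Decays h) (v : V3) : Integrable (fun w => k (v - w) • h w) := by
  obtain ⟨hkm, C, hC⟩ := hk
  obtain ⟨D, hD⟩ := hd
  obtain ⟨_, _, hR⟩ := riesz_bound hp hp'
  refine ((hR v).1.const_mul (C * D)).mono' ?_ (Filter.Eventually.of_forall fun w => ?_)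
  · exact (hkm.comp (measurable_const.sub measurable_id)).aestronglyMeasurable.smul hc.aestronglyMeasurable
  · rw [norm_smul, Real.norm_eq_abs]
    calc _ ≤ (C * ‖v - w‖ ^ p) * (D * (1 + ‖w‖) ^ (-10 : ℝ)) :=
          mul_le_mul (hC _) (hD w) (norm_nonneg _) ((abs_nonneg _).trans (hC _))
      _ = _ := by ring

lemma norm_kconv_le (hp : -3 < p) (hp' : p ≤ 5) (hk : RieszLike p k) (hc : Continuous h)
    (hd : Decays h) : ∃ C : ℝ, 0 < C ∧ ∀ v, ‖kconv k h v‖ ≤ C * (1 + ‖v‖) ^ p := by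
  obtain ⟨M, hM, hR⟩ := riesz_bound hp hp'
  have hi := integrable_kconv hp hp' hk hc hd
  obtain ⟨hkm, C, hC⟩ := hk
  obtain ⟨D, hD⟩ := hd
  refine ⟨|C * D| * M + 1, by positivity, fun v => ?_⟩
  have hb : ∀ w, ‖k (v - w) • h w‖ ≤ |C * D| * (‖v - w‖ ^ p * (1 + ‖w‖) ^ (-10 : ℝ)) := by
    intro w
    rw [norm_smul, Real.norm_eq_abs]
    calc _ ≤ (C * ‖v - w‖ ^ p) * (D * (1 + ‖w‖) ^ (-10 : ℝ)) :=
          mul_le_mul (hC _) (hD w) (norm_nonneg _) ((abs_nonneg _).trans (hC _))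
      _ = (C * D) * (‖v - w‖ ^ p * (1 + ‖w‖) ^ (-10 : ℝ)) := by ring
      _ ≤ _ := by gcongr; exact le_abs_self _
  calc ‖kconv k h v‖ ≤ ∫ w, ‖k (v - w) • h w‖ := norm_integral_le_integral_norm _
    _ ≤ ∫ w, |C * D| * (‖v - w‖ ^ p * (1 + ‖w‖) ^ (-10 : ℝ)) :=
        integral_mono (hi v).norm ((hR v).1.const_mul _) hb
    _ = |C * D| * ∫ w, (‖v - w‖ ^ p * (1 + ‖w‖) ^ (-10 : ℝ)) := integral_const_mul _ _
    _ ≤ |C * D| * (M * (1 + ‖v‖) ^ p) := by gcongr; exact (hR v).2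
    _ ≤ _ := by
      have : 0 ≤ (1 + ‖v‖) ^ p := by positivity
      nlinarith

/-- One integrable majorant serves all `v` in a unit ball, as continuity and differentiation under
the integral require. The factor `2^10` is the change of the weight under a shift of length at most
1. -/
lemma kconv_dominated (hk : RieszLike p k) (hd : Decays h) (v₀ : V3) :
    ∃ C : ℝ, ∀ v ∈ Metric.ball v₀ 1, ∀ z,
      ‖k z • h (v - z)‖ ≤ C * (‖z‖ ^ p * (1 + ‖v₀ - z‖) ^ (-10 : ℝ)) := by
  obtain ⟨hkm, C, hC⟩ := hk
  obtain ⟨D, hD⟩ := hd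
  have hD0 : 0 ≤ D := by
    have := (norm_nonneg _).trans (hD 0)
    simpa using this
  refine ⟨C * D * 2 ^ (10 : ℝ), fun v hv z => ?_⟩
  rw [norm_smul, Real.norm_eq_abs]
  have hv' : ‖v - v₀‖ ≤ 1 := by
    rw [Metric.mem_ball, dist_eq_norm] at hv; exact hv.le
  calc |k z| * ‖h (v - z)‖
      ≤ (C * ‖z‖ ^ p) * (D * (2 ^ (10 : ℝ) * (1 + ‖v₀ - z‖) ^ (-10 : ℝ))) := by
        refine mul_le_mul (hC _) ((hD _).trans ?_) (norm_nonneg _) ((abs_nonneg _).trans (hC _))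
        gcongr
        exact one_add_norm_rpow_shift hv' z
    _ = _ := by ring

lemma continuous_kconv (hp : -3 < p) (hp' : p ≤ 5) (hk : RieszLike p k) (hc : Continuous h)
    (hd : Decays h) : Continuous (kconv k h) := by
  have e : kconv k h = fun v => ∫ z, k z • h (v - z) := funext (kconv_eq k h)
  rw [e, continuous_iff_continuousAt]
  intro v₀
  obtain ⟨C, hC⟩ := kconv_dominated hk hd v₀
  refine continuousAt_of_dominated (Filter.Eventually.of_forall fun v => ?_)
    (bound := fun z => C * (‖z‖ ^ p * (1 + ‖v₀ - z‖) ^ (-10 : ℝ))) ?_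
    (kconv_bound_integrable hp hp' C v₀) (Filter.Eventually.of_forall fun z => ?_)
  · exact hk.1.aestronglyMeasurable.smul (hc.comp (continuous_const.sub continuous_id)).aestronglyMeasurable
  · filter_upwards [Metric.ball_mem_nhds v₀ one_pos] with v hv
    exact Filter.Eventually.of_forall (hC v hv)
  · exact ((hc.comp (continuous_id.sub continuous_const)).continuousAt).const_smul _

lemma hasFDerivAt_kconv [CompleteSpace F] (hp : -3 < p) (hp' : p ≤ 5) (hk : RieszLike p k) (hc : ContDiff ℝ 1 h)
    (hd : Decays h) (hd' : Decays (fderiv ℝ h)) (v₀ : V3) :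
    HasFDerivAt (kconv k h) (kconv k (fderiv ℝ h) v₀) v₀ := by
  have e : kconv k h = fun v => ∫ z, k z • h (v - z) := funext (kconv_eq k h)
  rw [e, kconv_eq]
  have hcf : Continuous (fderiv ℝ h) := hc.continuous_fderiv one_ne_zero
  obtain ⟨C, hC⟩ := kconv_dominated hk hd' v₀
  refine hasFDerivAt_integral_of_dominated_of_fderiv_le (𝕜 := ℝ) (F := fun v z => k z • h (v - z))
    (F' := fun v z => k z • fderiv ℝ h (v - z))
    (bound := fun z => C * (‖z‖ ^ p * (1 + ‖v₀ - z‖) ^ (-10 : ℝ)))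
    (Metric.ball_mem_nhds v₀ one_pos) (Filter.Eventually.of_forall fun v => ?_) ?_ ?_
    (Filter.Eventually.of_forall fun z v hv => hC v hv z)
    (kconv_bound_integrable hp hp' C v₀) (Filter.Eventually.of_forall fun z v hv => ?_)
  · exact hk.1.aestronglyMeasurable.smul
      (hc.continuous.comp (continuous_const.sub continuous_id)).aestronglyMeasurable
  · have := (integrable_kconv hp hp' hk hc.continuous hd v₀).comp_sub_left v₀
    simpa using this
  · exact hk.1.aestronglyMeasurable.smul
      (hcf.comp (continuous_const.sub continuous_id)).aestronglyMeasurable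
  · have h1 : HasFDerivAt h (fderiv ℝ h (v - z)) (v - z) :=
      (hc.differentiable (by norm_num) _).hasFDerivAt
    have h2 : HasFDerivAt (fun v => h (v - z)) (fderiv ℝ h (v - z)) v := by
      have := h1.comp v (f := fun v => v - z) ((hasFDerivAt_id v).sub_const z)
      rwa [ContinuousLinearMap.comp_id] at this
    exact h2.const_smul _

end conv

section scalar
variable {p : ℝ} {k h : V3 → ℝ}

lemma Decays.pd {h : V3 → ℝ} (hd' : Decays (fderiv ℝ h)) (i : Fin 3) : Decays (pd i h) := by
  obtain ⟨C, hC⟩ := hd'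
  refine ⟨C, fun w => ?_⟩
  have := (fderiv ℝ h w).le_opNorm (EuclideanSpace.single i 1)
  simp only [PiLp.norm_single, norm_one, mul_one] at this
  exact this.trans (hC w)

lemma contDiff_kconv (hp : -3 < p) (hp' : p ≤ 5) (hk : RieszLike p k) (hc : ContDiff ℝ 1 h)
    (hd : Decays h) (hd' : Decays (fderiv ℝ h)) : ContDiff ℝ 1 (kconv k h) := by
  rw [contDiff_one_iff_fderiv]
  refine ⟨fun v => (hasFDerivAt_kconv hp hp' hk hc hd hd' v).differentiableAt, ?_⟩
  have e : fderiv ℝ (kconv k h) = kconv k (fderiv ℝ h) :=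
    funext fun v => (hasFDerivAt_kconv hp hp' hk hc hd hd' v).fderiv
  rw [e]
  exact continuous_kconv hp hp' hk (hc.continuous_fderiv one_ne_zero) hd'

lemma pd_kconv (hp : -3 < p) (hp' : p ≤ 5) (hk : RieszLike p k) (hc : ContDiff ℝ 1 h)
    (hd : Decays h) (hd' : Decays (fderiv ℝ h)) (i : Fin 3) (v : V3) :
    pd i (kconv k h) v = kconv k (pd i h) v := by
  rw [pd, (hasFDerivAt_kconv hp hp' hk hc hd hd' v).fderiv, kconv,
    ContinuousLinearMap.integral_apply (integrable_kconv hp hp' hk (hc.continuous_fderiv one_ne_zero) hd' v)]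
  rfl

end scalar

/-! ### Functions of polynomial growth -/

/-- Polynomial growth of a function on `ℝ³`. -/
def PolyBound {F : Type*} [NormedAddCommGroup F] (q : V3 → F) : Prop :=
  ∃ (C : ℝ) (n : ℕ), ∀ w, ‖q w‖ ≤ C * (1 + ‖w‖) ^ n

lemma PolyBound.nonneg {F : Type*} [NormedAddCommGroup F] {q : V3 → F} (h : PolyBound q) :
    ∃ (C : ℝ) (n : ℕ), 0 ≤ C ∧ ∀ w, ‖q w‖ ≤ C * (1 + ‖w‖) ^ n := by
  obtain ⟨C, n, h⟩ := h
  refine ⟨|C|, n, abs_nonneg _, fun w => (h w).trans ?_⟩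
  gcongr
  exact le_abs_self C

lemma PolyBound.const {F : Type*} [NormedAddCommGroup F] (c : F) : PolyBound (fun _ : V3 => c) :=
  ⟨‖c‖, 0, fun w => by simp⟩

lemma PolyBound.add {F : Type*} [NormedAddCommGroup F] {q r : V3 → F} (hq : PolyBound q)
    (hr : PolyBound r) : PolyBound (fun w => q w + r w) := by
  obtain ⟨C, n, hC, h⟩ := hq.nonneg
  obtain ⟨D, m, hD, h'⟩ := hr.nonneg
  refine ⟨C + D, n + m, fun w => (norm_add_le _ _).trans ?_⟩
  have h1 : (1 : ℝ) ≤ 1 + ‖w‖ := by linarith [norm_nonneg w]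
  have e1 : (1 + ‖w‖) ^ n ≤ (1 + ‖w‖) ^ (n + m) := pow_le_pow_right₀ h1 (by omega)
  have e2 : (1 + ‖w‖) ^ m ≤ (1 + ‖w‖) ^ (n + m) := pow_le_pow_right₀ h1 (by omega)
  nlinarith [h w, h' w, mul_le_mul_of_nonneg_left e1 hC, mul_le_mul_of_nonneg_left e2 hD]

lemma PolyBound.smul {F : Type*} [NormedAddCommGroup F] [NormedSpace ℝ F] {q : V3 → ℝ} {r : V3 → F}
    (hq : PolyBound q) (hr : PolyBound r) : PolyBound (fun w => q w • r w) := by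
  obtain ⟨C, n, hC, h⟩ := hq.nonneg
  obtain ⟨D, m, hD, h'⟩ := hr.nonneg
  refine ⟨C * D, n + m, fun w => ?_⟩
  rw [norm_smul]
  calc _ ≤ (C * (1 + ‖w‖) ^ n) * (D * (1 + ‖w‖) ^ m) :=
        mul_le_mul (h w) (h' w) (norm_nonneg _) (by positivity)
    _ = _ := by ring

lemma PolyBound.mul {q r : V3 → ℝ} (hq : PolyBound q) (hr : PolyBound r) :
    PolyBound (fun w => q w * r w) := hq.smul hr

lemma PolyBound.neg {q : V3 → ℝ} (hq : PolyBound q) : PolyBound (fun w => -q w) := by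
  obtain ⟨C, n, h⟩ := hq
  exact ⟨C, n, fun w => by rw [norm_neg]; exact h w⟩

lemma PolyBound.sub {q r : V3 → ℝ} (hq : PolyBound q) (hr : PolyBound r) :
    PolyBound (fun w => q w - r w) := by
  simpa [sub_eq_add_neg] using hq.add hr.neg

lemma PolyBound.mono {F G : Type*} [NormedAddCommGroup F] [NormedAddCommGroup G] {q : V3 → F}
    {r : V3 → G} (hq : PolyBound q) (h : ∀ w, ‖r w‖ ≤ ‖q w‖) : PolyBound r := by
  obtain ⟨C, n, hq⟩ := hq
  exact ⟨C, n, fun w => (h w).trans (hq w)⟩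

lemma PolyBound.norm_id : PolyBound (fun w : V3 => ‖w‖) :=
  ⟨1, 1, fun w => by simp⟩

lemma abs_coord_le (w : V3) (i : Fin 3) : |w i| ≤ ‖w‖ := PiLp.norm_apply_le w i

lemma PolyBound.coord (i : Fin 3) : PolyBound (fun w : V3 => w i) :=
  PolyBound.norm_id.mono fun w => by simpa using abs_coord_le w i

lemma exists_pow_mul_exp_le (n : ℕ) :
    ∃ C : ℝ, 0 ≤ C ∧ ∀ r : ℝ, 0 ≤ r → (1 + r) ^ n * Real.exp (-r ^ 2 / 2) ≤ C := by
  refine ⟨n.factorial * Real.exp 2, by positivity, fun r hr => ?_⟩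
  have h1 : (1 + r) ^ n / n.factorial ≤ Real.exp (1 + r) := Real.pow_div_factorial_le_exp _ (by linarith) n
  rw [div_le_iff₀ (by positivity)] at h1
  calc (1 + r) ^ n * Real.exp (-r ^ 2 / 2) ≤ (Real.exp (1 + r) * n.factorial) * Real.exp (-r ^ 2 / 2) := by
        gcongr
    _ = n.factorial * Real.exp (1 + r + -r ^ 2 / 2) := by
        rw [Real.exp_add (1 + r)]; ring
    _ ≤ _ := by
        gcongr
        nlinarith [sq_nonneg (r - 1)]

/-! ### The Maxwellian and rules for partial derivatives -/

lemma maxwellian_nonneg (v : V3) : 0 ≤ maxwellian v := by unfold maxwellian; positivity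
lemma maxwellian_pos (v : V3) : 0 < maxwellian v := by unfold maxwellian; positivity

lemma PolyBound.decays {F : Type*} [NormedAddCommGroup F] [NormedSpace ℝ F] {q : V3 → F} (hq : PolyBound q) :
    Decays (fun w => maxwellian w • q w) := by
  obtain ⟨C, n, hC, h⟩ := hq.nonneg
  obtain ⟨M, hM, hexp⟩ := exists_pow_mul_exp_le (n + 10)
  set c : ℝ := (2 * Real.pi) ^ (-(3 / 2) : ℝ)
  have hc : 0 ≤ c := by positivity
  refine ⟨c * C * M, fun w => ?_⟩
  have hw := one_add_norm_pos w
  rw [norm_smul, Real.norm_of_nonneg (maxwellian_nonneg w), maxwellian, Real.rpow_neg hw.le]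
  have e : (1 + ‖w‖) ^ (10 : ℝ) = (1 + ‖w‖) ^ 10 := by norm_cast
  rw [e, ← div_eq_mul_inv, le_div_iff₀ (by positivity)]
  calc c * Real.exp (-‖w‖ ^ 2 / 2) * ‖q w‖ * (1 + ‖w‖) ^ 10
      ≤ c * Real.exp (-‖w‖ ^ 2 / 2) * (C * (1 + ‖w‖) ^ n) * (1 + ‖w‖) ^ 10 := by gcongr; exact h w
    _ = c * C * ((1 + ‖w‖) ^ (n + 10) * Real.exp (-‖w‖ ^ 2 / 2)) := by ring
    _ ≤ _ := by gcongr; exact hexp _ (norm_nonneg w)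

lemma Decays.integrable {F : Type*} [NormedAddCommGroup F] {h : V3 → F} (hd : Decays h)
    (hc : AEStronglyMeasurable h) : Integrable h := by
  obtain ⟨C, hC⟩ := hd
  exact ((integrable_one_add_norm_rpow (p := -10) (by norm_num)).const_mul C).mono' hc
    (Filter.Eventually.of_forall hC)

lemma hasFDerivAt_maxwellian (w : V3) :
    HasFDerivAt maxwellian (-(maxwellian w) • innerSL ℝ w) w := by
  have h1 : HasFDerivAt (fun w : V3 => ‖w‖ ^ 2) (2 • innerSL ℝ w) w :=
    (hasStrictFDerivAt_norm_sq w).hasFDerivAt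
  have h3 := ((h1.const_mul (-1 / 2 : ℝ)).exp).const_mul ((2 * Real.pi) ^ (-(3 / 2) : ℝ))
  have e : maxwellian = fun w : V3 => (2 * Real.pi) ^ (-(3 / 2) : ℝ) * Real.exp (-1 / 2 * ‖w‖ ^ 2) := by
    funext w
    rw [maxwellian]
    congr 2
    ring
  rw [e]
  refine h3.congr_fderiv ?_
  ext x
  simp
  ring

lemma contDiff_maxwellian : ContDiff ℝ 1 maxwellian := by
  unfold maxwellian
  exact contDiff_const.mul (((contDiff_norm_sq ℝ).neg.div_const 2).exp)

lemma pd_eq_of_hasFDerivAt {f : V3 → ℝ} {f' : V3 →L[ℝ] ℝ} {v : V3} (h : HasFDerivAt f f' v) (i : Fin 3) :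
    pd i f v = f' (EuclideanSpace.single i 1) := by
  rw [pd, h.fderiv]

lemma pd_maxwellian (i : Fin 3) (w : V3) : pd i maxwellian w = -(w i * maxwellian w) := by
  rw [pd_eq_of_hasFDerivAt (hasFDerivAt_maxwellian w)]
  simp [EuclideanSpace.inner_single_right]
  ring

lemma decays_maxwellian : Decays maxwellian := by
  simpa using (PolyBound.const (1 : ℝ)).decays

lemma fderiv_maxwellian_mul {q : V3 → ℝ} (hq : Differentiable ℝ q) (w : V3) :
    fderiv ℝ (fun w => maxwellian w * q w) w
      = maxwellian w • (fderiv ℝ q w - q w • innerSL ℝ w) := by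
  rw [((hasFDerivAt_maxwellian w).fun_mul (hq w).hasFDerivAt).fderiv]
  ext x
  simp
  ring

lemma decays_fderiv_maxwellian_mul {q : V3 → ℝ} (hq : Differentiable ℝ q) (hb : PolyBound q)
    (hb' : PolyBound (fderiv ℝ q)) : Decays (fderiv ℝ (fun w => maxwellian w * q w)) := by
  have : fderiv ℝ (fun w => maxwellian w * q w) = fun w => maxwellian w • (fderiv ℝ q w - q w • innerSL ℝ w) :=
    funext fun w => fderiv_maxwellian_mul hq w
  rw [this]
  apply PolyBound.decays
  have h2 : PolyBound (fun w : V3 => -q w • innerSL ℝ w) :=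
    hb.neg.smul (PolyBound.norm_id.mono fun w => by simp)
  convert hb'.add h2 using 2
  rw [neg_smul, sub_eq_add_neg]

lemma decays_fderiv_maxwellian : Decays (fderiv ℝ maxwellian) := by
  have h0 : PolyBound (fderiv ℝ (fun _ : V3 => (1 : ℝ))) := ⟨0, 0, fun w => by simp⟩
  simpa using decays_fderiv_maxwellian_mul (differentiable_const (1 : ℝ)) (PolyBound.const 1) h0

/-- The `j`-th coordinate as a continuous linear form. -/
def coordL (j : Fin 3) : V3 →L[ℝ] ℝ := EuclideanSpace.proj j

@[simp] lemma coordL_apply (j : Fin 3) (w : V3) : coordL j w = w j := rfl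

lemma hasFDerivAt_coord (j : Fin 3) (w : V3) : HasFDerivAt (fun w : V3 => w j) (coordL j) w :=
  (coordL j).hasFDerivAt

lemma contDiff_coord (j : Fin 3) {n : WithTop ℕ∞} : ContDiff ℝ n (fun w : V3 => w j) := (coordL j).contDiff

lemma differentiable_coord (j : Fin 3) : Differentiable ℝ (fun w : V3 => w j) :=
  fun w => (hasFDerivAt_coord j w).differentiableAt

lemma pd_coord (i j : Fin 3) (w : V3) : pd i (fun w : V3 => w j) w = if i = j then 1 else 0 := by
  rw [pd_eq_of_hasFDerivAt (hasFDerivAt_coord j w)]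
  simp [coordL_apply, eq_comm]

lemma pd_mul {f g : V3 → ℝ} {v : V3} (hf : DifferentiableAt ℝ f v) (hg : DifferentiableAt ℝ g v) (i : Fin 3) :
    pd i (fun w => f w * g w) v = pd i f v * g v + f v * pd i g v := by
  rw [pd_eq_of_hasFDerivAt (hf.hasFDerivAt.fun_mul hg.hasFDerivAt)]
  simp [pd]
  ring

lemma pd_add {f g : V3 → ℝ} {v : V3} (hf : DifferentiableAt ℝ f v) (hg : DifferentiableAt ℝ g v) (i : Fin 3) :
    pd i (fun w => f w + g w) v = pd i f v + pd i g v := by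
  rw [pd_eq_of_hasFDerivAt (hf.hasFDerivAt.fun_add hg.hasFDerivAt)]
  simp [pd]

lemma pd_const_mul {g : V3 → ℝ} {v : V3} (c : ℝ) (hg : DifferentiableAt ℝ g v) (i : Fin 3) :
    pd i (fun w => c * g w) v = c * pd i g v := by
  rw [pd_eq_of_hasFDerivAt (hg.hasFDerivAt.const_mul c)]
  simp [pd]

lemma pd_sum {f : Fin 3 → V3 → ℝ} {v : V3} (hf : ∀ j, DifferentiableAt ℝ (f j) v) (i : Fin 3) :
    pd i (fun w => ∑ j, f j w) v = ∑ j, pd i (f j) v := by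
  rw [pd_eq_of_hasFDerivAt (HasFDerivAt.fun_sum (u := Finset.univ) fun j _ => (hf j).hasFDerivAt)]
  simp [pd]

lemma continuous_pd {f : V3 → ℝ} (hf : ContDiff ℝ 1 f) (i : Fin 3) : Continuous (pd i f) :=
  (hf.continuous_fderiv one_ne_zero).clm_apply continuous_const

lemma decays_coord_maxwellian (j : Fin 3) : Decays (fun w : V3 => w j * maxwellian w) := by
  have := (PolyBound.coord j).decays
  simpa [mul_comm] using this

lemma fderiv_coord (j : Fin 3) : fderiv ℝ (fun w : V3 => w j) = fun _ => coordL j :=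
  funext fun w => (hasFDerivAt_coord j w).fderiv

lemma decays_fderiv_coord_maxwellian (j : Fin 3) :
    Decays (fderiv ℝ (fun w : V3 => w j * maxwellian w)) := by
  have h0 : PolyBound (fderiv ℝ (fun w : V3 => w j)) := by
    rw [fderiv_coord]; exact PolyBound.const _
  have := decays_fderiv_maxwellian_mul (differentiable_coord j) (PolyBound.coord j) h0
  simpa [mul_comm] using this

lemma contDiff_coord_maxwellian (j : Fin 3) : ContDiff ℝ 1 (fun w : V3 => w j * maxwellian w) :=
  (contDiff_coord j).mul contDiff_maxwellian

lemma pd_coord_maxwellian (i j : Fin 3) (w : V3) :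
    pd i (fun w : V3 => w j * maxwellian w) w = ((if i = j then 1 else 0) - w i * w j) * maxwellian w := by
  rw [pd_mul (differentiable_coord j w) (hasFDerivAt_maxwellian w).differentiableAt, pd_coord, pd_maxwellian]
  ring

/-! ### The Landau kernel and the diffusion matrix -/

section kernel
variable {γ : ℝ}

lemma norm_sq_three (z : V3) : ‖z‖ ^ 2 = z 0 ^ 2 + z 1 ^ 2 + z 2 ^ 2 := by
  rw [EuclideanSpace.norm_sq_eq, Fin.sum_univ_three]
  simp

lemma abs_kernel_poly_le (i j : Fin 3) (z : V3) :
    |(if i = j then ‖z‖ ^ 2 else 0) - z i * z j| ≤ 2 * ‖z‖ ^ 2 := by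
  have h1 := abs_coord_le z i
  have h2 := abs_coord_le z j
  have h3 : |z i * z j| ≤ ‖z‖ ^ 2 := by
    rw [abs_mul, sq]; exact mul_le_mul h1 h2 (abs_nonneg _) (norm_nonneg _)
  have h4 : |if i = j then ‖z‖ ^ 2 else 0| ≤ ‖z‖ ^ 2 := by
    split_ifs
    · rw [abs_of_nonneg (by positivity)]
    · simp
  calc _ ≤ |if i = j then ‖z‖ ^ 2 else 0| + |z i * z j| := abs_sub _ _
    _ ≤ _ := by linarith

lemma abs_kernel_le (i j : Fin 3) (z : V3) : |kernel γ i j z| ≤ 2 * ‖z‖ ^ (γ + 2) := by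
  rcases eq_or_ne z 0 with rfl | hz
  · simp [kernel]
    positivity
  · have h := abs_kernel_poly_le i j z
    have hz' : 0 < ‖z‖ := norm_pos_iff.2 hz
    rw [kernel, abs_mul, abs_of_nonneg (Real.rpow_nonneg hz'.le _), Real.rpow_add hz']
    norm_cast at h ⊢
    calc _ ≤ 2 * ‖z‖ ^ 2 * ‖z‖ ^ γ := by gcongr
      _ = _ := by ring

lemma measurable_kernel (i j : Fin 3) : Measurable (kernel γ i j) := by
  unfold kernel
  refine Measurable.mul (Measurable.sub ?_ ?_) (measurable_norm_rpow γ)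
  · split_ifs
    · exact measurable_norm.pow_const 2
    · exact measurable_const
  · exact (contDiff_coord i (n := 0)).continuous.measurable.mul (contDiff_coord j (n := 0)).continuous.measurable

lemma rieszLike_kernel (i j : Fin 3) : RieszLike (γ + 2) (kernel γ i j) :=
  ⟨measurable_kernel i j, 2, abs_kernel_le i j⟩

lemma abar_eq (i j : Fin 3) : abar γ i j = kconv (kernel γ i j) maxwellian := rfl

lemma kernel_symm (i j : Fin 3) (z : V3) : kernel γ i j z = kernel γ j i z := by
  unfold kernel
  rcases eq_or_ne i j with rfl | h
  · rfl
  · simp [h, h.symm, mul_comm]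

lemma abar_symm (i j : Fin 3) (v : V3) : abar γ i j v = abar γ j i v := by
  unfold abar; simp_rw [kernel_symm i j]

lemma sum_kernel_mul (z : V3) (x : Fin 3 → ℝ) :
    ∑ i, ∑ j, kernel γ i j z * x i * x j =
      (‖z‖ ^ 2 * (x 0 ^ 2 + x 1 ^ 2 + x 2 ^ 2) - (z 0 * x 0 + z 1 * x 1 + z 2 * x 2) ^ 2) * ‖z‖ ^ γ := by
  simp [kernel, Fin.sum_univ_three]
  ring

/-- By Lagrange's identity `|z|²|x|² - (z·x)²` is the sum of the squares of the components of `z ×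
x`. -/
lemma sum_kernel_mul_nonneg (z : V3) (x : Fin 3 → ℝ) : 0 ≤ ∑ i, ∑ j, kernel γ i j z * x i * x j := by
  rw [sum_kernel_mul, norm_sq_three]
  refine mul_nonneg ?_ (by positivity)
  nlinarith [sq_nonneg (z 0 * x 1 - z 1 * x 0), sq_nonneg (z 0 * x 2 - z 2 * x 0),
    sq_nonneg (z 1 * x 2 - z 2 * x 1)]

variable (hγ₁ : -3 < γ) (hγ₂ : γ < 0)
include hγ₁ hγ₂

lemma integrable_kernel {h : V3 → ℝ} (hc : Continuous h) (hd : Decays h) (i j : Fin 3) (v : V3) :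
    Integrable (fun w => kernel γ i j (v - w) * h w) :=
  integrable_kconv (p := γ + 2) (by linarith) (by linarith) (rieszLike_kernel i j) hc hd v

lemma contDiff_abar (i j : Fin 3) : ContDiff ℝ 1 (abar γ i j) :=
  contDiff_kconv (p := γ + 2) (by linarith) (by linarith) (rieszLike_kernel i j) contDiff_maxwellian
    decays_maxwellian decays_fderiv_maxwellian

lemma abar_bound : ∃ C : ℝ, 0 < C ∧ ∀ i j v, |abar γ i j v| ≤ C * (1 + ‖v‖) ^ (γ + 2) := by
  have h := fun i j => norm_kconv_le (p := γ + 2) (by linarith) (by linarith)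
    (rieszLike_kernel (γ := γ) i j) contDiff_maxwellian.continuous decays_maxwellian
  choose C hC h using h
  refine ⟨∑ i, ∑ j, C i j, Finset.sum_pos (fun i _ => Finset.sum_pos (fun j _ => hC i j) Finset.univ_nonempty)
    Finset.univ_nonempty, fun i j v => (h i j v).trans ?_⟩
  gcongr
  calc C i j ≤ ∑ j, C i j := Finset.single_le_sum (f := fun j => C i j) (fun j _ => (hC i j).le) (Finset.mem_univ j)
    _ ≤ _ := Finset.single_le_sum (f := fun i => ∑ j, C i j)
        (fun i _ => Finset.sum_nonneg fun j _ => (hC i j).le) (Finset.mem_univ i)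

lemma pd_abar_bound (i j k : Fin 3) : ∃ C : ℝ, 0 < C ∧ ∀ v, |pd k (abar γ i j) v| ≤ C * (1 + ‖v‖) ^ (γ + 2) := by
  obtain ⟨C, hC, h⟩ := norm_kconv_le (p := γ + 2) (by linarith) (by linarith)
    (rieszLike_kernel (γ := γ) i j) (continuous_pd contDiff_maxwellian k) (decays_fderiv_maxwellian.pd k)
  refine ⟨C, hC, fun v => ?_⟩
  rw [abar_eq, pd_kconv (p := γ + 2) (by linarith) (by linarith) (rieszLike_kernel i j) contDiff_maxwellian
    decays_maxwellian decays_fderiv_maxwellian]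
  exact h v

lemma sum_abar_mul (v : V3) (x : Fin 3 → ℝ) :
    ∑ i, ∑ j, abar γ i j v * x i * x j =
      ∫ w, (∑ i, ∑ j, kernel γ i j (v - w) * x i * x j) * maxwellian w := by
  have hi := fun i j => integrable_kernel hγ₁ hγ₂ contDiff_maxwellian.continuous decays_maxwellian i j v
  simp_rw [Finset.sum_mul]
  rw [integral_finsetSum]
  · refine Finset.sum_congr rfl fun i _ => ?_
    rw [integral_finsetSum]
    · refine Finset.sum_congr rfl fun j _ => ?_
      rw [abar, ← integral_mul_const, ← integral_mul_const]
      refine integral_congr_ae (ae_of_all _ fun w => ?_)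
      dsimp only
      ring
    · intro j _
      exact ((hi i j).mul_const (x i * x j)).congr (ae_of_all _ fun w => by dsimp only; ring)
  · intro i _
    refine integrable_finsetSum _ fun j _ => ?_
    exact ((hi i j).mul_const (x i * x j)).congr (ae_of_all _ fun w => by dsimp only; ring)

lemma sum_abar_nonneg (v : V3) (x : Fin 3 → ℝ) : 0 ≤ ∑ i, ∑ j, abar γ i j v * x i * x j := by
  rw [sum_abar_mul hγ₁ hγ₂]
  exact integral_nonneg fun w => mul_nonneg (sum_kernel_mul_nonneg _ _) (maxwellian_nonneg _)

end kernel

/-! ### The drift coefficient as a convolution -/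

/-- The zeroth order coefficient `∇·(A v/2)`. -/
def drift (γ : ℝ) (v : V3) : ℝ := ∑ i, ∑ j, pd i (fun w => abar γ i j w * (w j / 2)) v

/-- The Hessian factor `(δ_{ij} - w_i w_j)` of the Maxwellian. -/
def hessPoly (i j : Fin 3) (w : V3) : ℝ := (if i = j then 1 else 0) - w i * w j

lemma continuous_hessPoly (i j : Fin 3) : Continuous (hessPoly i j) := by
  unfold hessPoly
  exact continuous_const.sub ((contDiff_coord i (n := 0)).continuous.mul (contDiff_coord j (n := 0)).continuous)

lemma polyBound_hessPoly (i j : Fin 3) : PolyBound (hessPoly i j) :=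
  (PolyBound.const _).sub ((PolyBound.coord i).mul (PolyBound.coord j))

lemma pd_coord_maxwellian' (i j : Fin 3) :
    pd i (fun w : V3 => w j * maxwellian w) = fun w => maxwellian w * hessPoly i j w := by
  funext w
  rw [pd_coord_maxwellian, hessPoly, mul_comm]

/-- The matrix is `|z|^(γ+2)` times the projection onto the complement of `z`. -/
lemma sum_kernel_mul_coord (γ : ℝ) (i : Fin 3) (z : V3) : ∑ j, kernel γ i j z * z j = 0 := by
  have h : ∑ j, kernel γ i j z * z j = (z i * ‖z‖ ^ 2 - z i * (z 0 ^ 2 + z 1 ^ 2 + z 2 ^ 2)) * ‖z‖ ^ γ := by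
    fin_cases i <;> simp [kernel, Fin.sum_univ_three] <;> ring
  rw [h, norm_sq_three]
  ring

lemma decays_maxwellian_hess (i j : Fin 3) : Decays (fun w => maxwellian w * hessPoly i j w) :=
  (polyBound_hessPoly i j).decays

lemma continuous_maxwellian_hess (i j : Fin 3) : Continuous (fun w => maxwellian w * hessPoly i j w) :=
  contDiff_maxwellian.continuous.mul (continuous_hessPoly i j)

section
variable {γ : ℝ} (hγ₁ : -3 < γ) (hγ₂ : γ < 0)
include hγ₁ hγ₂

/-- Write `v = (v-w) + w`: the kernel at `v-w` annihilates the first summand. The growth of the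
factor `v` thus moves under the integral, where the Maxwellian absorbs it. -/
lemma sum_abar_mul_coord (i : Fin 3) (v : V3) :
    ∑ j, abar γ i j v * v j = ∑ j, kconv (kernel γ i j) (fun w => w j * maxwellian w) v := by
  rw [← sub_eq_zero, ← Finset.sum_sub_distrib]
  have hi := fun j => integrable_kernel hγ₁ hγ₂ contDiff_maxwellian.continuous decays_maxwellian i j v
  have hi' := fun j => integrable_kernel hγ₁ hγ₂ (contDiff_coord_maxwellian j).continuous
    (decays_coord_maxwellian j) i j v
  have h : ∀ j, abar γ i j v * v j - kconv (kernel γ i j) (fun w => w j * maxwellian w) v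
      = ∫ w, (kernel γ i j (v - w) * (v - w) j) * maxwellian w := by
    intro j
    simp only [abar, kconv, smul_eq_mul]
    rw [← integral_mul_const, ← integral_sub ((hi j).mul_const _) (hi' j)]
    refine integral_congr_ae (ae_of_all _ fun w => ?_)
    simp
    ring
  simp_rw [h]
  rw [← integral_finsetSum]
  · simp_rw [← Finset.sum_mul, sum_kernel_mul_coord]
    simp
  · intro j _
    exact (((hi j).mul_const (v j)).sub (hi' j)).congr (ae_of_all _ fun w => by simp; ring)

/-- Once `A v` is a convolution with `w μ(w)`, the divergence falls on that smooth factor and yields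
minus the Hessian of `μ`. -/
lemma drift_eq (v : V3) : drift γ v =
    1 / 2 * ∑ i, ∑ j, ∫ w, kernel γ i j (v - w) * (maxwellian w * hessPoly i j w) := by
  rw [drift, Finset.mul_sum]
  refine Finset.sum_congr rfl fun i _ => ?_
  have hd : ∀ j, DifferentiableAt ℝ (fun w => abar γ i j w * (w j / 2)) v := fun j =>
    ((contDiff_abar hγ₁ hγ₂ i j).mul ((contDiff_coord j).div_const 2)).differentiable one_ne_zero v
  have hk : ∀ j, DifferentiableAt ℝ (kconv (kernel γ i j) (fun w => w j * maxwellian w)) v := fun j =>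
    (contDiff_kconv (p := γ + 2) (by linarith) (by linarith) (rieszLike_kernel i j) (contDiff_coord_maxwellian j)
      (decays_coord_maxwellian j) (decays_fderiv_coord_maxwellian j)).differentiable one_ne_zero v
  rw [← pd_sum hd]
  have e : (fun w => ∑ j, abar γ i j w * (w j / 2)) =
      fun v => 1 / 2 * ∑ j, kconv (kernel γ i j) (fun w => w j * maxwellian w) v := by
    funext w
    rw [← sum_abar_mul_coord hγ₁ hγ₂, Finset.mul_sum]
    refine Finset.sum_congr rfl fun j _ => ?_
    ring
  rw [e, pd_const_mul _ (DifferentiableAt.fun_sum fun j _ => hk j), pd_sum hk]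
  congr 1
  refine Finset.sum_congr rfl fun j _ => ?_
  rw [pd_kconv (p := γ + 2) (by linarith) (by linarith) (rieszLike_kernel i j) (contDiff_coord_maxwellian j)
      (decays_coord_maxwellian j) (decays_fderiv_coord_maxwellian j), pd_coord_maxwellian']
  rfl

lemma abs_drift_bound : ∃ C : ℝ, 0 < C ∧ ∀ v, |drift γ v| ≤ C * (1 + ‖v‖) ^ (γ + 2) := by
  have h := fun i j => norm_kconv_le (p := γ + 2) (by linarith) (by linarith)
    (rieszLike_kernel (γ := γ) i j) (continuous_maxwellian_hess i j) (decays_maxwellian_hess i j)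
  choose C hC h using h
  refine ⟨1 / 2 * ∑ i, ∑ j, C i j, mul_pos (by norm_num) (Finset.sum_pos (fun i _ => Finset.sum_pos
    (fun j _ => hC i j) Finset.univ_nonempty) Finset.univ_nonempty), fun v => ?_⟩
  rw [drift_eq hγ₁ hγ₂, abs_mul, abs_of_pos (by norm_num), mul_assoc]
  gcongr
  simp_rw [Finset.sum_mul]
  refine (Finset.abs_sum_le_sum_abs _ _).trans (Finset.sum_le_sum fun i _ => ?_)
  exact (Finset.abs_sum_le_sum_abs _ _).trans (Finset.sum_le_sum fun j _ => h i j v)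

lemma continuous_drift : Continuous (drift γ) := by
  unfold drift
  refine continuous_finsetSum _ fun i _ => continuous_finsetSum _ fun j _ => continuous_pd ?_ i
  exact (contDiff_abar hγ₁ hγ₂ i j).mul ((contDiff_coord j).div_const 2)

end

/-! ### Regularised kernels -/

/-- A smooth approximation of `‖z‖ ^ (2 s)`. -/
def regPow (δ s : ℝ) (z : V3) : ℝ := (‖z‖ ^ 2 + δ) ^ s

lemma hasFDerivAt_norm_sq_V3 (z : V3) : HasFDerivAt (fun z : V3 => ‖z‖ ^ 2) (2 • innerSL ℝ z) z :=
  (hasStrictFDerivAt_norm_sq z).hasFDerivAt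

lemma pd_norm_sq (i : Fin 3) (z : V3) : pd i (fun z : V3 => ‖z‖ ^ 2) z = 2 * z i := by
  rw [pd_eq_of_hasFDerivAt (hasFDerivAt_norm_sq_V3 z)]
  simp [EuclideanSpace.inner_single_right]

section reg
variable {δ : ℝ} (hδ : 0 < δ)
include hδ

lemma regPow_pos (s : ℝ) (z : V3) : 0 < regPow δ s z := by unfold regPow; positivity

lemma contDiff_regPow (s : ℝ) : ContDiff ℝ 1 (regPow δ s) :=
  ((contDiff_norm_sq ℝ).add contDiff_const).rpow_const_of_ne fun z => by positivity

lemma pd_regPow (s : ℝ) (i : Fin 3) (z : V3) : pd i (regPow δ s) z = 2 * s * z i * regPow δ (s - 1) z := by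
  have h := ((hasFDerivAt_norm_sq_V3 z).add_const δ).rpow_const (p := s) (Or.inl (by positivity))
  have h' : pd i (regPow δ s) z = _ := pd_eq_of_hasFDerivAt h i
  rw [h', regPow]
  simp [EuclideanSpace.inner_single_right]
  ring

lemma polyBound_regPow {s : ℝ} (hs : s ≤ 0) : PolyBound (regPow δ s) := by
  refine ⟨δ ^ s, 0, fun z => ?_⟩
  rw [Real.norm_of_nonneg (regPow_pos hδ s z).le, pow_zero, mul_one]
  exact Real.rpow_le_rpow_of_nonpos hδ (by nlinarith [sq_nonneg ‖z‖]) hs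

end reg

lemma PolyBound.comp_sub {F : Type*} [NormedAddCommGroup F] {q : V3 → F} (hq : PolyBound q) (v : V3) :
    PolyBound (fun w => q (v - w)) := by
  obtain ⟨C, n, hC, h⟩ := hq.nonneg
  refine ⟨C * (1 + ‖v‖) ^ n, n, fun w => (h _).trans ?_⟩
  rw [mul_assoc, ← mul_pow]
  gcongr
  nlinarith [norm_sub_le v w, norm_nonneg v, norm_nonneg w, mul_nonneg (norm_nonneg v) (norm_nonneg w)]

lemma integrable_poly_maxwellian {q : V3 → ℝ} (hq : PolyBound q) (hc : Continuous q) :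
    Integrable (fun w => maxwellian w * q w) :=
  Decays.integrable (h := fun w => maxwellian w * q w) hq.decays
    (contDiff_maxwellian.continuous.mul hc).aestronglyMeasurable

lemma pd_comp_const_sub {K : V3 → ℝ} (hK : Differentiable ℝ K) (v : V3) (i : Fin 3) (w : V3) :
    pd i (fun w => K (v - w)) w = -pd i K (v - w) := by
  have h := (hK (v - w)).hasFDerivAt.comp w ((hasFDerivAt_id w).const_sub v)
  have h' : pd i (fun w => K (v - w)) w = _ := pd_eq_of_hasFDerivAt h i
  rw [h']
  simp [pd]

/-- The sign of the integration by parts cancels the sign from differentiating `K (v - w)` in `w`.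
Polynomial bounds on `K` and `q` suffice, since the Gaussian removes boundary terms. -/
lemma integral_conv_pd_maxwellian {K q q' : V3 → ℝ} {i : Fin 3} (hK : ContDiff ℝ 1 K) (bK : PolyBound K)
    (bK' : PolyBound (pd i K)) (hq : ContDiff ℝ 1 q) (bq : PolyBound q) (hq' : Continuous q')
    (bq' : PolyBound q') (h : ∀ w, pd i (fun w => maxwellian w * q w) w = maxwellian w * q' w) (v : V3) :
    ∫ w, K (v - w) * (maxwellian w * q' w) = ∫ w, pd i K (v - w) * (maxwellian w * q w) := by
  have hs : Continuous fun w : V3 => v - w := continuous_const.sub continuous_id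
  have hKv : Differentiable ℝ (fun w => K (v - w)) := fun w =>
    (hK.differentiable one_ne_zero (v - w)).comp w ((differentiableAt_const v).sub differentiableAt_id)
  have hh : Differentiable ℝ (fun w => maxwellian w * q w) :=
    (contDiff_maxwellian.mul hq).differentiable one_ne_zero
  have e1 : ∀ w, fderiv ℝ (fun w => maxwellian w * q w) w (EuclideanSpace.single i 1) = maxwellian w * q' w := h
  have e2 : ∀ w, fderiv ℝ (fun w => K (v - w)) w (EuclideanSpace.single i 1) = -pd i K (v - w) :=
    pd_comp_const_sub (hK.differentiable one_ne_zero) v i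
  have ibp := integral_mul_fderiv_eq_neg_fderiv_mul_of_integrable (μ := (volume : Measure V3))
    (f := fun w => K (v - w)) (g := fun w => maxwellian w * q w) (v := EuclideanSpace.single i 1)
    ?_ ?_ ?_ (fun w _ => hKv w) (fun w _ => hh w)
  · simp_rw [e1, e2] at ibp
    rw [ibp, ← integral_neg]
    simp
  · simp_rw [e2]
    exact (integrable_poly_maxwellian ((bK'.comp_sub v).neg.mul bq)
      ((((continuous_pd hK i).comp hs).neg).mul hq.continuous)).congr (ae_of_all _ fun w => by dsimp; ring)
  · simp_rw [e1]
    exact (integrable_poly_maxwellian ((bK.comp_sub v).mul bq')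
      ((hK.continuous.comp hs).mul hq')).congr (ae_of_all _ fun w => by dsimp; ring)
  · exact (integrable_poly_maxwellian ((bK.comp_sub v).mul bq)
      ((hK.continuous.comp hs).mul hq.continuous)).congr (ae_of_all _ fun w => by dsimp; ring)

/-- The polynomial part of the Landau kernel. -/
def kernelPoly (i j : Fin 3) (z : V3) : ℝ := (if i = j then ‖z‖ ^ 2 else 0) - z i * z j

lemma contDiff_kernelPoly (i j : Fin 3) : ContDiff ℝ 1 (kernelPoly i j) := by
  unfold kernelPoly
  refine ContDiff.sub ?_ ((contDiff_coord i).mul (contDiff_coord j))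
  split_ifs
  · exact contDiff_norm_sq ℝ
  · exact contDiff_const

lemma polyBound_kernelPoly (i j : Fin 3) : PolyBound (kernelPoly i j) := by
  refine ⟨2, 2, fun z => (abs_kernel_poly_le i j z).trans ?_⟩
  gcongr
  linarith

lemma pd_kernelPoly (k i j : Fin 3) (z : V3) : pd k (kernelPoly i j) z =
    (if i = j then 2 * z k else 0) - ((if k = i then 1 else 0) * z j + z i * (if k = j then 1 else 0)) := by
  have h1 : DifferentiableAt ℝ (fun z : V3 => if i = j then ‖z‖ ^ 2 else 0) z := by
    split_ifs
    · exact (hasFDerivAt_norm_sq_V3 z).differentiableAt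
    · exact differentiableAt_const _
  have h2 : DifferentiableAt ℝ (fun z : V3 => (-1) * (z i * z j)) z :=
    ((differentiable_coord i z).fun_mul (differentiable_coord j z)).const_mul _
  have e : kernelPoly i j = fun z => (if i = j then ‖z‖ ^ 2 else 0) + (-1) * (z i * z j) := by
    funext z; simp [kernelPoly]; ring
  rw [e, pd_add h1 h2, pd_const_mul _ ((differentiable_coord i z).fun_mul (differentiable_coord j z)),
    pd_mul (differentiable_coord i z) (differentiable_coord j z), pd_coord, pd_coord]
  have h3 : pd k (fun z : V3 => if i = j then ‖z‖ ^ 2 else 0) z = if i = j then 2 * z k else 0 := by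
    split_ifs
    · exact pd_norm_sq k z
    · simp [pd]
  rw [h3]
  ring

lemma polyBound_pd_kernelPoly (k i j : Fin 3) : PolyBound (pd k (kernelPoly i j)) := by
  rw [show pd k (kernelPoly i j) = _ from funext (pd_kernelPoly k i j)]
  refine PolyBound.sub ?_ (((PolyBound.const _).mul (PolyBound.coord j)).add ((PolyBound.coord i).mul (PolyBound.const _)))
  split_ifs
  · exact (PolyBound.const 2).mul (PolyBound.coord k)
  · exact PolyBound.const 0

section reg2
variable {δ s : ℝ} (hδ : 0 < δ) (hs : s ≤ 0)
include hδ

lemma contDiff_kernelPoly_mul_regPow (i j : Fin 3) : ContDiff ℝ 1 (fun z => kernelPoly i j z * regPow δ s z) :=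
  (contDiff_kernelPoly i j).mul (contDiff_regPow hδ s)

lemma pd_kernelPoly_mul_regPow (k i j : Fin 3) (z : V3) : pd k (fun z => kernelPoly i j z * regPow δ s z) z =
    pd k (kernelPoly i j) z * regPow δ s z + kernelPoly i j z * (2 * s * z k * regPow δ (s - 1) z) := by
  rw [pd_mul ((contDiff_kernelPoly i j).differentiable one_ne_zero z)
    ((contDiff_regPow hδ s).differentiable one_ne_zero z), pd_regPow hδ]

/-- The gradient of the radial factor is parallel to `z` and is annihilated by the matrix; only the
divergence `-2 z_j` of the polynomial part survives. -/
lemma sum_pd_kernelPoly_mul_regPow (j : Fin 3) (z : V3) :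
    ∑ i, pd i (fun z => kernelPoly i j z * regPow δ s z) z = -2 * (z j * regPow δ s z) := by
  have : ∑ i, (((if i = j then 2 * z i else 0) - ((if i = i then 1 else 0) * z j + z i * (if i = j then 1 else 0)))
      * regPow δ s z + kernelPoly i j z * (2 * s * z i * regPow δ (s - 1) z)) =
      -2 * (z j * regPow δ s z) + 2 * s * (z j * ‖z‖ ^ 2 - z j * (z 0 ^ 2 + z 1 ^ 2 + z 2 ^ 2)) * regPow δ (s - 1) z := by
    fin_cases j <;> simp [kernelPoly, Fin.sum_univ_three] <;> ring
  rw [Finset.sum_congr rfl fun i _ => by rw [pd_kernelPoly_mul_regPow hδ, pd_kernelPoly], this, norm_sq_three]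
  ring

lemma sum_pd_coord_mul_regPow (z : V3) : ∑ j, pd j (fun z => z j * regPow δ s z) z =
    3 * regPow δ s z + 2 * s * ‖z‖ ^ 2 * regPow δ (s - 1) z := by
  have h : ∀ j : Fin 3, pd j (fun z => z j * regPow δ s z) z = regPow δ s z + z j * (2 * s * z j * regPow δ (s - 1) z) := by
    intro j
    rw [pd_mul (differentiable_coord j z) ((contDiff_regPow hδ s).differentiable one_ne_zero z), pd_coord,
      pd_regPow hδ]
    simp
  simp_rw [h, Fin.sum_univ_three, norm_sq_three]
  ring

include hs

lemma polyBound_coord_mul_regPow (j : Fin 3) : PolyBound (fun z : V3 => z j * regPow δ s z) :=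
  (PolyBound.coord j).mul (polyBound_regPow hδ hs)

lemma polyBound_pd_coord_mul_regPow (i j : Fin 3) : PolyBound (pd i (fun z : V3 => z j * regPow δ s z)) := by
  have e : pd i (fun z : V3 => z j * regPow δ s z) = fun z =>
      (if i = j then 1 else 0) * regPow δ s z + z j * ((2 * s) * z i * regPow δ (s - 1) z) := by
    funext z
    rw [pd_mul (differentiable_coord j z) ((contDiff_regPow hδ s).differentiable one_ne_zero z), pd_coord,
      pd_regPow hδ]
  rw [e]
  exact ((PolyBound.const _).mul (polyBound_regPow hδ hs)).add ((PolyBound.coord j).mul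
    (((PolyBound.const (2 * s)).mul (PolyBound.coord i)).mul (polyBound_regPow hδ (by linarith))))

lemma polyBound_kernelPoly_mul_regPow (i j : Fin 3) : PolyBound (fun z => kernelPoly i j z * regPow δ s z) :=
  (polyBound_kernelPoly i j).mul (polyBound_regPow hδ hs)

lemma polyBound_pd_kernelPoly_mul_regPow (k i j : Fin 3) :
    PolyBound (pd k (fun z => kernelPoly i j z * regPow δ s z)) := by
  rw [show pd k (fun z => kernelPoly i j z * regPow δ s z) = _ from funext (pd_kernelPoly_mul_regPow hδ k i j)]
  exact ((polyBound_pd_kernelPoly k i j).mul (polyBound_regPow hδ hs)).add ((polyBound_kernelPoly i j).mul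
    (((PolyBound.const (2 * s)).mul (PolyBound.coord k)).mul (polyBound_regPow hδ (by linarith))))

/-- Both derivatives of the Hessian of `μ` move to the kernel, which is why the kernel had to be
made differentiable at the origin. -/
lemma sum_integral_reg_eq (v : V3) :
    ∑ i, ∑ j, ∫ w, (kernelPoly i j (v - w) * regPow δ s (v - w)) * (maxwellian w * hessPoly i j w) =
      2 * ∫ w, (3 * regPow δ s (v - w) + 2 * s * ‖v - w‖ ^ 2 * regPow δ (s - 1) (v - w)) * maxwellian w := by
  have hsub : Continuous fun w : V3 => v - w := continuous_const.sub continuous_id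
  have h1 : ∀ i j, ∫ w, (kernelPoly i j (v - w) * regPow δ s (v - w)) * (maxwellian w * hessPoly i j w) =
      ∫ w, pd i (fun z => kernelPoly i j z * regPow δ s z) (v - w) * (maxwellian w * w j) := by
    intro i j
    refine integral_conv_pd_maxwellian (K := fun z => kernelPoly i j z * regPow δ s z)
      (contDiff_kernelPoly_mul_regPow hδ i j) (polyBound_kernelPoly_mul_regPow hδ hs i j)
      (polyBound_pd_kernelPoly_mul_regPow hδ hs i i j) (contDiff_coord j) (PolyBound.coord j)
      (continuous_hessPoly i j) (polyBound_hessPoly i j) (fun w => ?_) v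
    rw [← congrFun (pd_coord_maxwellian' i j) w]
    simp_rw [mul_comm]
  have h2 : ∀ j, ∫ w, ((v - w) j * regPow δ s (v - w)) * (maxwellian w * -w j) =
      ∫ w, pd j (fun z => z j * regPow δ s z) (v - w) * (maxwellian w * 1) := by
    intro j
    refine integral_conv_pd_maxwellian (K := fun z => z j * regPow δ s z) (q' := fun w => -w j)
      ((contDiff_coord j).mul (contDiff_regPow hδ s)) (polyBound_coord_mul_regPow hδ hs j)
      (polyBound_pd_coord_mul_regPow hδ hs j j) contDiff_const (PolyBound.const 1)
      (contDiff_coord j (n := 0)).continuous.neg (PolyBound.coord j).neg (fun w => ?_) v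
    simp_rw [mul_one, pd_maxwellian]
    ring
  simp_rw [h1]
  rw [Finset.sum_comm]
  -- The product of `-2 z_j` and `w_j μ` equals `2 z_j ∂_j μ`, so a second integration by parts
  -- applies.
  have h3 : ∀ j, ∑ i, ∫ w, pd i (fun z => kernelPoly i j z * regPow δ s z) (v - w) * (maxwellian w * w j) =
      2 * ∫ w, pd j (fun z => z j * regPow δ s z) (v - w) * (maxwellian w * 1) := by
    intro j
    rw [← h2, ← integral_finsetSum, ← integral_const_mul]
    · refine integral_congr_ae (ae_of_all _ fun w => ?_)
      dsimp only
      rw [← Finset.sum_mul, sum_pd_kernelPoly_mul_regPow hδ]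
      ring
    · intro i _
      exact (integrable_poly_maxwellian (((polyBound_pd_kernelPoly_mul_regPow hδ hs i i j).comp_sub v).mul
        (PolyBound.coord j)) (((continuous_pd (contDiff_kernelPoly_mul_regPow hδ i j) i).comp hsub).mul
        (contDiff_coord j (n := 0)).continuous)).congr (ae_of_all _ fun w => by dsimp; ring)
  simp_rw [h3]
  rw [← Finset.mul_sum, ← integral_finsetSum]
  · congr 1
    refine integral_congr_ae (ae_of_all _ fun w => ?_)
    dsimp only
    rw [← Finset.sum_mul, sum_pd_coord_mul_regPow hδ, mul_one]
  · intro j _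
    exact (integrable_poly_maxwellian ((polyBound_pd_coord_mul_regPow hδ hs j j).comp_sub v)
      ((continuous_pd ((contDiff_coord j).mul (contDiff_regPow hδ s)) j).comp hsub)).congr
      (ae_of_all _ fun w => by dsimp; ring)

end reg2

lemma regPow_le {γ δ : ℝ} (hγ₂ : γ < 0) (hδ : 0 < δ) {z : V3} (hz : z ≠ 0) : regPow δ (γ / 2) z ≤ ‖z‖ ^ γ := by
  have hz' : 0 < ‖z‖ := norm_pos_iff.2 hz
  calc regPow δ (γ / 2) z ≤ (‖z‖ ^ 2) ^ (γ / 2) :=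
        Real.rpow_le_rpow_of_nonpos (by positivity) (by linarith) (by linarith)
    _ = ‖z‖ ^ γ := by
        rw [← Real.rpow_natCast, ← Real.rpow_mul hz'.le]
        congr 1
        push_cast
        ring

lemma rieszLike_norm_rpow (p : ℝ) : RieszLike p (fun z => ‖z‖ ^ p) :=
  ⟨measurable_norm_rpow p, 1, fun z => by rw [one_mul, abs_of_nonneg (by positivity)]⟩

section
variable {γ : ℝ} (hγ₁ : -3 < γ) (hγ₂ : γ < 0)
include hγ₁ hγ₂

/-- The exponent `γ/2` is negative, so the term with the factor `2s` has a favourable sign and is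
dropped. An upper bound is all that is needed, and no limit of that term has to be taken. -/
lemma sum_integral_reg_le {δ : ℝ} (hδ : 0 < δ) (v : V3) :
    ∑ i, ∑ j, ∫ w, (kernelPoly i j (v - w) * regPow δ (γ / 2) (v - w)) * (maxwellian w * hessPoly i j w) ≤
      6 * kconv (fun z => ‖z‖ ^ γ) maxwellian v := by
  have hsub : Continuous fun w : V3 => v - w := continuous_const.sub continuous_id
  have hs : γ / 2 ≤ 0 := by linarith
  rw [sum_integral_reg_eq hδ hs, kconv, ← integral_const_mul, ← integral_const_mul]
  refine integral_mono_ae ?_ ((integrable_kconv hγ₁ (by linarith) (rieszLike_norm_rpow γ)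
    contDiff_maxwellian.continuous decays_maxwellian v).const_mul 6) ?_
  · refine Integrable.const_mul ?_ 2
    have b1 : PolyBound (fun z : V3 => 3 * regPow δ (γ / 2) z + 2 * (γ / 2) * (‖z‖ * ‖z‖) * regPow δ (γ / 2 - 1) z) :=
      ((PolyBound.const 3).mul (polyBound_regPow hδ hs)).add
        (((PolyBound.const (2 * (γ / 2))).mul (PolyBound.norm_id.mul PolyBound.norm_id)).mul
          (polyBound_regPow hδ (by linarith)))
    have c1 : Continuous (fun z : V3 => 3 * regPow δ (γ / 2) z + 2 * (γ / 2) * (‖z‖ * ‖z‖) * regPow δ (γ / 2 - 1) z) := by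
      have := (contDiff_regPow hδ (γ / 2)).continuous
      have := (contDiff_regPow hδ (γ / 2 - 1)).continuous
      fun_prop
    exact (integrable_poly_maxwellian (b1.comp_sub v) (c1.comp hsub)).congr (ae_of_all _ fun w => by dsimp; ring)
  -- At `w = v` the convention `0 ^ γ = 0` would make the comparison false; the point is a null set.
  · have hne : ∀ᵐ w : V3, w ≠ v := by
      rw [ae_iff]; simp
    filter_upwards [hne] with w hw
    have hz : v - w ≠ 0 := sub_ne_zero.2 hw.symm
    have h1 := regPow_le hγ₂ hδ hz
    have h2 : 2 * (γ / 2) * ‖v - w‖ ^ 2 * regPow δ (γ / 2 - 1) (v - w) ≤ 0 := by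
      have := regPow_pos hδ (γ / 2 - 1) (v - w)
      have : 0 ≤ ‖v - w‖ ^ 2 * regPow δ (γ / 2 - 1) (v - w) := by positivity
      nlinarith
    have h3 := maxwellian_nonneg w
    rw [smul_eq_mul]
    nlinarith

/-- The regularised kernel is dominated by `2|z|^(γ+2)`, which is integrable near the origin. At `z
= 0` both kernels vanish through their polynomial factor. -/
lemma tendsto_integral_reg (i j : Fin 3) (v : V3) :
    Filter.Tendsto (fun n : ℕ => ∫ w, (kernelPoly i j (v - w) * regPow (1 / ((n : ℝ) + 1)) (γ / 2) (v - w))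
      * (maxwellian w * hessPoly i j w)) Filter.atTop
      (nhds (∫ w, kernel γ i j (v - w) * (maxwellian w * hessPoly i j w))) := by
  have hsub : Continuous fun w : V3 => v - w := continuous_const.sub continuous_id
  have hδ : ∀ n : ℕ, (0 : ℝ) < 1 / ((n : ℝ) + 1) := fun n => by positivity
  have hk : RieszLike (γ + 2) (fun z => 2 * ‖z‖ ^ (γ + 2)) :=
    ⟨(measurable_norm_rpow _).const_mul 2, 2, fun z => by rw [abs_of_nonneg (by positivity)]⟩
  have hb := (integrable_kconv (by linarith) (by linarith) hk (continuous_maxwellian_hess i j)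
    (decays_maxwellian_hess i j) v).norm
  refine tendsto_integral_of_dominated_convergence _ (fun n => ?_) hb (fun n => ae_of_all _ fun w => ?_)
    (ae_of_all _ fun w => ?_)
  · exact (((contDiff_kernelPoly_mul_regPow (hδ n) i j).continuous.comp hsub).mul
      (continuous_maxwellian_hess i j)).aestronglyMeasurable
  · rw [norm_mul, norm_smul]
    gcongr
    rw [Real.norm_eq_abs, Real.norm_of_nonneg (by positivity)]
    rcases eq_or_ne (v - w) 0 with h0 | h0
    · rw [h0]; simp [kernelPoly]; positivity
    · have hz' : 0 < ‖v - w‖ := norm_pos_iff.2 h0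
      rw [abs_mul, abs_of_pos (regPow_pos (hδ n) _ _), Real.rpow_add hz', mul_comm (‖v - w‖ ^ γ), ← mul_assoc]
      have := abs_kernel_poly_le i j (v - w)
      rw [Real.rpow_two]
      exact mul_le_mul this (regPow_le hγ₂ (hδ n) h0) (regPow_pos (hδ n) _ _).le (by positivity)
  · refine Filter.Tendsto.mul_const _ ?_
    change Filter.Tendsto _ _ (nhds (kernelPoly i j (v - w) * ‖v - w‖ ^ γ))
    rcases eq_or_ne (v - w) 0 with h0 | h0
    · rw [h0]; simp [kernelPoly]
    · have hz' : 0 < ‖v - w‖ := norm_pos_iff.2 h0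
      refine Filter.Tendsto.const_mul _ ?_
      have h1 : Filter.Tendsto (fun n : ℕ => ‖v - w‖ ^ 2 + 1 / ((n : ℝ) + 1)) Filter.atTop (nhds (‖v - w‖ ^ 2 + 0)) :=
        tendsto_const_nhds.add tendsto_one_div_add_atTop_nhds_zero_nat
      have h2 := h1.rpow_const (p := γ / 2) (Or.inl (by positivity))
      have e : (‖v - w‖ ^ 2 + 0) ^ (γ / 2) = ‖v - w‖ ^ γ := by
        rw [add_zero, ← Real.rpow_natCast, ← Real.rpow_mul hz'.le]
        congr 1
        push_cast
        ring
      rwa [e] at h2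

/-- The gain over `abs_drift_bound` is the exponent `γ` in place of `γ + 2`. It is what matches the
weight `⟨v⟩^(γ/2)` of (1); only the upper bound is of this order here. -/
lemma drift_le : ∃ C : ℝ, 0 < C ∧ ∀ v, drift γ v ≤ C * (1 + ‖v‖) ^ γ := by
  obtain ⟨C, hC, h⟩ := norm_kconv_le hγ₁ (by linarith) (rieszLike_norm_rpow γ)
    contDiff_maxwellian.continuous decays_maxwellian
  refine ⟨3 * C, by positivity, fun v => ?_⟩
  have h1 : ∑ i, ∑ j, ∫ w, kernel γ i j (v - w) * (maxwellian w * hessPoly i j w) ≤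
      6 * kconv (fun z => ‖z‖ ^ γ) maxwellian v :=
    le_of_tendsto (tendsto_finsetSum _ fun i _ => tendsto_finsetSum _ fun j _ => tendsto_integral_reg hγ₁ hγ₂ i j v)
      (Filter.Eventually.of_forall fun n => sum_integral_reg_le hγ₁ hγ₂ (by positivity) v)
  rw [drift_eq hγ₁ hγ₂]
  have h2 := (le_abs_self _).trans (h v)
  linarith

end

/-! ### Schwartz functions against coefficients of polynomial growth -/

/-- The `i`-th partial derivative as an operator on Schwartz functions. -/
def pdS (i : Fin 3) : 𝓢(V3, ℝ) →L[ℝ] 𝓢(V3, ℝ) :=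
  LineDeriv.lineDerivOpCLM ℝ 𝓢(V3, ℝ) (EuclideanSpace.single i (1 : ℝ) : V3)

lemma pdS_apply (i : Fin 3) (u : 𝓢(V3, ℝ)) (v : V3) : pdS i u v = pd i u v := by
  rw [pdS, LineDeriv.lineDerivOpCLM_apply, SchwartzMap.lineDerivOp_apply_eq_fderiv, pd]

lemma coe_pdS (i : Fin 3) (u : 𝓢(V3, ℝ)) : ⇑(pdS i u) = pd i u := funext (pdS_apply i u)

lemma contDiff_schwartz (u : 𝓢(V3, ℝ)) : ContDiff ℝ 1 u := u.smooth 1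

lemma contDiff_pd_schwartz (i : Fin 3) (u : 𝓢(V3, ℝ)) : ContDiff ℝ 1 (pd i u) := by
  rw [← coe_pdS]; exact contDiff_schwartz _

lemma schwartz_decay (n : ℕ) : ∃ (s : Finset (ℕ × ℕ)) (C : ℝ), 0 ≤ C ∧ ∀ (u : 𝓢(V3, ℝ)) (v : V3),
    (1 + ‖v‖) ^ n * ‖u v‖ ≤ C * (s.sup (schwartzSeminormFamily ℝ V3 ℝ)) u := by
  refine ⟨Finset.Iic (n, 0), 2 ^ n, by positivity, fun u v => ?_⟩
  have := SchwartzMap.one_add_le_sup_seminorm_apply (𝕜 := ℝ) (m := (n, 0)) le_rfl le_rfl u v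
  rw [norm_iteratedFDeriv_zero] at this
  exact this

/-- Stated with seminorms, so that it yields both integrability for each `u` and continuity of the
multiplication as a map into `L²`. -/
lemma PolyBound.mul_schwartz_bound {c : V3 → ℝ} (hc : PolyBound c) (k : ℕ) :
    ∃ (s : Finset (ℕ × ℕ)) (C : ℝ), 0 ≤ C ∧ ∀ (u : 𝓢(V3, ℝ)) (v : V3),
    ‖c v * u v‖ ≤ C * (s.sup (schwartzSeminormFamily ℝ V3 ℝ)) u * (1 + ‖v‖) ^ (-(k : ℝ)) := by
  obtain ⟨C, n, hC, h⟩ := hc.nonneg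
  obtain ⟨s, D, hD, h'⟩ := schwartz_decay (n + k)
  refine ⟨s, C * D, by positivity, fun u v => ?_⟩
  have hv := one_add_norm_pos v
  rw [Real.rpow_neg hv.le, Real.rpow_natCast, ← div_eq_mul_inv, le_div_iff₀ (by positivity), norm_mul]
  calc ‖c v‖ * ‖u v‖ * (1 + ‖v‖) ^ k ≤ (C * (1 + ‖v‖) ^ n) * ‖u v‖ * (1 + ‖v‖) ^ k := by gcongr; exact h v
    _ = C * ((1 + ‖v‖) ^ (n + k) * ‖u v‖) := by ring
    _ ≤ C * (D * (s.sup (schwartzSeminormFamily ℝ V3 ℝ)) u) :=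
        mul_le_mul_of_nonneg_left (h' u v) hC
    _ = _ := by ring

lemma PolyBound.integrable_mul_schwartz {c : V3 → ℝ} (hc : PolyBound c) (hcc : Continuous c) (u : 𝓢(V3, ℝ)) :
    Integrable (fun v => c v * u v) := by
  obtain ⟨s, C, hC, h⟩ := hc.mul_schwartz_bound 10
  refine Decays.integrable ⟨C * (s.sup (schwartzSeminormFamily ℝ V3 ℝ)) u, fun v => ?_⟩
    (hcc.mul u.continuous).aestronglyMeasurable
  exact_mod_cast h u v

lemma memLp_weight : MemLp (fun v : V3 => (1 + ‖v‖) ^ (-5 : ℝ)) 2 := by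
  have hc : Continuous (fun v : V3 => (1 + ‖v‖) ^ (-5 : ℝ)) :=
    (continuous_const.add continuous_norm).rpow_const fun v => Or.inl (one_add_norm_pos v).ne'
  rw [memLp_two_iff_integrable_sq hc.aestronglyMeasurable]
  refine (integrable_one_add_norm_rpow (p := -10) (by norm_num)).congr (ae_of_all _ fun v => ?_)
  dsimp only
  rw [← Real.rpow_natCast, ← Real.rpow_mul (one_add_norm_pos v).le]
  norm_num

lemma PolyBound.memLp_mul_schwartz {c : V3 → ℝ} (hc : PolyBound c) (hcc : Continuous c) (u : 𝓢(V3, ℝ)) :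
    MemLp (fun v => c v * u v) 2 := by
  obtain ⟨s, C, hC, h⟩ := hc.mul_schwartz_bound 5
  refine (memLp_weight.const_mul (C * (s.sup (schwartzSeminormFamily ℝ V3 ℝ)) u)).mono'
    (hcc.mul u.continuous).aestronglyMeasurable (ae_of_all _ fun v => ?_)
  exact_mod_cast h u v

/-- `L²(ℝ³)`. -/
abbrev L2V : Type := Lp ℝ 2 (volume : Measure V3)

/-- Multiplication by a continuous function of polynomial growth, from Schwartz functions to `L²`. -/
def mulL2 (c : V3 → ℝ) (hc : PolyBound c) (hcc : Continuous c) : 𝓢(V3, ℝ) →L[ℝ] L2V :=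
  SchwartzMap.mkCLMtoNormedSpace (σ := RingHom.id ℝ) (fun u => (hc.memLp_mul_schwartz hcc u).toLp _)
    (fun u w => by
      rw [← MemLp.toLp_add]
      congr 1
      funext v
      simp [mul_add])
    (fun a u => by
      rw [RingHom.id_apply, ← MemLp.toLp_const_smul]
      congr 1
      funext v
      simp [mul_left_comm])
    (by
      obtain ⟨s, C, hC, h⟩ := hc.mul_schwartz_bound 5
      refine ⟨s, C * ‖memLp_weight.toLp _‖, by positivity, fun u => ?_⟩
      have := Lp.norm_le_mul_norm_of_ae_le_mul (f := (hc.memLp_mul_schwartz hcc u).toLp _)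
        (g := memLp_weight.toLp _) (c := C * (s.sup (schwartzSeminormFamily ℝ V3 ℝ)) u) ?_
      · calc _ ≤ _ := this
          _ = _ := by ring
      · filter_upwards [(hc.memLp_mul_schwartz hcc u).coeFn_toLp, memLp_weight.coeFn_toLp] with v h1 h2
        rw [h1, h2, Real.norm_of_nonneg (by positivity : (0 : ℝ) ≤ (1 + ‖v‖) ^ (-5 : ℝ))]
        exact_mod_cast h u v)

lemma coeFn_mulL2 (c : V3 → ℝ) (hc : PolyBound c) (hcc : Continuous c) (u : 𝓢(V3, ℝ)) :
    mulL2 c hc hcc u =ᵐ[volume] fun v => c v * u v :=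
  (hc.memLp_mul_schwartz hcc u).coeFn_toLp

/-! ### The operator on Schwartz functions -/

/-- The potential `A v/2 · v/2`. -/
def potential (γ : ℝ) (v : V3) : ℝ := ∑ i, ∑ j, abar γ i j v * (v i / 2) * (v j / 2)

lemma landau_eq (γ : ℝ) (f : V3 → ℝ) (v : V3) : landau γ f v =
    (∑ i, ∑ j, pd i (fun w => abar γ i j w * pd j f w) v) - (potential γ v - drift γ v) * f v := by
  rw [landau, potential, drift]
  ring

lemma polyBound_of_rpow {f : V3 → ℝ} {p : ℝ} (hp : p ≤ 5) (h : ∃ C : ℝ, 0 < C ∧ ∀ v, |f v| ≤ C * (1 + ‖v‖) ^ p) :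
    PolyBound f := by
  obtain ⟨C, hC, h⟩ := h
  refine ⟨C, 5, fun v => (h v).trans ?_⟩
  gcongr
  rw [← Real.rpow_natCast]
  exact Real.rpow_le_rpow_of_exponent_le (by linarith [norm_nonneg v]) (by exact_mod_cast hp)

lemma polyBound_sum {f : Fin 3 → V3 → ℝ} (h : ∀ i, PolyBound (f i)) : PolyBound (fun v => ∑ i, f i v) := by
  simp_rw [Fin.sum_univ_three]
  exact ((h 0).add (h 1)).add (h 2)

lemma polyBound_schwartz (u : 𝓢(V3, ℝ)) : PolyBound u :=
  ⟨SchwartzMap.seminorm ℝ 0 0 u, 0, fun v => by simpa using SchwartzMap.norm_le_seminorm ℝ u v⟩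

lemma continuous_coord (i : Fin 3) : Continuous (fun v : V3 => v i) := (contDiff_coord i (n := 0)).continuous

section
variable {γ : ℝ} (hγ₁ : -3 < γ) (hγ₂ : γ < 0)
include hγ₁ hγ₂

lemma continuous_abar (i j : Fin 3) : Continuous (abar γ i j) := (contDiff_abar hγ₁ hγ₂ i j).continuous

lemma differentiable_abar (i j : Fin 3) : Differentiable ℝ (abar γ i j) :=
  (contDiff_abar hγ₁ hγ₂ i j).differentiable one_ne_zero

lemma polyBound_abar (i j : Fin 3) : PolyBound (abar γ i j) := by
  obtain ⟨C, hC, h⟩ := abar_bound hγ₁ hγ₂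
  exact polyBound_of_rpow (p := γ + 2) (by linarith) ⟨C, hC, h i j⟩

lemma polyBound_pd_abar (i j k : Fin 3) : PolyBound (pd k (abar γ i j)) :=
  polyBound_of_rpow (p := γ + 2) (by linarith) (pd_abar_bound hγ₁ hγ₂ i j k)

lemma polyBound_drift : PolyBound (drift γ) :=
  polyBound_of_rpow (p := γ + 2) (by linarith) (abs_drift_bound hγ₁ hγ₂)

lemma continuous_potential : Continuous (potential γ) := by
  unfold potential
  refine continuous_finsetSum _ fun i _ => continuous_finsetSum _ fun j _ => ?_
  exact ((continuous_abar hγ₁ hγ₂ i j).mul ((continuous_coord i).div_const 2)).mul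
    ((continuous_coord j).div_const 2)

lemma polyBound_potential : PolyBound (potential γ) := by
  have h : ∀ i : Fin 3, PolyBound (fun v : V3 => v i / 2) := fun i =>
    (PolyBound.coord i).mono fun v => by
      rw [norm_div, Real.norm_of_nonneg (by norm_num : (0 : ℝ) ≤ 2)]
      linarith [norm_nonneg (v i)]
  exact polyBound_sum fun i => polyBound_sum fun j => ((polyBound_abar hγ₁ hγ₂ i j).mul (h i)).mul (h j)

lemma continuous_zerothOrder : Continuous (fun v => potential γ v - drift γ v) :=
  (continuous_potential hγ₁ hγ₂).sub (continuous_drift hγ₁ hγ₂)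

lemma polyBound_zerothOrder : PolyBound (fun v => potential γ v - drift γ v) :=
  (polyBound_potential hγ₁ hγ₂).sub (polyBound_drift hγ₁ hγ₂)

lemma pd_abar_mul {f : V3 → ℝ} (hf : ContDiff ℝ 1 f) (i j k : Fin 3) (v : V3) :
    pd k (fun w => abar γ i j w * f w) v = pd k (abar γ i j) v * f v + abar γ i j v * pd k f v :=
  pd_mul (differentiable_abar hγ₁ hγ₂ i j v) (hf.differentiable one_ne_zero v) k

/-- The Landau operator from Schwartz functions to `L²`. -/
def landauL2 : 𝓢(V3, ℝ) →L[ℝ] L2V :=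
  (∑ i, ∑ j, ((mulL2 (pd i (abar γ i j)) (polyBound_pd_abar hγ₁ hγ₂ i j i)
      (continuous_pd (contDiff_abar hγ₁ hγ₂ i j) i)).comp (pdS j)
    + (mulL2 (abar γ i j) (polyBound_abar hγ₁ hγ₂ i j) (continuous_abar hγ₁ hγ₂ i j)).comp ((pdS i).comp (pdS j))))
  - mulL2 (fun v => potential γ v - drift γ v) (polyBound_zerothOrder hγ₁ hγ₂) (continuous_zerothOrder hγ₁ hγ₂)

omit hγ₁ hγ₂ in
lemma coeFn_finset_sum_L2 {ι : Type*} (s : Finset ι) (f : ι → L2V) :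
    ⇑(∑ i ∈ s, f i) =ᵐ[volume] fun v => ∑ i ∈ s, f i v := by
  have := Lp.coeFn_finsetSum s f
  filter_upwards [this] with v hv
  simpa using hv

lemma coeFn_landauL2 (u : 𝓢(V3, ℝ)) : landauL2 hγ₁ hγ₂ u =ᵐ[volume] landau γ u := by
  rw [landauL2, sub_apply]
  refine (Lp.coeFn_sub _ _).trans ?_
  have e : landau γ u = (fun v => ∑ i, ∑ j, (pd i (abar γ i j) v * pdS j u v + abar γ i j v * pdS i (pdS j u) v))
      - fun v => (potential γ v - drift γ v) * u v := by
    funext v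
    rw [landau_eq, Pi.sub_apply]
    congr 1
    refine Finset.sum_congr rfl fun i _ => Finset.sum_congr rfl fun j _ => ?_
    rw [pd_abar_mul hγ₁ hγ₂ (contDiff_pd_schwartz j u), pdS_apply, pdS_apply, coe_pdS]
  rw [e]
  refine Filter.EventuallyEq.sub ?_ (coeFn_mulL2 _ _ _ u)
  rw [sum_apply]
  refine (coeFn_finset_sum_L2 _ _).trans ?_
  have h : ∀ i j, ∀ᵐ v, ((mulL2 (pd i (abar γ i j)) (polyBound_pd_abar hγ₁ hγ₂ i j i)
      (continuous_pd (contDiff_abar hγ₁ hγ₂ i j) i)).comp (pdS j)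
    + (mulL2 (abar γ i j) (polyBound_abar hγ₁ hγ₂ i j)
      (continuous_abar hγ₁ hγ₂ i j)).comp ((pdS i).comp (pdS j))) u v
      = pd i (abar γ i j) v * pdS j u v + abar γ i j v * pdS i (pdS j u) v := by
    intro i j
    rw [add_apply]
    filter_upwards [Lp.coeFn_add ((mulL2 (pd i (abar γ i j)) (polyBound_pd_abar hγ₁ hγ₂ i j i)
      (continuous_pd (contDiff_abar hγ₁ hγ₂ i j) i)).comp (pdS j) u)
      ((mulL2 (abar γ i j) (polyBound_abar hγ₁ hγ₂ i j)
      (continuous_abar hγ₁ hγ₂ i j)).comp ((pdS i).comp (pdS j)) u),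
      coeFn_mulL2 (pd i (abar γ i j)) (polyBound_pd_abar hγ₁ hγ₂ i j i)
      (continuous_pd (contDiff_abar hγ₁ hγ₂ i j) i) (pdS j u),
      coeFn_mulL2 (abar γ i j) (polyBound_abar hγ₁ hγ₂ i j)
      (continuous_abar hγ₁ hγ₂ i j) (pdS i (pdS j u))] with v h1 h2 h3
    rw [h1, Pi.add_apply]
    simp only [ContinuousLinearMap.comp_apply]
    rw [h2, h3]
  have h' : ∀ᵐ v, ∀ i, ∀ j, _ := ae_all_iff.2 fun i => ae_all_iff.2 (h i)
  have h'' : ∀ᵐ v, ∀ i, _ := ae_all_iff.2 fun i => coeFn_finset_sum_L2 Finset.univ fun j =>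
    ((mulL2 (pd i (abar γ i j)) (polyBound_pd_abar hγ₁ hγ₂ i j i)
      (continuous_pd (contDiff_abar hγ₁ hγ₂ i j) i)).comp (pdS j)
    + (mulL2 (abar γ i j) (polyBound_abar hγ₁ hγ₂ i j)
      (continuous_abar hγ₁ hγ₂ i j)).comp ((pdS i).comp (pdS j))) u
  filter_upwards [h', h''] with v hv hv2
  refine Finset.sum_congr rfl fun i _ => ?_
  rw [sum_apply, hv2]
  exact Finset.sum_congr rfl fun j _ => hv i j

/-! ### Integration by parts, the energy identity and dissipativity -/

omit hγ₁ hγ₂ in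
lemma integrable_coeff_mul_mul {c : V3 → ℝ} (hc : PolyBound c) (hcc : Continuous c) (u w : 𝓢(V3, ℝ)) :
    Integrable (fun v => c v * u v * w v) :=
  (hc.mul (polyBound_schwartz u)).integrable_mul_schwartz (hcc.mul u.continuous) w

lemma integral_pd_abar_pd_mul (i j : Fin 3) (u w : 𝓢(V3, ℝ)) :
    Integrable (fun v => pd i (fun x => abar γ i j x * pd j u x) v * w v) ∧
    Integrable (fun v => abar γ i j v * pd j u v * pd i w v) ∧
    ∫ v, pd i (fun x => abar γ i j x * pd j u x) v * w v = -∫ v, abar γ i j v * pd j u v * pd i w v := by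
  have hb := polyBound_abar hγ₁ hγ₂ i j
  have hbc := continuous_abar hγ₁ hγ₂ i j
  have i1 : Integrable (fun v => pd i (fun x => abar γ i j x * pd j u x) v * w v) := by
    refine ((integrable_coeff_mul_mul (polyBound_pd_abar hγ₁ hγ₂ i j i)
      (continuous_pd (contDiff_abar hγ₁ hγ₂ i j) i) (pdS j u) w).add
      (integrable_coeff_mul_mul hb hbc (pdS i (pdS j u)) w)).congr (ae_of_all _ fun v => ?_)
    simp only [Pi.add_apply]
    rw [pd_abar_mul hγ₁ hγ₂ (contDiff_pd_schwartz j u), pdS_apply, pdS_apply, coe_pdS]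
    ring
  have i2 : Integrable (fun v => abar γ i j v * pd j u v * pd i w v) := by
    have := integrable_coeff_mul_mul hb hbc (pdS j u) (pdS i w)
    simpa [coe_pdS] using this
  have i3 : Integrable (fun v => abar γ i j v * pd j u v * w v) := by
    have := integrable_coeff_mul_mul hb hbc (pdS j u) w
    simpa [coe_pdS] using this
  refine ⟨i1, i2, ?_⟩
  have ibp := integral_mul_fderiv_eq_neg_fderiv_mul_of_integrable (μ := (volume : Measure V3))
    (f := fun v => abar γ i j v * pd j u v) (g := w) (v := EuclideanSpace.single i 1) i1 i2 i3
    (fun v _ => (differentiable_abar hγ₁ hγ₂ i j v).mul ((contDiff_pd_schwartz j u).differentiable one_ne_zero v))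
    (fun v _ => (contDiff_schwartz w).differentiable one_ne_zero v)
  have ibp' : ∫ v, abar γ i j v * pd j u v * pd i w v = -∫ v, pd i (fun x => abar γ i j x * pd j u x) v * w v := ibp
  rw [ibp', neg_neg]

/-- The Dirichlet form `∫ A ∇u · ∇u`. -/
def gradForm (γ : ℝ) (u : V3 → ℝ) : ℝ := ∑ i, ∑ j, ∫ v, abar γ i j v * pd j u v * pd i u v

omit hγ₁ hγ₂ in
lemma sum_congr₂ {f g : Fin 3 → Fin 3 → ℝ} (h : ∀ i j, f i j = g i j) : ∑ i, ∑ j, f i j = ∑ i, ∑ j, g i j :=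
  Finset.sum_congr rfl fun i _ => Finset.sum_congr rfl fun j _ => h i j

omit hγ₁ hγ₂ in
lemma integral_sum₂ {f : Fin 3 → Fin 3 → V3 → ℝ} (h : ∀ i j, Integrable (f i j)) :
    ∫ v, ∑ i, ∑ j, f i j v = ∑ i, ∑ j, ∫ v, f i j v := by
  rw [integral_finsetSum _ fun i _ => integrable_finsetSum _ fun j _ => h i j]
  exact Finset.sum_congr rfl fun i _ => integral_finsetSum _ fun j _ => h i j

omit hγ₁ hγ₂ in
lemma integrable_sum₂ {f : Fin 3 → Fin 3 → V3 → ℝ} (h : ∀ i j, Integrable (f i j)) :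
    Integrable (fun v => ∑ i, ∑ j, f i j v) :=
  integrable_finsetSum _ fun i _ => integrable_finsetSum _ fun j _ => h i j

lemma integral_landau_mul_self (u : 𝓢(V3, ℝ)) : ∫ v, landau γ u v * u v =
    -gradForm γ u - ∫ v, (potential γ v - drift γ v) * u v ^ 2 := by
  have h := fun i j => integral_pd_abar_pd_mul hγ₁ hγ₂ i j u u
  have hV := integrable_coeff_mul_mul (polyBound_zerothOrder hγ₁ hγ₂) (continuous_zerothOrder hγ₁ hγ₂) u u
  have e : ∀ v, landau γ u v * u v = (∑ i, ∑ j, pd i (fun x => abar γ i j x * pd j u x) v * u v)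
      - (potential γ v - drift γ v) * u v * u v := by
    intro v
    rw [landau_eq, sub_mul, Finset.sum_mul]
    simp_rw [Finset.sum_mul]
  simp_rw [e]
  rw [integral_sub (integrable_sum₂ fun i j => (h i j).1) hV, integral_sum₂ fun i j => (h i j).1,
    sum_congr₂ fun i j => (h i j).2.2, gradForm]
  congr 1
  · simp [Finset.sum_neg_distrib]
  · congr 1; funext v; ring

omit hγ₁ hγ₂ in
lemma integrable_zeroth_mul_sq {c : V3 → ℝ} (hc : PolyBound c) (hcc : Continuous c) (u : 𝓢(V3, ℝ)) :
    Integrable (fun v => c v * u v ^ 2) :=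
  (integrable_coeff_mul_mul hc hcc u u).congr (ae_of_all _ fun v => by dsimp; ring)

lemma normASq_eq (u : 𝓢(V3, ℝ)) : normASq γ u = gradForm γ u + ∫ v, potential γ v * u v ^ 2 := by
  have hv : ∀ i j, Integrable (fun v : V3 => abar γ i j v * (v i / 2) * (v j / 2) * u v ^ 2) := fun i j =>
    (integrable_zeroth_mul_sq (((polyBound_abar hγ₁ hγ₂ i j).mul (PolyBound.coord i)).mul (PolyBound.coord j))
      (((continuous_abar hγ₁ hγ₂ i j).mul (continuous_coord i)).mul (continuous_coord j)) u).const_mul (1 / 4)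
      |>.congr (ae_of_all _ fun v => by dsimp; ring)
  have e : ∀ v, potential γ v * u v ^ 2 = ∑ i, ∑ j, abar γ i j v * (v i / 2) * (v j / 2) * u v ^ 2 := by
    intro v
    simp_rw [potential, Finset.sum_mul]
  simp_rw [e]
  rw [integral_sum₂ hv, gradForm, normASq, ← Finset.sum_add_distrib]
  refine Finset.sum_congr rfl fun i _ => ?_
  rw [← Finset.sum_add_distrib]
  refine Finset.sum_congr rfl fun j _ => ?_
  rw [← integral_add (integral_pd_abar_pd_mul hγ₁ hγ₂ i j u u).2.1 (hv i j)]
  congr 1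
  funext v
  ring

/-- Since `(v_j/2) ∂_i(u²) = v_j u ∂_i u`, integration by parts turns the drift into the cross term
of a square. -/
lemma integral_drift_mul_sq (i j : Fin 3) (u : 𝓢(V3, ℝ)) :
    Integrable (fun v => pd i (fun x => abar γ i j x * (x j / 2)) v * u v ^ 2) ∧
    Integrable (fun v => abar γ i j v * v j * u v * pd i u v) ∧
    ∫ v, pd i (fun x => abar γ i j x * (x j / 2)) v * u v ^ 2 = -∫ v, abar γ i j v * v j * u v * pd i u v := by
  have hb := polyBound_abar hγ₁ hγ₂ i j
  have hbc := continuous_abar hγ₁ hγ₂ i j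
  have hj : ContDiff ℝ 1 (fun x : V3 => x j / 2) := (contDiff_coord j).div_const 2
  have hg : ContDiff ℝ 1 (fun x : V3 => abar γ i j x * (x j / 2)) := (contDiff_abar hγ₁ hγ₂ i j).mul hj
  have hpb : PolyBound (fun x : V3 => x j / 2) := (PolyBound.coord j).mono fun v => by
      rw [norm_div, Real.norm_of_nonneg (by norm_num : (0 : ℝ) ≤ 2)]
      linarith [norm_nonneg (v j)]
  have hgp : PolyBound (pd i (fun x => abar γ i j x * (x j / 2))) := by
    have e : pd i (fun x => abar γ i j x * (x j / 2)) =
        fun v => pd i (abar γ i j) v * (v j / 2) + abar γ i j v * ((if i = j then 1 else 0) * (1 / 2)) := by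
      funext v
      rw [pd_abar_mul hγ₁ hγ₂ hj]
      congr 2
      have := pd_const_mul (1 / 2) (differentiable_coord j v) i
      rw [pd_coord] at this
      rw [mul_comm, ← this]
      congr 1
      funext x
      ring
    rw [e]
    exact ((polyBound_pd_abar hγ₁ hγ₂ i j i).mul hpb).add (hb.mul (PolyBound.const _))
  have i1 := integrable_zeroth_mul_sq hgp (continuous_pd hg i) u
  have i2 : Integrable (fun v => abar γ i j v * v j * u v * pd i u v) := by
    have := integrable_coeff_mul_mul (hb.mul (PolyBound.coord j)) (hbc.mul (continuous_coord j)) u (pdS i u)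
    simpa [coe_pdS] using this
  have i3 := integrable_zeroth_mul_sq (hb.mul hpb) (hbc.mul hj.continuous) u
  have hu2 : Differentiable ℝ (fun v => u v ^ 2) := ((contDiff_schwartz u).pow 2).differentiable one_ne_zero
  have hpu : ∀ v, pd i (fun v => u v ^ 2) v = 2 * u v * pd i u v := by
    intro v
    have := pd_mul ((contDiff_schwartz u).differentiable one_ne_zero v)
      ((contDiff_schwartz u).differentiable one_ne_zero v) i
    simp_rw [pow_two]
    rw [this]
    ring
  have e2 : ∀ v, abar γ i j v * (v j / 2) * pd i (fun v => u v ^ 2) v = abar γ i j v * v j * u v * pd i u v := by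
    intro v
    rw [hpu]
    ring
  refine ⟨i1, i2, ?_⟩
  have ibp := integral_mul_fderiv_eq_neg_fderiv_mul_of_integrable (μ := (volume : Measure V3))
    (f := fun v => abar γ i j v * (v j / 2)) (g := fun v => u v ^ 2) (v := EuclideanSpace.single i 1) i1
    (i2.congr (ae_of_all _ fun v => (e2 v).symm)) i3
    (fun v _ => hg.differentiable one_ne_zero v)
    (fun v _ => hu2 v)
  have ibp' : ∫ v, abar γ i j v * (v j / 2) * pd i (fun v => u v ^ 2) v
    = -∫ v, pd i (fun x => abar γ i j x * (x j / 2)) v * u v ^ 2 := ibp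
  simp_rw [e2] at ibp'
  rw [ibp', neg_neg]

/-- The difference of the two sides is `∫ A ξ·ξ` with `ξ = ∇u + v u/2`, and `A` is nonnegative. -/
lemma integral_drift_le_normASq (u : 𝓢(V3, ℝ)) : ∫ v, drift γ v * u v ^ 2 ≤ normASq γ u := by
  have h1 := fun i j => integral_drift_mul_sq hγ₁ hγ₂ i j u
  have h2 := fun i j => (integral_pd_abar_pd_mul hγ₁ hγ₂ i j u u).2.1
  have hp := integrable_zeroth_mul_sq (polyBound_potential hγ₁ hγ₂) (continuous_potential hγ₁ hγ₂) u
  have e : ∀ v, drift γ v * u v ^ 2 = ∑ i, ∑ j, pd i (fun x => abar γ i j x * (x j / 2)) v * u v ^ 2 := by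
    intro v
    simp_rw [drift, Finset.sum_mul]
  rw [normASq_eq hγ₁ hγ₂, gradForm]
  simp_rw [e]
  rw [integral_sum₂ fun i j => (h1 i j).1, sum_congr₂ fun i j => (h1 i j).2.2, ← integral_sum₂ h2,
    ← integral_add (integrable_sum₂ h2) hp]
  simp_rw [Finset.sum_neg_distrib]
  have i12 : Integrable (fun v => ∑ i, ∑ j, abar γ i j v * pd j u v * pd i u v + potential γ v * u v ^ 2) :=
    (integrable_sum₂ h2).add hp
  rw [← integral_sum₂ fun i j => (h1 i j).2.1, ← sub_nonneg, sub_neg_eq_add,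
    ← integral_add i12 (integrable_sum₂ fun i j => (h1 i j).2.1)]
  refine integral_nonneg fun v => ?_
  have hq := sum_abar_nonneg hγ₁ hγ₂ v (fun i => pd i u v + v i / 2 * u v)
  have s01 := abar_symm (γ := γ) 0 1 v
  have s02 := abar_symm (γ := γ) 0 2 v
  have s12 := abar_symm (γ := γ) 1 2 v
  refine hq.trans (le_of_eq ?_)
  simp only [potential, Fin.sum_univ_three, s01, s02, s12]
  ring

lemma integral_landau_mul_self_eq (u : 𝓢(V3, ℝ)) :
    ∫ v, landau γ u v * u v = -normASq γ u + ∫ v, drift γ v * u v ^ 2 := by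
  have hp := integrable_zeroth_mul_sq (polyBound_potential hγ₁ hγ₂) (continuous_potential hγ₁ hγ₂) u
  have hd := integrable_zeroth_mul_sq (polyBound_drift hγ₁ hγ₂) (continuous_drift hγ₁ hγ₂) u
  rw [integral_landau_mul_self hγ₁ hγ₂, normASq_eq hγ₁ hγ₂]
  simp_rw [sub_mul]
  rw [integral_sub hp hd]
  ring

lemma integral_landau_mul_self_nonpos (u : 𝓢(V3, ℝ)) : ∫ v, landau γ u v * u v ≤ 0 := by
  rw [integral_landau_mul_self_eq hγ₁ hγ₂]
  linarith [integral_drift_le_normASq hγ₁ hγ₂ u]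

/-- With `I = ∫ drift u²`, the bounds `I ≤ ‖u‖_A²` and `I ≤ C ‖u‖²_{2,γ/2}` are combined as `I = √I
√I ≤ ‖u‖_A · √C ‖u‖_{2,γ/2}`, whence the constant `√C`. -/
lemma exists_isEnergyConstant : ∃ C₀ : ℝ, 0 < C₀ ∧ IsEnergyConstant γ C₀ := by
  obtain ⟨C, hC, hd⟩ := drift_le hγ₁ hγ₂
  refine ⟨Real.sqrt C, Real.sqrt_pos.2 hC, fun u => ?_⟩
  rw [integral_landau_mul_self_eq hγ₁ hγ₂]
  set I := ∫ v, drift γ v * u v ^ 2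
  set N := normASq γ u
  have h1 : I ≤ N := integral_drift_le_normASq hγ₁ hγ₂ u
  have hbr : ∀ v, 1 ≤ bracket v := fun v => by
    rw [bracket, Real.one_le_sqrt]; nlinarith [sq_nonneg ‖v‖]
  have hbr2 : ∀ v, bracket v ≤ 1 + ‖v‖ := fun v => by
    rw [bracket]
    apply Real.sqrt_le_iff.2 ⟨by positivity, by nlinarith [norm_nonneg v]⟩
  have hbc : Continuous bracket := by unfold bracket; fun_prop
  have hw : Integrable (fun v => (bracket v ^ (γ / 2) * u v) ^ 2) := by
    have hcc : Continuous (fun v => bracket v ^ (γ / 2)) :=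
      hbc.rpow_const fun v => Or.inl (zero_lt_one.trans_le (hbr v)).ne'
    have hpb : PolyBound (fun v => bracket v ^ (γ / 2)) := ⟨1, 0, fun v => by
      rw [Real.norm_of_nonneg (Real.rpow_nonneg (zero_le_one.trans (hbr v)) _), pow_zero, mul_one]
      exact Real.rpow_le_one_of_one_le_of_nonpos (hbr v) (by linarith)⟩
    exact (integrable_zeroth_mul_sq (hpb.mul hpb) (hcc.mul hcc) u).congr
      (ae_of_all _ fun v => by dsimp; ring)
  have h2 : I ≤ C * ∫ v, (bracket v ^ (γ / 2) * u v) ^ 2 := by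
    rw [← integral_const_mul]
    refine integral_mono (integrable_zeroth_mul_sq (polyBound_drift hγ₁ hγ₂) (continuous_drift hγ₁ hγ₂) u)
      (hw.const_mul C) fun v => ?_
    have e : (bracket v ^ (γ / 2) * u v) ^ 2 = bracket v ^ γ * u v ^ 2 := by
      rw [mul_pow, ← Real.rpow_natCast, ← Real.rpow_mul (by linarith [hbr v])]
      congr 2
      push_cast
      ring
    dsimp only
    rw [e, ← mul_assoc]
    refine mul_le_mul_of_nonneg_right ((hd v).trans (mul_le_mul_of_nonneg_left ?_ hC.le)) (sq_nonneg _)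
    exact Real.rpow_le_rpow_of_nonpos (by linarith [hbr v]) (hbr2 v) hγ₂.le
  have h3 : I ≤ Real.sqrt C * Real.sqrt N * weightedNorm (γ / 2) u := by
    rcases le_or_gt I 0 with h0 | h0
    · exact h0.trans (by unfold weightedNorm; positivity)
    · have a1 : Real.sqrt I ≤ Real.sqrt N := Real.sqrt_le_sqrt h1
      have a2 : Real.sqrt I ≤ Real.sqrt C * weightedNorm (γ / 2) u := by
        rw [weightedNorm, ← Real.sqrt_mul hC.le]
        exact Real.sqrt_le_sqrt h2
      calc I = Real.sqrt I * Real.sqrt I := (Real.mul_self_sqrt h0.le).symm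
        _ ≤ Real.sqrt N * (Real.sqrt C * weightedNorm (γ / 2) u) := by gcongr
        _ = _ := by ring
  linarith

end

/-! ### Convolution and Fubini -/

/-- Convolution of scalar functions on `ℝ³`. -/
def mol (ρ u : V3 → ℝ) : V3 → ℝ := convolution ρ u (ContinuousLinearMap.mul ℝ ℝ) volume

lemma mol_apply (ρ u : V3 → ℝ) (x : V3) : mol ρ u x = ∫ y, ρ (x - y) * u y := by
  rw [mol, convolution_eq_swap]; rfl

lemma hasCompactSupport_pd {ρ : V3 → ℝ} (h : HasCompactSupport ρ) (i : Fin 3) : HasCompactSupport (pd i ρ) :=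
  h.fderiv_apply ℝ _

lemma pd_mol_left {ρ u : V3 → ℝ} (hρ : HasCompactSupport ρ) (hc : ContDiff ℝ 1 ρ) (hu : LocallyIntegrable u)
    (i : Fin 3) (v : V3) : pd i (mol ρ u) v = mol (pd i ρ) u v := by
  have h := hρ.hasFDerivAt_convolution_left (ContinuousLinearMap.mul ℝ ℝ) hc hu v
  have h' : pd i (mol ρ u) v = _ := pd_eq_of_hasFDerivAt h i
  rw [h', mol, convolution, convolution, ContinuousLinearMap.integral_apply]
  · rfl
  · exact (hρ.fderiv (𝕜 := ℝ)).convolutionExists_left _ (hc.continuous_fderiv one_ne_zero) hu v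

lemma pd_mol_right {ρ w : V3 → ℝ} (hρ : LocallyIntegrable ρ) (hw : HasCompactSupport w) (hc : ContDiff ℝ 1 w)
    (i : Fin 3) (v : V3) : pd i (mol ρ w) v = mol ρ (pd i w) v := by
  have h := hw.hasFDerivAt_convolution_right (ContinuousLinearMap.mul ℝ ℝ) hρ hc v
  have h' : pd i (mol ρ w) v = _ := pd_eq_of_hasFDerivAt h i
  rw [h', mol, convolution, convolution, ContinuousLinearMap.integral_apply]
  · rfl
  · exact (hw.fderiv (𝕜 := ℝ)).convolutionExists_right _ hρ (hc.continuous_fderiv one_ne_zero) v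

/-- The common Fubini argument for the adjoint of mollification and for the commutator formula.
Since `k` vanishes off a bounded set, `u` may be truncated to a ball, where it is integrable. -/
lemma integral_mul_integral_swap {u : V3 → ℝ} (hu : LocallyIntegrable u) {k : V3 → V3 → ℝ}
    (hk : Continuous (Function.uncurry k)) {R : ℝ} (hR : ∀ v y, R < ‖v‖ ∨ R < ‖y‖ → k v y = 0) :
    ∫ v, u v * ∫ y, k v y = ∫ y, ∫ v, u v * k v y := by
  set B := Metric.closedBall (0 : V3) R
  have hB : IsCompact B := isCompact_closedBall 0 R
  obtain ⟨M, hM⟩ := (hB.prod hB).exists_bound_of_continuousOn hk.continuousOn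
  have hb : ∀ v y, ‖k v y‖ ≤ B.indicator (fun _ => |M|) y := by
    intro v y
    by_cases hv : v ∈ B
    · by_cases hy : y ∈ B
      · rw [indicator_of_mem hy]
        exact (hM (v, y) ⟨hv, hy⟩).trans (le_abs_self M)
      · rw [indicator_of_notMem hy, hR v y (Or.inr (by simpa [B] using hy)), norm_zero]
    · rw [hR v y (Or.inl (by simpa [B] using hv)), norm_zero]
      exact indicator_nonneg (fun _ _ => abs_nonneg M) y
  have hu' : Integrable (B.indicator u) := (hu.integrableOn_isCompact hB).integrable_indicator hB.measurableSet
  have h1 : Integrable (B.indicator (fun _ : V3 => |M|)) :=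
    (integrableOn_const hB.measure_lt_top.ne).integrable_indicator hB.measurableSet
  have hp := hu'.mul_prod h1
  have hint : Integrable (Function.uncurry fun v y => B.indicator u v * k v y) (volume.prod volume) := by
    refine hp.mono (AEStronglyMeasurable.mul hu'.aestronglyMeasurable.comp_fst hk.aestronglyMeasurable)
      (ae_of_all _ fun x => ?_)
    simp only [Function.uncurry, norm_mul]
    gcongr
    exact (hb x.1 x.2).trans (le_abs_self _)
  have e : ∀ v y, u v * k v y = B.indicator u v * k v y := by
    intro v y
    by_cases hv : v ∈ B
    · rw [indicator_of_mem hv]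
    · rw [hR v y (Or.inl (by simpa [B] using hv)), mul_zero, mul_zero]
  simp_rw [← integral_const_mul, e]
  exact integral_integral_swap hint

lemma exists_norm_bound {w : V3 → ℝ} (hw : HasCompactSupport w) : ∃ R : ℝ, 0 < R ∧ ∀ y, R < ‖y‖ → w y = 0 := by
  obtain ⟨R, hR⟩ := hw.isCompact.isBounded.subset_closedBall (0 : V3)
  refine ⟨max R 1, by positivity, fun y hy => image_eq_zero_of_notMem_tsupport fun h => ?_⟩
  have := hR h
  simp only [Metric.mem_closedBall, dist_zero_right] at this
  exact absurd ((le_max_left R 1).trans_lt hy) (not_lt.2 this)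

/-- Convolution with an even function is symmetric for the `L²` pairing. -/
lemma integral_mul_mol {ρ g w : V3 → ℝ} (hρ : Continuous ρ) (hρc : HasCompactSupport ρ)
    (he : ∀ x, ρ (-x) = ρ x) (hg : LocallyIntegrable g) (hw : Continuous w) (hwc : HasCompactSupport w) :
    ∫ v, g v * mol ρ w v = ∫ y, mol ρ g y * w y := by
  obtain ⟨R, hR0, hR⟩ := exists_norm_bound hwc
  obtain ⟨S, hS0, hS⟩ := exists_norm_bound hρc
  have hsub : Continuous fun p : V3 × V3 => p.1 - p.2 := continuous_fst.sub continuous_snd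
  have := integral_mul_integral_swap hg (k := fun v y => ρ (v - y) * w y) (R := R + S)
    ((hρ.comp hsub).mul (hw.comp continuous_snd)) ?_
  · simp_rw [mol_apply]
    rw [this]
    refine integral_congr_ae (ae_of_all _ fun y => ?_)
    dsimp only
    rw [← integral_mul_const]
    refine integral_congr_ae (ae_of_all _ fun v => ?_)
    dsimp only
    rw [← he (v - y), neg_sub]
    ring
  · intro v y h
    by_cases hy : R < ‖y‖
    · rw [hR y hy, mul_zero]
    · have hv : R + S < ‖v‖ := h.resolve_right (by linarith)
      rw [hS (v - y), zero_mul]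
      linarith [norm_sub_norm_le v y]

/-! ### Continuity of translations in `L²` -/

lemma norm_sq_L2 (F : L2V) : ‖F‖ ^ 2 = ∫ v, F v ^ 2 := by
  rw [← real_inner_self_eq_norm_sq, L2.inner_def]
  refine integral_congr_ae (ae_of_all _ fun v => ?_)
  simp [sq]

lemma norm_sq_toLp {f : V3 → ℝ} (hf : MemLp f 2) : ‖hf.toLp f‖ ^ 2 = ∫ v, f v ^ 2 := by
  rw [norm_sq_L2]
  refine integral_congr_ae ?_
  filter_upwards [hf.coeFn_toLp] with v hv
  rw [hv]

lemma exists_translation_bound {f : V3 → ℝ} (hf : MemLp f 2) {δ : ℝ} (hδ : 0 < δ) :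
    ∃ r : ℝ, 0 < r ∧ ∀ h : V3, ‖h‖ ≤ r → ∫ y, (f (y + h) - f y) ^ 2 ≤ δ := by
  have hmp : ∀ h : V3, MeasurePreserving (fun y : V3 => y + h) volume volume := fun h =>
    measurePreserving_add_right volume h
  set G : V3 → C(V3, V3) := fun h => ⟨fun y => y + h, by fun_prop⟩
  have hG : Continuous G := by
    refine ContinuousMap.continuous_of_continuous_uncurry _ ?_
    exact (continuous_snd.add continuous_fst)
  have hcont : Continuous fun h : V3 => (Lp.compMeasurePreserving (G h) (hmp h)) (hf.toLp f) :=
    (continuous_const (y := hf.toLp f)).compMeasurePreservingLp hG hmp (by norm_num)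
  have hN : Continuous fun h : V3 => ‖(Lp.compMeasurePreserving (G h) (hmp h)) (hf.toLp f) - hf.toLp f‖ ^ 2 :=
    ((hcont.sub continuous_const).norm).pow 2
  have hval : ∀ h : V3, ‖(Lp.compMeasurePreserving (G h) (hmp h)) (hf.toLp f) - hf.toLp f‖ ^ 2
      = ∫ y, (f (y + h) - f y) ^ 2 := by
    intro h
    rw [norm_sq_L2]
    refine integral_congr_ae ?_
    filter_upwards [Lp.coeFn_sub ((Lp.compMeasurePreserving (G h) (hmp h)) (hf.toLp f)) (hf.toLp f),
      Lp.coeFn_compMeasurePreserving (hf.toLp f) (hmp h), hf.coeFn_toLp,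
      (hmp h).quasiMeasurePreserving.ae hf.coeFn_toLp] with y h1 h2 h3 h4
    have h2' : (Lp.compMeasurePreserving (G h) (hmp h)) (hf.toLp f) y = (hf.toLp f) (y + h) := h2
    rw [h1, Pi.sub_apply, h2', h4, h3]
  simp_rw [hval] at hN
  have h0 : (fun h : V3 => ∫ y, (f (y + h) - f y) ^ 2) 0 < δ := by simpa using hδ
  have := (hN.continuousAt (x := (0 : V3))).eventually (gt_mem_nhds h0)
  obtain ⟨r, hr, hr'⟩ := Metric.eventually_nhds_iff_ball.1 this
  refine ⟨r / 2, by positivity, fun h hh => (hr' h ?_).le⟩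
  rw [mem_ball_zero_iff]
  linarith

/-- The mean over the ball of radius `ε` of the squared increments of `f`. -/
def meanSqIncr (f : V3 → ℝ) (ε : ℝ) (y : V3) : ℝ :=
  (ε ^ 3)⁻¹ * ∫ h in Metric.closedBall (0 : V3) ε, (f (y + h) - f y) ^ 2

/-- The volume of the unit ball. -/
def ballVol : ℝ := (volume : Measure V3).real (Metric.ball (0 : V3) 1)

lemma ballVol_nonneg : 0 ≤ ballVol := measureReal_nonneg

lemma volume_real_closedBall {ε : ℝ} (hε : 0 < ε) :
    (volume : Measure V3).real (Metric.closedBall (0 : V3) ε) = ε ^ 3 * ballVol := by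
  rw [Measure.addHaar_real_closedBall _ _ hε.le, finrank_V3]; rfl

lemma memLp_incr {f : V3 → ℝ} (hf : MemLp f 2) (h : V3) : MemLp (fun y => f (y + h) - f y) 2 :=
  (hf.comp_measurePreserving (measurePreserving_add_right volume h)).sub hf

/-- By Fubini the integral is `ε⁻³` times the integral over the ball of `‖f(· + h) - f‖²`, so
continuity of translations controls it. -/
lemma integrable_meanSqIncr {f : V3 → ℝ} (hm : Measurable f) (hf : MemLp f 2) {ε δ : ℝ} (hε : 0 < ε)
    (hδ : ∀ h : V3, ‖h‖ ≤ ε → ∫ y, (f (y + h) - f y) ^ 2 ≤ δ) :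
    Integrable (meanSqIncr f ε) ∧ ∫ y, meanSqIncr f ε y ≤ ballVol * δ := by
  set B := Metric.closedBall (0 : V3) ε
  have hmeas : Measurable (fun p : V3 × V3 => (f (p.1 + p.2) - f p.1) ^ 2) :=
    ((hm.comp (measurable_fst.add measurable_snd)).sub (hm.comp measurable_fst)).pow_const 2
  have hsm : StronglyMeasurable (fun h : V3 => ∫ y, (f (y + h) - f y) ^ 2) :=
    (hmeas.stronglyMeasurable).integral_prod_left (μ := (volume : Measure V3))
  have hδ0 : ∀ h ∈ B, ‖∫ y, (f (y + h) - f y) ^ 2‖ ≤ δ := by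
    intro h hh
    rw [Real.norm_of_nonneg (integral_nonneg fun y => sq_nonneg _)]
    exact hδ h (by simpa [B] using hh)
  have hBt : volume B ≠ ∞ := (isCompact_closedBall (0 : V3) ε).measure_lt_top.ne
  have hNi : IntegrableOn (fun h : V3 => ∫ y, (f (y + h) - f y) ^ 2) B := by
    refine Integrable.mono' (g := fun _ => δ) (integrableOn_const hBt) hsm.aestronglyMeasurable ?_
    exact (ae_restrict_iff' Metric.isClosed_closedBall.measurableSet).2 (ae_of_all _ hδ0)
  have hi : Integrable (fun p : V3 × V3 => (f (p.1 + p.2) - f p.1) ^ 2)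
      ((volume : Measure V3).prod (volume.restrict B)) := by
    rw [integrable_prod_iff' hmeas.aestronglyMeasurable]
    refine ⟨ae_of_all _ fun h => (memLp_incr hf h).integrable_sq, ?_⟩
    refine hNi.congr (ae_of_all _ fun h => integral_congr_ae (ae_of_all _ fun y => ?_))
    exact (Real.norm_of_nonneg (sq_nonneg _)).symm
  have hswap : ∫ y, ∫ h in B, (f (y + h) - f y) ^ 2 = ∫ h in B, ∫ y, (f (y + h) - f y) ^ 2 :=
    integral_integral_swap hi
  refine ⟨hi.integral_prod_left.const_mul _, ?_⟩
  have h1 : ∫ h in B, ∫ y, (f (y + h) - f y) ^ 2 ≤ δ * (ε ^ 3 * ballVol) := by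
    have := norm_setIntegral_le_of_norm_le_const hBt.lt_top hδ0
    rw [volume_real_closedBall hε] at this
    exact (le_abs_self _).trans this
  simp only [meanSqIncr]
  rw [integral_const_mul, hswap]
  calc _ ≤ (ε ^ 3)⁻¹ * (δ * (ε ^ 3 * ballVol)) := by gcongr
    _ = _ := by field_simp

lemma meanSqIncr_nonneg (f : V3 → ℝ) {ε : ℝ} (hε : 0 < ε) (y : V3) : 0 ≤ meanSqIncr f ε y :=
  mul_nonneg (by positivity) (integral_nonneg fun _ => sq_nonneg _)

/-- Cauchy–Schwarz against the constant 1, obtained by expanding the integral of `(m f - I)²`, where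
`m` is the total mass and `I = ∫ f`. -/
lemma sq_integral_le_of_finite {α : Type*} [MeasurableSpace α] {μ : Measure α} [IsFiniteMeasure μ] {f : α → ℝ}
    (hf : MemLp f 2 μ) : (∫ x, f x ∂μ) ^ 2 ≤ μ.real univ * ∫ x, f x ^ 2 ∂μ := by
  have h1 : Integrable f μ := hf.integrable (by norm_num)
  have h2 : Integrable (fun x => f x ^ 2) μ := hf.integrable_sq
  rcases eq_or_lt_of_le (measureReal_nonneg (μ := μ) (s := univ)) with h0 | h0
  · have : μ = 0 := by
      rw [← Measure.measure_univ_eq_zero]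
      exact (measureReal_eq_zero_iff).1 h0.symm
    simp [this]
  · set m := μ.real univ
    set I := ∫ x, f x ∂μ
    have h : 0 ≤ ∫ x, (m * f x - I) ^ 2 ∂μ := integral_nonneg fun _ => sq_nonneg _
    have e : ∀ x, (m * f x - I) ^ 2 = m ^ 2 * f x ^ 2 - 2 * m * I * f x + I ^ 2 := fun x => by ring
    simp_rw [e] at h
    have h3 : Integrable (fun x => m ^ 2 * f x ^ 2 - 2 * m * I * f x) μ := (h2.const_mul _).sub (h1.const_mul _)
    rw [integral_add h3 (integrable_const _),
      integral_sub (h2.const_mul _) (h1.const_mul _), integral_const_mul, integral_const_mul, integral_const] at h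
    have : 0 ≤ m * (m * (∫ x, f x ^ 2 ∂μ) - I ^ 2) := by
      calc 0 ≤ _ := h
        _ = _ := by simp only [smul_eq_mul]; ring
    have := nonneg_of_mul_nonneg_right this h0
    linarith

/-- Cauchy–Schwarz on a ball of volume `ε³ ballVol`: a kernel of size `ε⁻³` gives exactly the
normalised mean of squared increments. It serves for the mollifier and for the commutator kernel
alike. -/
lemma sq_integral_incr_le {f k : V3 → ℝ} (hf : MemLp f 2) {ε M : ℝ} (hε : 0 < ε) (y : V3)
    (hk : ∀ h, |k h| ≤ M * (ε ^ 3)⁻¹) (hk0 : ∀ h, ε < ‖h‖ → k h = 0) :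
    (∫ h, k h * (f (y + h) - f y)) ^ 2 ≤ M ^ 2 * ballVol * meanSqIncr f ε y := by
  set B := Metric.closedBall (0 : V3) ε
  have hBt : volume B ≠ ∞ := (isCompact_closedBall (0 : V3) ε).measure_lt_top.ne
  have : IsFiniteMeasure ((volume : Measure V3).restrict B) := ⟨by simpa using hBt.lt_top⟩
  have hf1 : MemLp (fun h => f (y + h) - f y) 2 ((volume : Measure V3).restrict B) :=
    ((hf.comp_measurePreserving (measurePreserving_add_left volume y)).restrict B).sub (memLp_const (f y))
  have hf2 : MemLp (fun h => |f (y + h) - f y|) 2 ((volume : Measure V3).restrict B) := hf1.norm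
  have h1 : |∫ h, k h * (f (y + h) - f y)| ≤ M * (ε ^ 3)⁻¹ * ∫ h in B, |f (y + h) - f y| := by
    have e : ∫ h, k h * (f (y + h) - f y) = ∫ h in B, k h * (f (y + h) - f y) := by
      symm
      apply setIntegral_eq_integral_of_forall_compl_eq_zero
      intro h hh
      rw [hk0 h (by simpa [B] using hh), zero_mul]
    rw [e, ← integral_const_mul, ← Real.norm_eq_abs]
    refine norm_integral_le_of_norm_le ((hf2.integrable (by norm_num)).const_mul _) (ae_of_all _ fun h => ?_)
    rw [norm_mul]
    exact mul_le_mul_of_nonneg_right (hk h) (norm_nonneg _)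
  have h2 := sq_integral_le_of_finite hf2
  rw [measureReal_restrict_apply_univ, volume_real_closedBall hε] at h2
  simp_rw [sq_abs] at h2
  calc (∫ h, k h * (f (y + h) - f y)) ^ 2 = |∫ h, k h * (f (y + h) - f y)| ^ 2 := (sq_abs _).symm
    _ ≤ (M * (ε ^ 3)⁻¹ * ∫ h in B, |f (y + h) - f y|) ^ 2 := by gcongr
    _ = (M * (ε ^ 3)⁻¹) ^ 2 * (∫ h in B, |f (y + h) - f y|) ^ 2 := by ring
    _ ≤ (M * (ε ^ 3)⁻¹) ^ 2 * (ε ^ 3 * ballVol * ∫ h in B, (f (y + h) - f y) ^ 2) := by gcongr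
    _ = _ := by
      change _ = M ^ 2 * ballVol * ((ε ^ 3)⁻¹ * ∫ h in B, (f (y + h) - f y) ^ 2)
      field_simp

/-! ### Mollifiers -/

/-- A smooth even mollifier at scale `ε` with derivative bounds. -/
structure IsMollifier (M ε : ℝ) (ρ : V3 → ℝ) : Prop where
  smooth : ContDiff ℝ (⊤ : ℕ∞) ρ
  even : ∀ x, ρ (-x) = ρ x
  zero : ∀ x, ε < ‖x‖ → ρ x = 0
  integral : ∫ x, ρ x = 1
  bound : ∀ x, |ρ x| ≤ M * (ε ^ 3)⁻¹
  pd_bound : ∀ i x, |pd i ρ x| ≤ M * (ε ^ 4)⁻¹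

/-- All scales are dilates of one even bump, so a single `M` serves every `ε`, as the limit `ε → 0`
requires; a derivative costs one factor `ε⁻¹`. -/
lemma exists_isMollifier : ∃ M : ℝ, 0 < M ∧ ∀ ε : ℝ, 0 < ε → ∃ ρ, IsMollifier M ε ρ := by
  let φ : ContDiffBump (0 : V3) := ⟨1 / 2, 1, by norm_num, by norm_num⟩
  set η := φ.normed (volume : Measure V3) with hη
  have hηs : ContDiff ℝ (⊤ : ℕ∞) η := φ.contDiff_normed
  have hηc : HasCompactSupport η := φ.hasCompactSupport_normed
  have hη1 : ContDiff ℝ 1 η := hηs.of_le (by exact_mod_cast le_top)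
  obtain ⟨M₀, hM₀⟩ := hηc.exists_bound_of_continuous hηs.continuous
  have hpd : ∀ i, ∃ M, ∀ x, ‖pd i η x‖ ≤ M := fun i =>
    (hasCompactSupport_pd hηc i).exists_bound_of_continuous (continuous_pd hη1 i)
  choose M₁ hM₁ using hpd
  refine ⟨|M₀| + ∑ i, |M₁ i| + 1, by positivity, fun ε hε => ?_⟩
  have hsum : 0 ≤ ∑ i, |M₁ i| := Finset.sum_nonneg fun i _ => abs_nonneg _
  refine ⟨fun x => (ε ^ 3)⁻¹ * η (ε⁻¹ • x), ?_, ?_, ?_, ?_, ?_, ?_⟩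
  · exact contDiff_const.mul (hηs.comp (contDiff_const_smul _))
  · intro x
    rw [smul_neg, hη, φ.normed_neg]
  · intro x hx
    have : ε⁻¹ • x ∉ Function.support η := by
      rw [hη, φ.support_normed_eq]
      simp only [Metric.mem_ball, dist_zero_right, norm_smul, norm_inv, Real.norm_of_nonneg hε.le, not_lt]
      change 1 ≤ ε⁻¹ * ‖x‖
      rw [inv_mul_eq_div, one_le_div hε]
      exact hx.le
    rw [Function.notMem_support.1 this, mul_zero]
  · rw [integral_const_mul, Measure.integral_comp_smul, φ.integral_normed, finrank_V3, smul_eq_mul, mul_one,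
      inv_pow, inv_inv, abs_of_pos (by positivity)]
    field_simp
  · intro x
    rw [abs_mul, abs_of_pos (by positivity : 0 < (ε ^ 3)⁻¹), mul_comm]
    gcongr
    calc |η (ε⁻¹ • x)| ≤ M₀ := hM₀ _
      _ ≤ |M₀| := le_abs_self _
      _ ≤ _ := by linarith
  · intro i x
    have h1 : HasFDerivAt η (fderiv ℝ η (ε⁻¹ • x)) (ε⁻¹ • x) := (hη1.differentiable one_ne_zero _).hasFDerivAt
    have h2 := (h1.comp x ((hasFDerivAt_id x).const_smul ε⁻¹)).const_mul (ε ^ 3)⁻¹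
    have h3 : pd i (fun x => (ε ^ 3)⁻¹ * η (ε⁻¹ • x)) x = _ := pd_eq_of_hasFDerivAt h2 i
    have h4 : pd i (fun x => (ε ^ 3)⁻¹ * η (ε⁻¹ • x)) x = (ε ^ 4)⁻¹ * pd i η (ε⁻¹ • x) := by
      rw [h3, pd]
      simp
      field_simp
    rw [h4, abs_mul, abs_of_pos (by positivity : 0 < (ε ^ 4)⁻¹), mul_comm]
    gcongr
    calc |pd i η (ε⁻¹ • x)| ≤ M₁ i := hM₁ i _
      _ ≤ |M₁ i| := le_abs_self _
      _ ≤ ∑ i, |M₁ i| := Finset.single_le_sum (f := fun i => |M₁ i|) (fun i _ => abs_nonneg _) (Finset.mem_univ i)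
      _ ≤ _ := by linarith [abs_nonneg M₀]

namespace IsMollifier
variable {M ε : ℝ} {ρ : V3 → ℝ} (h : IsMollifier M ε ρ)
include h

lemma contDiff_one : ContDiff ℝ 1 ρ := h.smooth.of_le (by exact_mod_cast le_top)

lemma hasCompactSupport : HasCompactSupport ρ :=
  HasCompactSupport.of_support_subset_isCompact (isCompact_closedBall (0 : V3) ε) fun x hx => by
    by_contra hx'
    exact hx (h.zero x (by simpa using hx'))

lemma pd_zero (i : Fin 3) (x : V3) (hx : ε < ‖x‖) : pd i ρ x = 0 := by
  have : ρ =ᶠ[nhds x] fun _ => 0 := by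
    filter_upwards [(isOpen_lt continuous_const continuous_norm).mem_nhds hx] with z hz
    exact h.zero z hz
  rw [pd, this.fderiv_eq]
  simp

lemma locallyIntegrable : LocallyIntegrable ρ := h.smooth.continuous.locallyIntegrable

lemma mol_sub_eq {f : V3 → ℝ} (hf : LocallyIntegrable f) (y : V3) :
    mol ρ f y - f y = ∫ z, ρ z * (f (y + z) - f y) := by
  have e1 : mol ρ f y = ∫ z, ρ z * f (y + z) := by
    rw [mol_apply, ← integral_add_left_eq_self _ y]
    refine integral_congr_ae (ae_of_all _ fun z => ?_)
    dsimp only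
    rw [sub_add_cancel_left, h.even]
  have hi : Integrable (fun z => ρ z * f (y + z)) := by
    have hx := h.hasCompactSupport.convolutionExists_left (ContinuousLinearMap.mul ℝ ℝ) h.smooth.continuous hf y
    have := hx.integrable.comp_neg
    refine this.congr (ae_of_all _ fun z => ?_)
    simp [h.even]
  have hi2 : Integrable ρ := h.smooth.continuous.integrable_of_hasCompactSupport h.hasCompactSupport
  simp_rw [mul_sub]
  rw [integral_sub hi (hi2.mul_const _), integral_mul_const, h.integral, one_mul, e1]

lemma sq_mol_sub_le (hε : 0 < ε) {f : V3 → ℝ} (hf : MemLp f 2) (y : V3) :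
    (mol ρ f y - f y) ^ 2 ≤ M ^ 2 * ballVol * meanSqIncr f ε y := by
  rw [h.mol_sub_eq (hf.locallyIntegrable (by norm_num))]
  exact sq_integral_incr_le hf hε y h.bound h.zero

lemma continuous_mol {f : V3 → ℝ} (hf : LocallyIntegrable f) : Continuous (mol ρ f) :=
  h.hasCompactSupport.continuous_convolution_left _ h.smooth.continuous hf

lemma contDiff_mol {f : V3 → ℝ} (hf : LocallyIntegrable f) : ContDiff ℝ (⊤ : ℕ∞) (mol ρ f) :=
  h.hasCompactSupport.contDiff_convolution_left _ h.smooth hf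

lemma mol_zero {w : V3 → ℝ} {R : ℝ} (hw : ∀ y, R < ‖y‖ → w y = 0) (x : V3) (hx : R + ε < ‖x‖) :
    mol ρ w x = 0 := by
  rw [mol_apply]
  refine integral_eq_zero_of_ae (ae_of_all _ fun y => ?_)
  by_cases hy : R < ‖y‖
  · simp [hw y hy]
  · have : ε < ‖x - y‖ := by linarith [norm_sub_norm_le x y]
    simp [h.zero _ this]

end IsMollifier

lemma inner_toLp {f g : V3 → ℝ} (hf : MemLp f 2) (hg : MemLp g 2) :
    inner ℝ (hf.toLp f) (hg.toLp g) = ∫ v, f v * g v := by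
  rw [L2.inner_def]
  refine integral_congr_ae ?_
  filter_upwards [hf.coeFn_toLp, hg.coeFn_toLp] with v h1 h2
  rw [h1, h2]
  simp [mul_comm]

lemma integrable_meanSqIncr' {f : V3 → ℝ} (hm : Measurable f) (hf : MemLp f 2) {ε : ℝ} (hε : 0 < ε) :
    Integrable (meanSqIncr f ε) := by
  refine (integrable_meanSqIncr hm hf (δ := 4 * ∫ y, f y ^ 2) hε fun h _ => ?_).1
  have hmp := measurePreserving_add_right (volume : Measure V3) h
  have h1 : Integrable (fun y => f (y + h) ^ 2) := (hf.comp_measurePreserving hmp).integrable_sq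
  have h2 := hf.integrable_sq
  have h3 : ∫ y, f (y + h) ^ 2 = ∫ y, f y ^ 2 := integral_add_right_eq_self (fun y => f y ^ 2) h
  calc ∫ y, (f (y + h) - f y) ^ 2 ≤ ∫ y, (2 * f (y + h) ^ 2 + 2 * f y ^ 2) := by
        refine integral_mono (memLp_incr hf h).integrable_sq ((h1.const_mul 2).add (h2.const_mul 2)) fun y => ?_
        dsimp only
        nlinarith [sq_nonneg (f (y + h) + f y)]
    _ = 4 * ∫ y, f y ^ 2 := by
        rw [integral_add (h1.const_mul 2) (h2.const_mul 2), integral_const_mul, integral_const_mul, h3]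
        ring

lemma tendsto_integral_meanSqIncr {f : V3 → ℝ} (hm : Measurable f) (hf : MemLp f 2) :
    Tendsto (fun n : ℕ => ∫ y, meanSqIncr f (1 / ((n : ℝ) + 1)) y) atTop (𝓝 0) := by
  rw [Metric.tendsto_atTop]
  intro δ hδ
  have hb := ballVol_nonneg
  obtain ⟨r, hr, hr'⟩ := exists_translation_bound hf (δ := δ / (ballVol + 1) / 2) (by positivity)
  obtain ⟨N, hN⟩ := (Metric.tendsto_atTop.1 (tendsto_one_div_add_atTop_nhds_zero_nat (𝕜 := ℝ))) r hr
  refine ⟨N, fun n hn => ?_⟩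
  have hε : (0 : ℝ) < 1 / ((n : ℝ) + 1) := by positivity
  have h1 : 1 / ((n : ℝ) + 1) < r := by
    have := hN n hn
    rwa [Real.dist_eq, sub_zero, abs_of_pos hε] at this
  have h2 := (integrable_meanSqIncr hm hf hε fun h hh => hr' h (hh.trans h1.le)).2
  rw [Real.dist_eq, sub_zero, abs_of_nonneg (integral_nonneg fun y => meanSqIncr_nonneg f hε y)]
  calc _ ≤ _ := h2
    _ = δ / 2 * (ballVol / (ballVol + 1)) := by field_simp
    _ ≤ δ / 2 * 1 := by
        gcongr
        rw [div_le_one (by positivity)]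
        linarith
    _ < δ := by linarith

section moll
variable {M ε : ℝ} {ρ : V3 → ℝ}

lemma IsMollifier.memLp_mol_sub (h : IsMollifier M ε ρ) (hε : 0 < ε) {f : V3 → ℝ} (hm : Measurable f)
    (hf : MemLp f 2) : MemLp (fun y => mol ρ f y - f y) 2 := by
  have hs : AEStronglyMeasurable (fun y => mol ρ f y - f y) (volume : Measure V3) :=
    ((h.continuous_mol (hf.locallyIntegrable (by norm_num))).measurable.sub hm).aestronglyMeasurable
  rw [memLp_two_iff_integrable_sq hs]
  refine ((integrable_meanSqIncr' hm hf hε).const_mul (M ^ 2 * ballVol)).mono' (hs.pow 2) (ae_of_all _ fun y => ?_)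
  rw [Real.norm_of_nonneg (sq_nonneg _)]
  exact h.sq_mol_sub_le hε hf y

lemma IsMollifier.memLp_mol (h : IsMollifier M ε ρ) (hε : 0 < ε) {f : V3 → ℝ} (hm : Measurable f)
    (hf : MemLp f 2) : MemLp (mol ρ f) 2 := by
  have := (h.memLp_mol_sub hε hm hf).add hf
  convert this using 1
  funext y
  simp

lemma IsMollifier.integral_sq_mol_sub_le (h : IsMollifier M ε ρ) (hε : 0 < ε) {f : V3 → ℝ} (hm : Measurable f)
    (hf : MemLp f 2) : ∫ y, (mol ρ f y - f y) ^ 2 ≤ M ^ 2 * ballVol * ∫ y, meanSqIncr f ε y := by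
  rw [← integral_const_mul]
  exact integral_mono (h.memLp_mol_sub hε hm hf).integrable_sq ((integrable_meanSqIncr' hm hf hε).const_mul _)
    fun y => h.sq_mol_sub_le hε hf y

end moll

lemma tendsto_toLp_of_sq {f : V3 → ℝ} (hf : MemLp f 2) {F : ℕ → V3 → ℝ} (hF : ∀ n, MemLp (F n) 2)
    (h : Tendsto (fun n => ∫ y, (F n y - f y) ^ 2) atTop (𝓝 0)) :
    Tendsto (fun n => (hF n).toLp (F n)) atTop (𝓝 (hf.toLp f)) := by
  rw [tendsto_iff_norm_sub_tendsto_zero]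
  have e : ∀ n, ‖(hF n).toLp (F n) - hf.toLp f‖ = Real.sqrt (∫ y, (F n y - f y) ^ 2) := by
    intro n
    rw [← MemLp.toLp_sub, ← Real.sqrt_sq (norm_nonneg _), norm_sq_toLp]
    rfl
  simp_rw [e]
  simpa using h.sqrt

/-- Mollification converges in `L²`, multiplication by the bounded `b` preserves this, and the inner
product is continuous. -/
lemma tendsto_integral_mol_mul_mol {M : ℝ} {ρ : ℕ → V3 → ℝ}
    (hρ : ∀ n : ℕ, IsMollifier M (1 / ((n : ℝ) + 1)) (ρ n)) {f g b : V3 → ℝ} (hfm : Measurable f) (hf : MemLp f 2)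
    (hgm : Measurable g) (hg : MemLp g 2) (hb : Continuous b) {C : ℝ} (hC : ∀ v, |b v| ≤ C) :
    Tendsto (fun n => ∫ v, b v * mol (ρ n) f v * mol (ρ n) g v) atTop (𝓝 (∫ v, b v * f v * g v)) := by
  have hε : ∀ n : ℕ, (0 : ℝ) < 1 / ((n : ℝ) + 1) := fun n => by positivity
  have hbm : ∀ {φ : V3 → ℝ}, MemLp φ 2 → MemLp (fun v => b v * φ v) 2 := fun {φ} hφ => by
    refine (hφ.const_mul C).mono (hb.aestronglyMeasurable.mul hφ.1) (ae_of_all _ fun v => ?_)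
    rw [norm_mul, norm_mul]
    gcongr
    exact (hC v).trans (le_abs_self C)
  have hlim : ∀ {φ : V3 → ℝ}, Measurable φ → MemLp φ 2 →
      Tendsto (fun n => ∫ y, (mol (ρ n) φ y - φ y) ^ 2) atTop (𝓝 0) := fun {φ} hφm hφ => by
    have h0 : Tendsto (fun n : ℕ => M ^ 2 * ballVol * ∫ y, meanSqIncr φ (1 / ((n : ℝ) + 1)) y) atTop (𝓝 0) := by
      simpa using (tendsto_integral_meanSqIncr hφm hφ).const_mul (M ^ 2 * ballVol)
    exact squeeze_zero (fun n => integral_nonneg fun _ => sq_nonneg _)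
      (fun n => (hρ n).integral_sq_mol_sub_le (hε n) hφm hφ) h0
  have h1 := tendsto_toLp_of_sq (hbm hf) (fun n => hbm ((hρ n).memLp_mol (hε n) hfm hf)) (by
    have h0 : Tendsto (fun n : ℕ => C ^ 2 * ∫ y, (mol (ρ n) f y - f y) ^ 2) atTop (𝓝 0) := by
      simpa using (hlim hfm hf).const_mul (C ^ 2)
    refine squeeze_zero (fun n => integral_nonneg fun _ => sq_nonneg _) (fun n => ?_) h0
    rw [← integral_const_mul]
    have hi := (hρ n).memLp_mol_sub (hε n) hfm hf
    refine integral_mono ((hbm hi).integrable_sq.congr (ae_of_all _ fun v => by dsimp; ring))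
      (hi.integrable_sq.const_mul _) fun v => ?_
    have h2 : b v ^ 2 ≤ C ^ 2 := sq_le_sq' (abs_le.1 (hC v)).1 (abs_le.1 (hC v)).2
    calc (b v * mol (ρ n) f v - b v * f v) ^ 2 = b v ^ 2 * (mol (ρ n) f v - f v) ^ 2 := by ring
      _ ≤ _ := by gcongr)
  have h2 := tendsto_toLp_of_sq hg (fun n => (hρ n).memLp_mol (hε n) hgm hg) (hlim hgm hg)
  have h3 := h1.inner (𝕜 := ℝ) h2
  simpa only [inner_toLp] using h3

/-! ### The commutator of a divergence form operator with a mollifier -/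

/-- The kernel of the commutator of `∂ᵢ a` with the convolution by `ρ`. -/
def commKernel (a ρ : V3 → ℝ) (i : Fin 3) (y z : V3) : ℝ :=
  pd i a (y + z) * ρ z + (a (y + z) - a y) * pd i ρ z

lemma integrable_mul_of_compact {f k : V3 → ℝ} (hf : LocallyIntegrable f) (hk : Continuous k)
    (hc : HasCompactSupport k) : Integrable (fun v => f v * k v) :=
  (hf.integrable_smul_right_of_hasCompactSupport hk hc).congr (ae_of_all _ fun v => by simp)

lemma pd_comp_add {K : V3 → ℝ} (hK : Differentiable ℝ K) (y : V3) (i : Fin 3) (z : V3) :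
    pd i (fun z => K (y + z)) z = pd i K (y + z) := by
  have h := (hK (y + z)).hasFDerivAt.comp z ((hasFDerivAt_id z).const_add y)
  have h' : pd i (fun z => K (y + z)) z = _ := pd_eq_of_hasFDerivAt h i
  rw [h']
  simp [pd]

section comm
variable {a ρ f h : V3 → ℝ} {M ε : ℝ}

lemma continuous_commKernel (ha : ContDiff ℝ 1 a) (hρ : ContDiff ℝ 1 ρ) (i : Fin 3) (y : V3) :
    Continuous (commKernel a ρ i y) := by
  have h1 : Continuous fun z : V3 => y + z := continuous_const.add continuous_id
  exact (((continuous_pd ha i).comp h1).mul hρ.continuous).add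
    (((ha.continuous.comp h1).sub continuous_const).mul (continuous_pd hρ i))

lemma commKernel_zero (hρ : IsMollifier M ε ρ) (i : Fin 3) (y z : V3) (hz : ε < ‖z‖) :
    commKernel a ρ i y z = 0 := by
  rw [commKernel, hρ.zero z hz, hρ.pd_zero i z hz]
  simp

lemma hasCompactSupport_commKernel (hρ : IsMollifier M ε ρ) (i : Fin 3) (y : V3) :
    HasCompactSupport (commKernel a ρ i y) :=
  HasCompactSupport.of_support_subset_isCompact (isCompact_closedBall (0 : V3) ε) fun z hz => by
    by_contra hz'
    exact hz (commKernel_zero hρ i y z (by simpa using hz'))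

/-- The kernel is the derivative in `z` of `(a(y+z) - a(y)) ρ(z)`, which has compact support. This
cancellation allows the constant `f(y)` to be subtracted from `f(y+z)`. -/
lemma integral_commKernel (ha : ContDiff ℝ 1 a) (hρ : IsMollifier M ε ρ) (i : Fin 3) (y : V3) :
    ∫ z, commKernel a ρ i y z = 0 := by
  have hρ1 := hρ.contDiff_one
  have hc := hρ.hasCompactSupport
  have h1 : Continuous fun z : V3 => y + z := continuous_const.add continuous_id
  have hA : ContDiff ℝ 1 (fun z => a (y + z) - a y) := (ha.comp (contDiff_const.add contDiff_id)).sub contDiff_const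
  have hpd : ∀ z, pd i (fun z => a (y + z) - a y) z = pd i a (y + z) := by
    intro z
    rw [← pd_comp_add (ha.differentiable one_ne_zero) y i z, pd, pd, fderiv_sub_const]
  have i1 : Integrable (fun z => pd i (fun z => a (y + z) - a y) z * ρ z) :=
    ((continuous_pd hA i).mul hρ1.continuous).integrable_of_hasCompactSupport hc.mul_left
  have i2 : Integrable (fun z => (a (y + z) - a y) * pd i ρ z) :=
    (hA.continuous.mul (continuous_pd hρ1 i)).integrable_of_hasCompactSupport (hasCompactSupport_pd hc i).mul_left
  have i3 : Integrable (fun z => (a (y + z) - a y) * ρ z) :=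
    (hA.continuous.mul hρ1.continuous).integrable_of_hasCompactSupport hc.mul_left
  have ibp := integral_mul_fderiv_eq_neg_fderiv_mul_of_integrable (μ := (volume : Measure V3))
    (f := fun z => a (y + z) - a y) (g := ρ) (v := EuclideanSpace.single i 1) i1 i2 i3
    (fun z _ => hA.differentiable one_ne_zero z) (fun z _ => hρ1.differentiable one_ne_zero z)
  have ibp' : ∫ z, (a (y + z) - a y) * pd i ρ z = -∫ z, pd i (fun z => a (y + z) - a y) z * ρ z := ibp
  have e : ∀ z, commKernel a ρ i y z = pd i (fun z => a (y + z) - a y) z * ρ z + (a (y + z) - a y) * pd i ρ z := by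
    intro z
    rw [hpd, commKernel]
  simp_rw [e]
  rw [integral_add i1 i2, ibp']
  ring

/-- Both divergence terms are double integrals of `f(v)` and `h(y)` against kernels in `(v, y)`. At
`v = y + z` the difference of the kernels is `commKernel`, and its mean over `z` is zero. -/
lemma commutator_eq (ha : ContDiff ℝ 1 a) (hρ : IsMollifier M ε ρ) (hf : LocallyIntegrable f)
    (hh : ContDiff ℝ 1 h) {R : ℝ} (hR : ∀ y, R < ‖y‖ → h y = 0) (i : Fin 3) :
    ∫ v, f v * pd i (fun x => a x * mol ρ h x) v = (∫ y, mol ρ f y * pd i (fun x => a x * h x) y)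
      + ∫ y, h y * ∫ z, commKernel a ρ i y z * (f (y + z) - f y) := by
  have hρ1 := hρ.contDiff_one
  have hρc := hρ.hasCompactSupport
  have hρ' := continuous_pd hρ1 i
  have hρ'c := hasCompactSupport_pd hρc i
  have hhc : HasCompactSupport h :=
    HasCompactSupport.of_support_subset_isCompact (isCompact_closedBall (0 : V3) R) fun z hz => by
      by_contra hz'
      exact hz (hR z (by simpa using hz'))
  have hhl : LocallyIntegrable h := hh.continuous.locallyIntegrable
  have hah : ContDiff ℝ 1 (fun x => a x * h x) := ha.mul hh
  have hahc : HasCompactSupport (fun x => a x * h x) := hhc.mul_left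
  have hmh : ContDiff ℝ 1 (mol ρ h) := (hρ.contDiff_mol hhl).of_le (by exact_mod_cast le_top)
  have hmhc : HasCompactSupport (mol ρ h) := hρc.convolution _ hhc
  have hsub : ∀ v : V3, Continuous fun y : V3 => v - y := fun v => continuous_const.sub continuous_id
  -- the two terms as integrals against `f`
  have e1 : ∀ v, pd i (fun x => a x * mol ρ h x) v
      = ∫ y, (pd i a v * ρ (v - y) + a v * pd i ρ (v - y)) * h y := by
    intro v
    have j1 : Integrable (fun y => ρ (v - y) * h y) :=
      ((hρ1.continuous.comp (hsub v)).mul hh.continuous).integrable_of_hasCompactSupport hhc.mul_left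
    have j2 : Integrable (fun y => pd i ρ (v - y) * h y) :=
      ((hρ'.comp (hsub v)).mul hh.continuous).integrable_of_hasCompactSupport hhc.mul_left
    rw [pd_mul (ha.differentiable one_ne_zero v) (hmh.differentiable one_ne_zero v),
      pd_mol_left hρc hρ1 hhl, mol_apply, mol_apply, ← integral_const_mul, ← integral_const_mul,
      ← integral_add (j1.const_mul _) (j2.const_mul _)]
    refine integral_congr_ae (ae_of_all _ fun y => ?_)
    dsimp only
    ring
  have e2 : ∫ y, mol ρ f y * pd i (fun x => a x * h x) y = ∫ v, f v * ∫ y, pd i ρ (v - y) * (a y * h y) := by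
    rw [← integral_mul_mol hρ1.continuous hρc hρ.even hf (continuous_pd hah i) (hasCompactSupport_pd hahc i)]
    refine integral_congr_ae (ae_of_all _ fun v => ?_)
    dsimp only
    rw [← pd_mol_right hρ.locallyIntegrable hahc hah, pd_mol_left hρc hρ1 hah.continuous.locallyIntegrable,
      mol_apply]
  have c1 : Integrable (fun v => f v * pd i (fun x => a x * mol ρ h x) v) :=
    integrable_mul_of_compact hf (continuous_pd (ha.mul hmh) i) (hasCompactSupport_pd hmhc.mul_left i)
  have c2 : Integrable (fun v => f v * ∫ y, pd i ρ (v - y) * (a y * h y)) := by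
    have e : (fun v => ∫ y, pd i ρ (v - y) * (a y * h y)) = mol (pd i ρ) (fun x => a x * h x) :=
      funext fun v => (mol_apply _ _ v).symm
    have := integrable_mul_of_compact hf (k := mol (pd i ρ) (fun x => a x * h x))
      (hρ'c.continuous_convolution_left _ hρ' hah.continuous.locallyIntegrable) (hρ'c.convolution _ hahc)
    rwa [← e] at this
  rw [← sub_eq_iff_eq_add', e2, ← integral_sub c1 c2]
  have e3 : ∀ v, f v * pd i (fun x => a x * mol ρ h x) v - f v * ∫ y, pd i ρ (v - y) * (a y * h y)
      = f v * ∫ y, (pd i a v * ρ (v - y) + (a v - a y) * pd i ρ (v - y)) * h y := by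
    intro v
    have j1 : Integrable (fun y => (pd i a v * ρ (v - y) + a v * pd i ρ (v - y)) * h y) :=
      (((continuous_const.mul (hρ1.continuous.comp (hsub v))).add
        (continuous_const.mul (hρ'.comp (hsub v)))).mul hh.continuous).integrable_of_hasCompactSupport hhc.mul_left
    have j2 : Integrable (fun y => pd i ρ (v - y) * (a y * h y)) :=
      ((hρ'.comp (hsub v)).mul hah.continuous).integrable_of_hasCompactSupport hahc.mul_left
    rw [← mul_sub, e1, ← integral_sub j1 j2]
    congr 1
    refine integral_congr_ae (ae_of_all _ fun y => ?_)
    dsimp only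
    ring
  simp_rw [e3]
  rw [integral_mul_integral_swap hf (R := R + ε)]
  · refine integral_congr_ae (ae_of_all _ fun y => ?_)
    dsimp only
    have hfy : LocallyIntegrable (fun z => f (y + z)) := by
      intro x
      obtain ⟨s, hs, hsi⟩ := hf (y + x)
      refine ⟨(fun z => y + z) ⁻¹' s, (continuous_const.add continuous_id).continuousAt hs, ?_⟩
      exact ((measurePreserving_add_left volume y).integrableOn_comp_preimage
        (Homeomorph.addLeft y).measurableEmbedding).2 hsi
    have k1 : Integrable (fun z => f (y + z) * commKernel a ρ i y z) :=
      integrable_mul_of_compact hfy (continuous_commKernel ha hρ1 i y) (hasCompactSupport_commKernel hρ i y)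
    have k2 : Integrable (fun z => f y * commKernel a ρ i y z) :=
      ((continuous_commKernel ha hρ1 i y).integrable_of_hasCompactSupport
        (hasCompactSupport_commKernel hρ i y)).const_mul _
    have e4 : ∫ z, commKernel a ρ i y z * (f (y + z) - f y) = ∫ z, f (y + z) * commKernel a ρ i y z := by
      have : ∀ z, commKernel a ρ i y z * (f (y + z) - f y)
          = f (y + z) * commKernel a ρ i y z - f y * commKernel a ρ i y z := fun z => by ring
      simp_rw [this]
      rw [integral_sub k1 k2, integral_const_mul, integral_commKernel ha hρ, mul_zero, sub_zero]
    rw [e4, ← integral_const_mul, ← integral_add_left_eq_self _ y]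
    refine integral_congr_ae (ae_of_all _ fun z => ?_)
    dsimp only
    rw [commKernel, add_sub_cancel_left]
    ring
  · have hs : Continuous fun p : V3 × V3 => p.1 - p.2 := continuous_fst.sub continuous_snd
    exact ((((continuous_pd ha i).comp continuous_fst).mul (hρ1.continuous.comp hs)).add
      (((ha.continuous.comp continuous_fst).sub (ha.continuous.comp continuous_snd)).mul (hρ'.comp hs))).mul
      (hh.continuous.comp continuous_snd)
  · intro v y hvy
    by_cases hy : R < ‖y‖
    · rw [hR y hy, mul_zero]
    -- For negative `ε` the mollifier would vanish identically, against its integral being 1.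
    · have hε0 : 0 ≤ ε := by
        by_contra hneg
        have : ∀ x, ρ x = 0 := fun x => hρ.zero x ((not_le.1 hneg).trans_le (norm_nonneg x))
        have h1 := hρ.integral
        simp [this] at h1
      have hv : R + ε < ‖v‖ := hvy.resolve_right (by linarith)
      have : ε < ‖v - y‖ := by linarith [norm_sub_norm_le v y]
      rw [hρ.zero _ this, hρ.pd_zero i _ this]
      ring

lemma exists_local_lipschitz (ha : ContDiff ℝ 1 a) (R : ℝ) : ∃ L : ℝ, 0 < L ∧
    (∀ x, ‖x‖ ≤ R → ∀ i, |pd i a x| ≤ L) ∧ ∀ x y, ‖x‖ ≤ R → ‖y‖ ≤ R → |a x - a y| ≤ L * ‖x - y‖ := by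
  obtain ⟨C, hC⟩ := (isCompact_closedBall (0 : V3) R).exists_bound_of_continuousOn
    (ha.continuous_fderiv one_ne_zero).continuousOn
  have hC' : ∀ x ∈ Metric.closedBall (0 : V3) R, ‖fderiv ℝ a x‖ ≤ |C| + 1 := fun x hx => by
    linarith [hC x hx, le_abs_self C]
  refine ⟨|C| + 1, by positivity, fun x hx i => ?_, fun x y hx hy => ?_⟩
  · have := (fderiv ℝ a x).le_opNorm (EuclideanSpace.single i 1)
    simp only [PiLp.norm_single, norm_one, mul_one] at this
    exact this.trans (hC' x (by simpa using hx))
  · exact (convex_closedBall (0 : V3) R).norm_image_sub_le_of_norm_fderiv_le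
      (fun x _ => ha.differentiable one_ne_zero x) hC' (by simpa using hy) (by simpa using hx)

/-- Friedrichs' lemma. On the support `a(y+z) - a(y)` is of size `ε`, which compensates the extra
`ε⁻¹` in `∂ρ`; the commutator kernel is thus no larger than a mollifier. Young's inequality with
weight `θ` separates `h`, to be absorbed, from the increments of `f`, which tend to zero. The
constant `L` depends only on `a`, `R` and `i`. -/
lemma commutator_le (ha : ContDiff ℝ 1 a) (R : ℝ) (i : Fin 3) : ∃ L : ℝ, 0 ≤ L ∧
    ∀ {M ε : ℝ} {ρ f h : V3 → ℝ}, 0 < ε → ε ≤ 1 → 0 ≤ M → IsMollifier M ε ρ → Measurable f → MemLp f 2 →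
    ContDiff ℝ 1 h → (∀ y, R < ‖y‖ → h y = 0) → ∀ θ : ℝ, 0 < θ →
    ∫ v, f v * pd i (fun x => a x * mol ρ h x) v ≤ (∫ y, mol ρ f y * pd i (fun x => a x * h x) y)
      + θ * (∫ y, h y ^ 2) + θ⁻¹ * (L * M ^ 2) * ∫ y, meanSqIncr f ε y := by
  -- Radius `R + 1`, because `h` lives in the ball of radius `R` and the kernel reaches at most `ε ≤
  -- 1` further.
  obtain ⟨L, hL, hL1, hL2⟩ := exists_local_lipschitz ha (R + 1)
  have hbv := ballVol_nonneg
  refine ⟨(2 * L) ^ 2 * ballVol, by positivity, ?_⟩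
  intro M ε ρ f h hε hε1 hM hρ hfm hf hh hR θ hθ
  rw [commutator_eq ha hρ (hf.locallyIntegrable (by norm_num)) hh hR i, add_assoc]
  gcongr
  have hhc : HasCompactSupport h :=
    HasCompactSupport.of_support_subset_isCompact (isCompact_closedBall (0 : V3) R) fun z hz => by
      by_contra hz'
      exact hz (hR z (by simpa using hz'))
  have hh2 : Integrable (fun y => h y ^ 2) := by
    have : Integrable (fun y => h y * h y) :=
      (hh.continuous.mul hh.continuous).integrable_of_hasCompactSupport hhc.mul_left
    simpa [sq] using this
  have hms := integrable_meanSqIncr' hfm hf hε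
  have hk : ∀ y, ‖y‖ ≤ R → ∀ z, |commKernel a ρ i y z| ≤ (2 * L * M) * (ε ^ 3)⁻¹ := by
    intro y hy z
    by_cases hz : ε < ‖z‖
    · rw [commKernel_zero hρ i y z hz, abs_zero]; positivity
    · rw [not_lt] at hz
      have hyz : ‖y + z‖ ≤ R + 1 := (norm_add_le _ _).trans (by linarith)
      have b1 := hL1 (y + z) hyz i
      have b2 := hL2 (y + z) y hyz (by linarith)
      rw [add_sub_cancel_left] at b2
      have b3 : |a (y + z) - a y| ≤ L * ε := b2.trans (by gcongr)
      calc |commKernel a ρ i y z| ≤ |pd i a (y + z) * ρ z| + |(a (y + z) - a y) * pd i ρ z| := abs_add_le _ _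
        _ = |pd i a (y + z)| * |ρ z| + |a (y + z) - a y| * |pd i ρ z| := by rw [abs_mul, abs_mul]
        _ ≤ L * (M * (ε ^ 3)⁻¹) + (L * ε) * (M * (ε ^ 4)⁻¹) :=
            add_le_add (mul_le_mul b1 (hρ.bound z) (abs_nonneg _) hL.le)
              (mul_le_mul b3 (hρ.pd_bound i z) (abs_nonneg _) (by positivity))
        _ = _ := by field_simp; ring
  have hp : ∀ y, ‖h y * ∫ z, commKernel a ρ i y z * (f (y + z) - f y)‖ ≤
      θ * h y ^ 2 + θ⁻¹ * ((2 * L) ^ 2 * ballVol * M ^ 2) * meanSqIncr f ε y := by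
    intro y
    have hm0 := meanSqIncr_nonneg f hε y
    by_cases hy : R < ‖y‖
    · rw [hR y hy, zero_mul, norm_zero]; positivity
    · set K := ∫ z, commKernel a ρ i y z * (f (y + z) - f y)
      have hK : K ^ 2 ≤ (2 * L * M) ^ 2 * ballVol * meanSqIncr f ε y :=
        sq_integral_incr_le hf hε y (hk y (not_lt.1 hy)) (commKernel_zero hρ i y)
      have h1 : |h y * K| ≤ θ * h y ^ 2 + θ⁻¹ * K ^ 2 := by
        rw [abs_mul]
        have h2 : 0 ≤ θ⁻¹ * (θ * |h y| - |K|) ^ 2 := by positivity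
        have h3 : θ⁻¹ * (θ * |h y| - |K|) ^ 2 = θ * |h y| ^ 2 - 2 * (|h y| * |K|) + θ⁻¹ * |K| ^ 2 := by
          field_simp; ring
        rw [h3, sq_abs, sq_abs] at h2
        nlinarith [mul_nonneg (abs_nonneg (h y)) (abs_nonneg K)]
      calc _ ≤ _ := h1
        _ ≤ θ * h y ^ 2 + θ⁻¹ * ((2 * L * M) ^ 2 * ballVol * meanSqIncr f ε y) := by gcongr
        _ = _ := by ring
  have := norm_integral_le_of_norm_le ((hh2.const_mul θ).add (hms.const_mul _)) (ae_of_all _ hp)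
  have h4 := (le_abs_self _).trans this
  simp only [Pi.add_apply] at h4
  rwa [integral_add (hh2.const_mul θ) (hms.const_mul _), integral_const_mul, integral_const_mul] at h4

end comm

/-! ### Local ellipticity and cut-off functions -/

section
variable {γ : ℝ} (hγ₁ : -3 < γ) (hγ₂ : γ < 0)
include hγ₁ hγ₂

/-- The integrand is strictly positive wherever `v - w` is not parallel to `x`, an open nonempty set
of `w`. -/
lemma sum_abar_pos (v : V3) {x : Fin 3 → ℝ} (hx : x ≠ 0) : 0 < ∑ i, ∑ j, abar γ i j v * x i * x j := by
  rw [sum_abar_mul hγ₁ hγ₂]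
  set F : V3 → ℝ := fun w => (∑ i, ∑ j, kernel γ i j (v - w) * x i * x j) * maxwellian w
  have hF0 : 0 ≤ F := fun w => mul_nonneg (sum_kernel_mul_nonneg _ _) (maxwellian_nonneg _)
  have hFi : Integrable F := by
    have : Integrable (fun w => ∑ i, ∑ j, kernel γ i j (v - w) * maxwellian w * (x i * x j)) :=
      integrable_sum₂ fun i j => (integrable_kernel hγ₁ hγ₂ contDiff_maxwellian.continuous decays_maxwellian i j v).mul_const _
    refine this.congr (ae_of_all _ fun w => ?_)
    simp only [F, Finset.sum_mul]
    exact sum_congr₂ fun i j => by ring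
  rw [integral_pos_iff_support_of_nonneg hF0 hFi]
  set D : V3 → ℝ := fun w => ‖v - w‖ ^ 2 * (x 0 ^ 2 + x 1 ^ 2 + x 2 ^ 2)
    - ((v - w) 0 * x 0 + (v - w) 1 * x 1 + (v - w) 2 * x 2) ^ 2
  have hsub : Continuous fun w : V3 => v - w := continuous_const.sub continuous_id
  have hD : Continuous D := by
    have h := fun i : Fin 3 => (continuous_coord i).comp hsub
    exact (((hsub.norm).pow 2).mul continuous_const).sub
      ((((h 0).mul continuous_const).add ((h 1).mul continuous_const)).add ((h 2).mul continuous_const) |>.pow 2)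
  have hopen : IsOpen {w | 0 < D w} := isOpen_lt continuous_const hD
  have hne : {w | 0 < D w}.Nonempty := by
    obtain ⟨k, hk⟩ := Function.ne_iff.1 hx
    have hk' : 0 < x k ^ 2 := by
      have : x k ≠ 0 := hk
      positivity
    -- With `x_k ≠ 0` and `l ≠ k`, the unit vector `e_l` is not parallel to `x`: the defect `|x|² -
    -- x_l²` is at least `x_k²`.
    obtain ⟨l, hl⟩ : ∃ l : Fin 3, l ≠ k := exists_ne k
    refine ⟨v - EuclideanSpace.single l 1, ?_⟩
    simp only [D, Set.mem_ofPred_eq, sub_sub_cancel, PiLp.norm_single, norm_one]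
    fin_cases k <;> fin_cases l <;> simp at hl hk' ⊢ <;>
      nlinarith [sq_nonneg (x 0), sq_nonneg (x 1), sq_nonneg (x 2)]
  refine (hopen.measure_pos volume hne).trans_le (measure_mono fun w hw => ?_)
  have hw' : 0 < D w := hw
  have hz : v - w ≠ 0 := by
    intro h0
    simp only [D, h0, norm_zero] at hw'
    nlinarith [sq_nonneg ((0 : V3) 0 * x 0 + (0 : V3) 1 * x 1 + (0 : V3) 2 * x 2)]
  simp only [Function.mem_support, F, sum_kernel_mul]
  have := norm_pos_iff.2 hz
  exact (mul_pos (mul_pos hw' (by positivity)) (maxwellian_pos w)).ne'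

/-- The quadratic form attains a positive minimum on the compact product of the ball and the unit
sphere; homogeneity extends the bound to all `x`. -/
lemma exists_elliptic (R : ℝ) : ∃ c : ℝ, 0 < c ∧ ∀ v : V3, ‖v‖ ≤ R → ∀ x : Fin 3 → ℝ,
    c * ∑ i, x i ^ 2 ≤ ∑ i, ∑ j, abar γ i j v * x i * x j := by
  rcases lt_or_ge R 0 with hR | hR
  · exact ⟨1, one_pos, fun v hv => absurd (hv.trans_lt hR) (not_lt.2 (norm_nonneg v))⟩
  set q : V3 × V3 → ℝ := fun p => ∑ i, ∑ j, abar γ i j p.1 * p.2 i * p.2 j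
  have hq : Continuous q := continuous_finsetSum _ fun i _ => continuous_finsetSum _ fun j _ =>
    (((continuous_abar hγ₁ hγ₂ i j).comp continuous_fst).mul ((continuous_coord i).comp continuous_snd)).mul
      ((continuous_coord j).comp continuous_snd)
  have hK : IsCompact (Metric.closedBall (0 : V3) R ×ˢ Metric.sphere (0 : V3) 1) :=
    (isCompact_closedBall _ _).prod (isCompact_sphere _ _)
  have hne : (Metric.closedBall (0 : V3) R ×ˢ Metric.sphere (0 : V3) 1).Nonempty :=
    ⟨(0, EuclideanSpace.single 0 1), by simpa using hR, by simp⟩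
  obtain ⟨p, hp, hmin⟩ := hK.exists_isMinOn hne hq.continuousOn
  have hp2 : (fun i => p.2 i) ≠ (0 : Fin 3 → ℝ) := by
    intro h0
    have : p.2 = 0 := by
      ext i
      exact congrFun h0 i
    have h1 := hp.2
    rw [this] at h1
    simp at h1
  refine ⟨q p, sum_abar_pos hγ₁ hγ₂ p.1 hp2, fun v hv x => ?_⟩
  set ξ : V3 := WithLp.toLp 2 x
  have hξ : ‖ξ‖ ^ 2 = ∑ i, x i ^ 2 := by
    rw [EuclideanSpace.norm_sq_eq]
    simp [ξ]
  rcases eq_or_ne ξ 0 with h0 | h0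
  · have : ∀ i, x i = 0 := fun i => congrArg (fun z : V3 => z i) h0
    simp [this]
  · have hn : 0 < ‖ξ‖ := norm_pos_iff.2 h0
    have hmem : (v, ‖ξ‖⁻¹ • ξ) ∈ Metric.closedBall (0 : V3) R ×ˢ Metric.sphere (0 : V3) 1 := by
      refine ⟨by simpa using hv, ?_⟩
      simp [norm_smul, hn.ne']
    have h1 : q p ≤ q (v, ‖ξ‖⁻¹ • ξ) := hmin hmem
    have h2 : q (v, ‖ξ‖⁻¹ • ξ) = (‖ξ‖ ^ 2)⁻¹ * ∑ i, ∑ j, abar γ i j v * x i * x j := by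
      simp only [q, Finset.mul_sum, PiLp.smul_apply, smul_eq_mul]
      refine sum_congr₂ fun i j => ?_
      simp only [ξ]
      field_simp
    rw [h2] at h1
    rw [← hξ]
    calc q p * ‖ξ‖ ^ 2 ≤ ((‖ξ‖ ^ 2)⁻¹ * ∑ i, ∑ j, abar γ i j v * x i * x j) * ‖ξ‖ ^ 2 := by gcongr
      _ = _ := by field_simp

end

/-- Dilates of one bump: the gradient is of size `1/R` with `C` independent of `R`, and lives in the
shell `R ≤ |v| ≤ 2R`, where `A` is then to be estimated. -/
lemma exists_cutoff : ∃ C : ℝ, 0 < C ∧ ∀ R : ℝ, 1 ≤ R → ∃ χ : V3 → ℝ, ContDiff ℝ (⊤ : ℕ∞) χ ∧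
    (∀ v, 0 ≤ χ v ∧ χ v ≤ 1) ∧ (∀ v, ‖v‖ ≤ R → χ v = 1) ∧ (∀ v, 2 * R < ‖v‖ → χ v = 0) ∧
    (∀ i v, |pd i χ v| ≤ C / R) ∧ (∀ i v, ‖v‖ < R → pd i χ v = 0) ∧ (∀ i v, 2 * R < ‖v‖ → pd i χ v = 0) := by
  let φ : ContDiffBump (0 : V3) := ⟨1, 2, by norm_num, by norm_num⟩
  have hφ : ContDiff ℝ 1 φ := φ.contDiff
  have hpd : ∀ i, ∃ M, ∀ x, ‖pd i φ x‖ ≤ M := fun i =>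
    (hasCompactSupport_pd φ.hasCompactSupport i).exists_bound_of_continuous (continuous_pd hφ i)
  choose M hM using hpd
  refine ⟨∑ i, |M i| + 1, by positivity, fun R hR => ?_⟩
  have hR0 : 0 < R := by linarith
  have hone : ∀ v : V3, ‖v‖ ≤ R → φ (R⁻¹ • v) = 1 := by
    intro v hv
    refine φ.one_of_mem_closedBall ?_
    simp only [Metric.mem_closedBall, dist_zero_right, norm_smul, norm_inv, Real.norm_of_nonneg hR0.le]
    change R⁻¹ * ‖v‖ ≤ 1
    rw [inv_mul_eq_div, div_le_one hR0]
    exact hv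
  have hzero : ∀ v : V3, 2 * R < ‖v‖ → φ (R⁻¹ • v) = 0 := by
    intro v hv
    refine φ.zero_of_le_dist ?_
    simp only [dist_zero_right, norm_smul, norm_inv, Real.norm_of_nonneg hR0.le]
    change 2 ≤ R⁻¹ * ‖v‖
    rw [inv_mul_eq_div, le_div_iff₀ hR0]
    exact hv.le
  refine ⟨fun v => φ (R⁻¹ • v), φ.contDiff.comp (contDiff_const_smul _), fun v => ⟨φ.nonneg, φ.le_one⟩,
    hone, hzero, ?_, ?_, ?_⟩
  · intro i v
    have h1 : HasFDerivAt φ (fderiv ℝ φ (R⁻¹ • v)) (R⁻¹ • v) := (hφ.differentiable one_ne_zero _).hasFDerivAt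
    have h2 := h1.comp v ((hasFDerivAt_id v).const_smul R⁻¹)
    have h3 : pd i (fun v => φ (R⁻¹ • v)) v = _ := pd_eq_of_hasFDerivAt h2 i
    have h4 : pd i (fun v => φ (R⁻¹ • v)) v = R⁻¹ * pd i φ (R⁻¹ • v) := by
      rw [h3, pd]
      simp
    rw [h4, abs_mul, abs_of_pos (by positivity : 0 < R⁻¹), div_eq_inv_mul]
    gcongr
    calc |pd i φ (R⁻¹ • v)| ≤ M i := hM i _
      _ ≤ |M i| := le_abs_self _
      _ ≤ ∑ i, |M i| := Finset.single_le_sum (f := fun i => |M i|) (fun i _ => abs_nonneg _) (Finset.mem_univ i)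
      _ ≤ _ := by linarith
  · intro i v hv
    have : (fun v => φ (R⁻¹ • v)) =ᶠ[𝓝 v] fun _ => 1 := by
      filter_upwards [(isOpen_lt continuous_norm continuous_const).mem_nhds hv] with z hz
      exact hone z (le_of_lt hz)
    rw [pd, this.fderiv_eq]
    simp
  · intro i v hv
    have : (fun v => φ (R⁻¹ • v)) =ᶠ[𝓝 v] fun _ => 0 := by
      filter_upwards [(isOpen_lt continuous_const continuous_norm).mem_nhds hv] with z hz
      exact hzero z hz
    rw [pd, this.fderiv_eq]
    simp

lemma hasCompactSupport_of_zero {h : V3 → ℝ} {R : ℝ} (hR : ∀ y, R < ‖y‖ → h y = 0) : HasCompactSupport h :=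
  HasCompactSupport.of_support_subset_isCompact (isCompact_closedBall (0 : V3) R) fun z hz => by
    by_contra hz'
    exact hz (hR z (by simpa using hz'))

lemma pd_zero_of_zero {h : V3 → ℝ} {R : ℝ} (hR : ∀ y, R < ‖y‖ → h y = 0) (i : Fin 3) (y : V3) (hy : R < ‖y‖) :
    pd i h y = 0 := by
  have : h =ᶠ[𝓝 y] fun _ => 0 := by
    filter_upwards [(isOpen_lt continuous_const continuous_norm).mem_nhds hy] with z hz
    exact hR z hz
  rw [pd, this.fderiv_eq]
  simp

lemma contDiff_pd {f : V3 → ℝ} (hf : ContDiff ℝ (⊤ : ℕ∞) f) (i : Fin 3) : ContDiff ℝ 1 (pd i f) := by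
  have h2 : ContDiff ℝ 2 f := contDiff_infty.1 hf 2
  exact (h2.fderiv_right (m := 1) (by norm_num)).clm_apply contDiff_const

lemma exists_schwartz_of_compact {f : V3 → ℝ} (hf : ContDiff ℝ (⊤ : ℕ∞) f) (hc : HasCompactSupport f) :
    ∃ ψ : 𝓢(V3, ℝ), ⇑ψ = f := ⟨hc.toSchwartzMap hf, rfl⟩

/-! ### The localised and mollified energy estimate -/

section
variable {γ : ℝ} (hγ₁ : -3 < γ) (hγ₂ : γ < 0)
include hγ₁ hγ₂

/-- By symmetry of `A`, pointwise `A∇U·∇(χ²U) = A∇(χU)·∇(χU) - (A∇χ·∇χ) U²`. The cut-off therefore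
costs only a zeroth order term of size `κ`. -/
lemma gradForm_cutoff {χ U : V3 → ℝ} (hχ : ContDiff ℝ (⊤ : ℕ∞) χ) (hU : ContDiff ℝ (⊤ : ℕ∞) U) {R κ : ℝ}
    (hχR : ∀ y, R < ‖y‖ → χ y = 0) (hκ : ∀ v, ∑ i, ∑ j, abar γ i j v * pd i χ v * pd j χ v ≤ κ)
    (hU2 : MemLp U 2) :
    ∑ i, ∑ j, ∫ y, U y * pd i (fun x => abar γ i j x * pd j (fun x => χ x ^ 2 * U x) x) y
      ≤ -gradForm γ (fun x => χ x * U x) + κ * ∫ y, U y ^ 2 := by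
  have hχ1 : ContDiff ℝ 1 χ := hχ.of_le (by exact_mod_cast le_top)
  have hU1 : ContDiff ℝ 1 U := hU.of_le (by exact_mod_cast le_top)
  have hχd := hχ1.differentiable one_ne_zero
  have hUd := hU1.differentiable one_ne_zero
  have hχc := hasCompactSupport_of_zero hχR
  have hw : ContDiff ℝ (⊤ : ℕ∞) (fun x => χ x ^ 2 * U x) := (hχ.pow 2).mul hU
  have hwR : ∀ y, R < ‖y‖ → χ y ^ 2 * U y = 0 := fun y hy => by rw [hχR y hy]; ring
  have hwc := hasCompactSupport_of_zero hwR
  have hg : ∀ i j, ContDiff ℝ 1 (fun x => abar γ i j x * pd j (fun x => χ x ^ 2 * U x) x) := fun i j =>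
    (contDiff_abar hγ₁ hγ₂ i j).mul (contDiff_pd hw j)
  have hgc : ∀ i j, HasCompactSupport (fun x => abar γ i j x * pd j (fun x => χ x ^ 2 * U x) x) := fun i j =>
    (hasCompactSupport_pd hwc j).mul_left
  have hpχ : ∀ i v, pd i (fun x => χ x * U x) v = pd i χ v * U v + χ v * pd i U v := fun i v =>
    pd_mul (hχd v) (hUd v) i
  have hpw : ∀ j v, pd j (fun x => χ x ^ 2 * U x) v = 2 * χ v * pd j χ v * U v + χ v ^ 2 * pd j U v := by
    intro j v
    have h1 := pd_mul ((hχd v).fun_mul (hχd v)) (hUd v) j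
    rw [pd_mul (hχd v) (hχd v)] at h1
    simp_rw [pow_two]
    rw [h1]
    ring
  have ibp : ∀ i j, ∫ y, U y * pd i (fun x => abar γ i j x * pd j (fun x => χ x ^ 2 * U x) x) y
      = -∫ y, pd i U y * (abar γ i j y * pd j (fun x => χ x ^ 2 * U x) y) := by
    intro i j
    exact integral_mul_fderiv_eq_neg_fderiv_mul_of_integrable (μ := (volume : Measure V3))
      (f := U) (g := fun x => abar γ i j x * pd j (fun x => χ x ^ 2 * U x) x) (v := EuclideanSpace.single i 1)
      (((continuous_pd hU1 i).mul (hg i j).continuous).integrable_of_hasCompactSupport (hgc i j).mul_left)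
      ((hU1.continuous.mul (continuous_pd (hg i j) i)).integrable_of_hasCompactSupport
        (hasCompactSupport_pd (hgc i j) i).mul_left)
      ((hU1.continuous.mul (hg i j).continuous).integrable_of_hasCompactSupport (hgc i j).mul_left)
      (fun y _ => hUd y) (fun y _ => (hg i j).differentiable one_ne_zero y)
  have hp : ContDiff ℝ 1 (fun x => χ x * U x) := hχ1.mul hU1
  have hpc : HasCompactSupport (fun x => χ x * U x) := hχc.mul_right
  have i1 : ∀ i j, Integrable (fun y => pd i U y * (abar γ i j y * pd j (fun x => χ x ^ 2 * U x) y)) := fun i j =>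
    ((continuous_pd hU1 i).mul (hg i j).continuous).integrable_of_hasCompactSupport (hgc i j).mul_left
  have i2 : ∀ i j, Integrable (fun y => abar γ i j y * pd j (fun x => χ x * U x) y * pd i (fun x => χ x * U x) y) :=
    fun i j => (((continuous_abar hγ₁ hγ₂ i j).mul (continuous_pd hp j)).mul (continuous_pd hp i)
      ).integrable_of_hasCompactSupport (hasCompactSupport_pd hpc i).mul_left
  simp_rw [ibp, Finset.sum_neg_distrib]
  rw [gradForm, ← integral_sum₂ i1, ← integral_sum₂ i2, ← integral_const_mul, ← sub_le_iff_le_add', sub_neg_eq_add,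
    add_comm, ← sub_eq_add_neg, ← integral_sub (integrable_sum₂ i2) (integrable_sum₂ i1)]
  refine integral_mono ((integrable_sum₂ i2).sub (integrable_sum₂ i1)) (hU2.integrable_sq.const_mul κ) fun v => ?_
  dsimp only
  have s01 := abar_symm (γ := γ) 0 1 v
  have s02 := abar_symm (γ := γ) 0 2 v
  have s12 := abar_symm (γ := γ) 1 2 v
  have e : (∑ i, ∑ j, abar γ i j v * pd j (fun x => χ x * U x) v * pd i (fun x => χ x * U x) v)
      - ∑ i, ∑ j, pd i U v * (abar γ i j v * pd j (fun x => χ x ^ 2 * U x) v)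
      = (∑ i, ∑ j, abar γ i j v * pd i χ v * pd j χ v) * U v ^ 2 := by
    simp only [hpχ, hpw, Fin.sum_univ_three, s01, s02, s12]
    ring
  rw [e]
  exact mul_le_mul_of_nonneg_right (hκ v) (sq_nonneg _)

/-- With `U = ρ * u`, testing against `ρ * (χ²U)` gives minus the Dirichlet form `E` of `χU`, the
cost `κ` of the cut-off, and commutator errors. The errors contain `θ ∫ |∇(χ²U)|²`, which local
ellipticity bounds by a multiple of `θ E` plus `L²` terms. The zeroth order coefficient has no sign,
so its contribution is controlled through dissipativity for the Schwartz function `χU`. -/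
lemma local_estimate {χ : V3 → ℝ} (hχ : ContDiff ℝ (⊤ : ℕ∞) χ) {R κ : ℝ} (hχ1 : ∀ v, |χ v| ≤ 1)
    (hχR : ∀ y, R < ‖y‖ → χ y = 0) (hκ : ∀ v, ∑ i, ∑ j, abar γ i j v * pd i χ v * pd j χ v ≤ κ) :
    ∃ C₁ K θ₀ : ℝ, 0 ≤ C₁ ∧ 0 ≤ K ∧ 0 < θ₀ ∧ ∀ {M ε : ℝ} {ρ u : V3 → ℝ}, 0 < ε → ε ≤ 1 → 0 ≤ M →
    IsMollifier M ε ρ → Measurable u → MemLp u 2 → ∀ θ : ℝ, 0 < θ → θ ≤ θ₀ →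
    ∃ ψ : 𝓢(V3, ℝ), ⇑ψ = mol ρ (fun y => χ y ^ 2 * mol ρ u y) ∧
    (∫ v, u v * landau γ ψ v) + (∫ v, u v * ((potential γ v - drift γ v) * ψ v))
      - (∫ v, (potential γ v - drift γ v) * (χ v * mol ρ u v) ^ 2)
      ≤ (κ + θ * C₁) * (∫ v, mol ρ u v ^ 2) + θ⁻¹ * (K * M ^ 2) * ∫ y, meanSqIncr u ε y := by
  obtain ⟨c, hc, hell⟩ := exists_elliptic hγ₁ hγ₂ R
  have hVc := continuous_zerothOrder hγ₁ hγ₂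
  set V : V3 → ℝ := fun v => potential γ v - drift γ v with hV
  obtain ⟨W₀, hW₀⟩ := (isCompact_closedBall (0 : V3) R).exists_bound_of_continuousOn hVc.continuousOn
  obtain ⟨W, hW0, hW⟩ : ∃ W : ℝ, 0 ≤ W ∧ ∀ v, ‖v‖ ≤ R → |V v| ≤ W :=
    ⟨|W₀|, abs_nonneg _, fun v hv => (hW₀ v (by simpa using hv)).trans (le_abs_self _)⟩
  have hχs1 : ContDiff ℝ 1 χ := hχ.of_le (by exact_mod_cast le_top)
  have hχd := hχs1.differentiable one_ne_zero
  have hχc := hasCompactSupport_of_zero hχR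
  have hpd : ∀ i, ∃ M, ∀ x, ‖pd i χ x‖ ≤ M := fun i =>
    (hasCompactSupport_pd hχc i).exists_bound_of_continuous (continuous_pd hχs1 i)
  choose Y hY using hpd
  choose L hL0 hL using fun i j => commutator_le (contDiff_abar hγ₁ hγ₂ i j) R i
  have hKs : 0 ≤ ∑ i, ∑ j, L i j := Finset.sum_nonneg fun i _ => Finset.sum_nonneg fun j _ => hL0 i j
  have hYs : 0 ≤ ∑ j, Y j ^ 2 := Finset.sum_nonneg fun j _ => sq_nonneg _
  -- The 6 in `6 / c` is 3 from the sum over `i` times 2 from `(a+b)² ≤ 2a² + 2b²`; `1/c` comes from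
  -- ellipticity. For `θ ≤ c/6` the factor `1 - 6θ/c` in front of `E` stays nonnegative.
  refine ⟨6 / c * W + 6 * ∑ j, Y j ^ 2, ∑ i, ∑ j, L i j, c / 6, by positivity, hKs, by positivity, ?_⟩
  intro M ε ρ u hε hε1 hM hρ hum hu θ hθ hθ₀
  have hul := hu.locallyIntegrable (by norm_num)
  set U := mol ρ u with hUdef
  have hUs : ContDiff ℝ (⊤ : ℕ∞) U := hρ.contDiff_mol hul
  have hUs1 : ContDiff ℝ 1 U := hUs.of_le (by exact_mod_cast le_top)
  have hUd := hUs1.differentiable one_ne_zero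
  have hU2 : MemLp U 2 := hρ.memLp_mol hε hum hu
  have hw : ContDiff ℝ (⊤ : ℕ∞) (fun x => χ x ^ 2 * U x) := (hχ.pow 2).mul hUs
  have hw1 : ContDiff ℝ 1 (fun x => χ x ^ 2 * U x) := hw.of_le (by exact_mod_cast le_top)
  have hwR : ∀ y, R < ‖y‖ → χ y ^ 2 * U y = 0 := fun y hy => by rw [hχR y hy]; ring
  have hwc := hasCompactSupport_of_zero hwR
  have hψs : ContDiff ℝ (⊤ : ℕ∞) (mol ρ (fun y => χ y ^ 2 * U y)) :=
    hρ.contDiff_mol hw.continuous.locallyIntegrable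
  have hψc : HasCompactSupport (mol ρ (fun y => χ y ^ 2 * U y)) := hρ.hasCompactSupport.convolution _ hwc
  obtain ⟨ψ, hψ⟩ := exists_schwartz_of_compact hψs hψc
  refine ⟨ψ, hψ, ?_⟩
  have hp : ContDiff ℝ (⊤ : ℕ∞) (fun x => χ x * U x) := hχ.mul hUs
  have hp1 : ContDiff ℝ 1 (fun x => χ x * U x) := hp.of_le (by exact_mod_cast le_top)
  have hpc : HasCompactSupport (fun x => χ x * U x) := hχc.mul_right
  obtain ⟨p, hpp⟩ := exists_schwartz_of_compact hp hpc
  have hpd' : ∀ j, pd j (mol ρ (fun y => χ y ^ 2 * U y)) = mol ρ (pd j fun y => χ y ^ 2 * U y) := fun j =>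
    funext fun v => pd_mol_right hρ.locallyIntegrable hwc hw1 j v
  -- expansion of `L ψ`
  have j1 : ∀ i j, Integrable (fun v => u v * pd i (fun x => abar γ i j x * pd j ψ x) v) := fun i j => by
    rw [hψ]
    exact integrable_mul_of_compact hul
      (continuous_pd ((contDiff_abar hγ₁ hγ₂ i j).mul (contDiff_pd hψs j)) i)
      (hasCompactSupport_pd (hasCompactSupport_pd hψc j).mul_left i)
  have j2 : Integrable (fun v => u v * (V v * ψ v)) := by
    rw [hψ]
    exact integrable_mul_of_compact hul (hVc.mul hψs.continuous) hψc.mul_left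
  have hA : (∫ v, u v * landau γ ψ v) + (∫ v, u v * (V v * ψ v)) =
      ∑ i, ∑ j, ∫ v, u v * pd i (fun x => abar γ i j x * mol ρ (pd j fun y => χ y ^ 2 * U y) x) v := by
    have e : ∀ v, u v * landau γ ψ v = (∑ i, ∑ j, u v * pd i (fun x => abar γ i j x * pd j ψ x) v)
        - u v * (V v * ψ v) := by
      intro v
      rw [landau_eq, mul_sub, Finset.mul_sum]
      simp_rw [Finset.mul_sum]
      rfl
    simp_rw [e]
    rw [integral_sub (integrable_sum₂ j1) j2, integral_sum₂ j1, sub_add_cancel]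
    rw [hψ]
    simp_rw [hpd']
  have hB : ∑ i, ∑ j, ∫ v, u v * pd i (fun x => abar γ i j x * mol ρ (pd j fun y => χ y ^ 2 * U y) x) v ≤
      ∑ i, ∑ j, ((∫ y, U y * pd i (fun x => abar γ i j x * pd j (fun x => χ x ^ 2 * U x) x) y)
        + θ * (∫ y, pd j (fun x => χ x ^ 2 * U x) y ^ 2) + θ⁻¹ * (L i j * M ^ 2) * ∫ y, meanSqIncr u ε y) :=
    Finset.sum_le_sum fun i _ => Finset.sum_le_sum fun j _ =>
      hL i j hε hε1 hM hρ hum hu (contDiff_pd hw j) (pd_zero_of_zero hwR j) θ hθ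
  have hC := gradForm_cutoff hγ₁ hγ₂ hχ hUs hχR hκ hU2
  set E := gradForm γ (fun x => χ x * U x) with hE
  set N := ∫ v, U v ^ 2 with hN
  have hN0 : 0 ≤ N := integral_nonneg fun _ => sq_nonneg _
  -- the gradient is controlled by the Dirichlet form
  have i2 : ∀ i j, Integrable (fun y => abar γ i j y * pd j (fun x => χ x * U x) y * pd i (fun x => χ x * U x) y) :=
    fun i j => (((continuous_abar hγ₁ hγ₂ i j).mul (continuous_pd hp1 j)).mul (continuous_pd hp1 i)
      ).integrable_of_hasCompactSupport (hasCompactSupport_pd hpc i).mul_left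
  have i3 : ∀ j, Integrable (fun y => pd j (fun x => χ x * U x) y ^ 2) := fun j => by
    simp_rw [sq]
    exact ((continuous_pd hp1 j).mul (continuous_pd hp1 j)).integrable_of_hasCompactSupport
      (hasCompactSupport_pd hpc j).mul_left
  have i4 : ∀ j, Integrable (fun y => pd j (fun x => χ x ^ 2 * U x) y ^ 2) := fun j => by
    simp_rw [sq]
    have hc1 : HasCompactSupport (pd j fun x => χ x * χ x * U x) := by
      have := hasCompactSupport_pd hwc j
      simpa only [sq] using this
    have hc2 : Continuous (pd j fun x => χ x * χ x * U x) := by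
      have := continuous_pd hw1 j
      simpa only [sq] using this
    exact (hc2.mul hc2).integrable_of_hasCompactSupport hc1.mul_left
  have hgrad : c * ∑ j, ∫ y, pd j (fun x => χ x * U x) y ^ 2 ≤ E := by
    rw [hE, gradForm, ← integral_finsetSum _ fun j _ => i3 j, ← integral_sum₂ i2, ← integral_const_mul]
    refine integral_mono ((integrable_finsetSum _ fun j _ => i3 j).const_mul c) (integrable_sum₂ i2) fun v => ?_
    dsimp only
    by_cases hv : ‖v‖ ≤ R
    · refine (hell v hv fun j => pd j (fun x => χ x * U x) v).trans (le_of_eq ?_)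
      exact sum_congr₂ fun i j => by ring
    · have hz : ∀ j, pd j (fun x => χ x * U x) v = 0 := fun j =>
        pd_zero_of_zero (R := R) (fun y hy => by rw [hχR y hy, zero_mul]) j v (not_le.1 hv)
      simp [hz]
  have hpU : ∀ v, (χ v * U v) ^ 2 ≤ U v ^ 2 := fun v => by
    rw [mul_pow]
    have : χ v ^ 2 ≤ 1 := by rw [sq_le_one_iff_abs_le_one]; exact hχ1 v
    nlinarith [sq_nonneg (U v)]
  have i5 : Integrable (fun v => (χ v * U v) ^ 2) := by
    refine hU2.integrable_sq.mono' ((hχ.continuous.mul hUs.continuous).pow 2).aestronglyMeasurable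
      (ae_of_all _ fun v => ?_)
    rw [Real.norm_of_nonneg (sq_nonneg _)]
    exact hpU v
  have hD : ∀ j, ∫ y, pd j (fun x => χ x ^ 2 * U x) y ^ 2 ≤
      2 * (∫ y, pd j (fun x => χ x * U x) y ^ 2) + 2 * Y j ^ 2 * N := by
    intro j
    rw [← integral_const_mul, hN, ← integral_const_mul, ← integral_add ((i3 j).const_mul 2) (hU2.integrable_sq.const_mul _)]
    refine integral_mono (i4 j) (((i3 j).const_mul 2).add (hU2.integrable_sq.const_mul _)) fun v => ?_
    dsimp only
    have e1 : pd j (fun x => χ x ^ 2 * U x) v = χ v * pd j (fun x => χ x * U x) v + (χ v * U v) * pd j χ v := by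
      have h1 := pd_mul (hχd v) ((hp1.differentiable one_ne_zero) v) j
      have e2 : (fun x => χ x ^ 2 * U x) = fun x => χ x * (χ x * U x) := by funext x; ring
      rw [e2, h1]
      ring
    have h2 : pd j χ v ^ 2 ≤ Y j ^ 2 := sq_le_sq' (abs_le.1 (hY j v)).1 (abs_le.1 (hY j v)).2
    have h3 : (χ v * pd j (fun x => χ x * U x) v) ^ 2 ≤ pd j (fun x => χ x * U x) v ^ 2 := by
      rw [mul_pow]
      have : χ v ^ 2 ≤ 1 := by rw [sq_le_one_iff_abs_le_one]; exact hχ1 v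
      nlinarith [sq_nonneg (pd j (fun x => χ x * U x) v)]
    have h4 : ((χ v * U v) * pd j χ v) ^ 2 ≤ Y j ^ 2 * U v ^ 2 := by
      rw [mul_pow, mul_comm (Y j ^ 2)]
      exact mul_le_mul (hpU v) h2 (sq_nonneg _) (sq_nonneg _)
    rw [e1]
    nlinarith [sq_nonneg (χ v * pd j (fun x => χ x * U x) v - (χ v * U v) * pd j χ v)]
  -- positivity of `-L` on the cut-off function
  have hE0 : -∫ v, V v * (χ v * U v) ^ 2 ≤ E := by
    have h1 := integral_landau_mul_self_nonpos hγ₁ hγ₂ p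
    rw [integral_landau_mul_self hγ₁ hγ₂, hpp] at h1
    linarith
  have hVb : |∫ v, V v * (χ v * U v) ^ 2| ≤ W * N := by
    rw [hN, ← integral_const_mul, ← Real.norm_eq_abs]
    refine norm_integral_le_of_norm_le (hU2.integrable_sq.const_mul W) (ae_of_all _ fun v => ?_)
    rw [norm_mul, Real.norm_of_nonneg (sq_nonneg (χ v * U v))]
    by_cases hv : ‖v‖ ≤ R
    · exact mul_le_mul (hW v hv) (hpU v) (sq_nonneg _) hW0
    · rw [hχR v (not_le.1 hv)]
      have := sq_nonneg (U v)
      simpa using mul_nonneg hW0 this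
  set I := ∫ v, V v * (χ v * U v) ^ 2
  set S := ∫ y, meanSqIncr u ε y
  have hsum : ∑ i : Fin 3, ∑ j, ((∫ y, U y * pd i (fun x => abar γ i j x * pd j (fun x => χ x ^ 2 * U x) x) y)
        + θ * (∫ y, pd j (fun x => χ x ^ 2 * U x) y ^ 2) + θ⁻¹ * (L i j * M ^ 2) * S)
      = (∑ i, ∑ j, ∫ y, U y * pd i (fun x => abar γ i j x * pd j (fun x => χ x ^ 2 * U x) x) y)
        + 3 * θ * (∑ j, ∫ y, pd j (fun x => χ x ^ 2 * U x) y ^ 2) + θ⁻¹ * ((∑ i, ∑ j, L i j) * M ^ 2) * S := by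
    simp only [Fin.sum_univ_three]
    ring
  have hDs : ∑ j, ∫ y, pd j (fun x => χ x ^ 2 * U x) y ^ 2 ≤ 2 / c * E + 2 * (∑ j, Y j ^ 2) * N := by
    have h1 : ∑ j, ∫ y, pd j (fun x => χ x * U x) y ^ 2 ≤ E / c := by
      rw [le_div_iff₀ hc, mul_comm]; exact hgrad
    calc _ ≤ ∑ j, (2 * (∫ y, pd j (fun x => χ x * U x) y ^ 2) + 2 * Y j ^ 2 * N) := Finset.sum_le_sum fun j _ => hD j
      _ = 2 * (∑ j, ∫ y, pd j (fun x => χ x * U x) y ^ 2) + 2 * (∑ j, Y j ^ 2) * N := by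
          simp only [Fin.sum_univ_three]; ring
      _ ≤ 2 * (E / c) + 2 * (∑ j, Y j ^ 2) * N := by gcongr
      _ = _ := by ring
  rw [hA]
  have hθc : θ * (6 / c) ≤ 1 := by
    calc θ * (6 / c) ≤ c / 6 * (6 / c) := by gcongr
      _ = 1 := by field_simp
  -- The fraction `1 - 6θ/c` of `-I` is paid for by the same fraction of `E`; the remaining fraction
  -- `6θ/c` is small and bounded by `W N`.
  have hlast : -E + θ * (6 / c) * E - I ≤ θ * (6 / c) * (W * N) := by
    have h1 : (1 - θ * (6 / c)) * (-I) ≤ (1 - θ * (6 / c)) * E := mul_le_mul_of_nonneg_left hE0 (by linarith)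
    have h2 : θ * (6 / c) * (-I) ≤ θ * (6 / c) * (W * N) :=
      mul_le_mul_of_nonneg_left ((neg_le_abs I).trans hVb) (by positivity)
    nlinarith
  have hDs' : 3 * θ * (∑ j, ∫ y, pd j (fun x => χ x ^ 2 * U x) y ^ 2) ≤
      θ * (6 / c) * E + θ * (6 * (∑ j, Y j ^ 2)) * N := by
    calc _ ≤ 3 * θ * (2 / c * E + 2 * (∑ j, Y j ^ 2) * N) := by gcongr
      _ = _ := by ring
  calc _ ≤ (-E + κ * N) + (θ * (6 / c) * E + θ * (6 * (∑ j, Y j ^ 2)) * N)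
        + θ⁻¹ * ((∑ i, ∑ j, L i j) * M ^ 2) * S - I := by linarith [hB, hsum, hC]
    _ ≤ _ := by
      have : (κ + θ * (6 / c * W + 6 * ∑ j, Y j ^ 2)) * N = κ * N + θ * (6 / c) * (W * N) + θ * (6 * (∑ j, Y j ^ 2)) * N := by
        ring
      linarith

end

/-! ### Dissipativity in the sense of distributions -/

section
variable {γ : ℝ} (hγ₁ : -3 < γ) (hγ₂ : γ < 0)
include hγ₁ hγ₂

/-- The order of limits matters: for fixed `θ` the mollification scale tends to zero and removes the
commutator error, which carries `θ⁻¹`; only then `θ → 0`, which removes `C₁`. -/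
lemma integral_cutoff_le {χ : V3 → ℝ} (hχ : ContDiff ℝ (⊤ : ℕ∞) χ) {R κ : ℝ} (hχ1 : ∀ v, |χ v| ≤ 1)
    (hχR : ∀ y, R < ‖y‖ → χ y = 0) (hκ : ∀ v, ∑ i, ∑ j, abar γ i j v * pd i χ v * pd j χ v ≤ κ)
    {u g : V3 → ℝ} (hum : Measurable u) (hu : MemLp u 2) (hgm : Measurable g) (hg : MemLp g 2)
    (h : ∀ ψ : 𝓢(V3, ℝ), ∫ v, u v * landau γ ψ v = ∫ v, g v * ψ v) :
    ∫ v, χ v ^ 2 * g v * u v ≤ κ * ∫ v, u v ^ 2 := by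
  obtain ⟨C₁, K, θ₀, hC₁, hK, hθ₀, hloc⟩ := local_estimate hγ₁ hγ₂ hχ hχ1 hχR hκ
  obtain ⟨M, hM, hex⟩ := exists_isMollifier
  have hε : ∀ n : ℕ, (0 : ℝ) < 1 / ((n : ℝ) + 1) := fun n => by positivity
  have hε1 : ∀ n : ℕ, 1 / ((n : ℝ) + 1) ≤ (1 : ℝ) := fun n => by
    rw [div_le_one (by positivity)]
    linarith [n.cast_nonneg (α := ℝ)]
  choose ρ hρ using fun n : ℕ => hex (1 / ((n : ℝ) + 1)) (hε n)
  have hVc := continuous_zerothOrder hγ₁ hγ₂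
  set V : V3 → ℝ := fun v => potential γ v - drift γ v with hV
  set B : Set V3 := Metric.closedBall 0 (R + 1)
  obtain ⟨W, hW⟩ := (isCompact_closedBall (0 : V3) (R + 1)).exists_bound_of_continuousOn hVc.continuousOn
  have hχc := hasCompactSupport_of_zero hχR
  -- The coefficient `V` need not be bounded, but the test functions live in the ball of radius `R +
  -- 1`; truncation there keeps `V u` in `L²`.
  set k : V3 → ℝ := B.indicator fun v => V v * u v
  have hkm : Measurable k := (hVc.measurable.mul hum).indicator measurableSet_closedBall
  have hk : MemLp k 2 := by
    refine (hu.const_mul W).mono hkm.aestronglyMeasurable (ae_of_all _ fun v => ?_)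
    by_cases hv : v ∈ B
    · simp only [k, indicator_of_mem hv, norm_mul]
      gcongr
      exact (hW v hv).trans (le_abs_self W)
    · simp only [k, indicator_of_notMem hv, norm_zero]
      positivity
  have hgk : MemLp (fun v => g v + k v) 2 := hg.add hk
  have hgkm : Measurable fun v => g v + k v := hgm.add hkm
  have hχ2 : ∀ v, |χ v ^ 2| ≤ 1 := fun v => by
    rw [abs_pow]
    exact pow_le_one₀ (abs_nonneg _) (hχ1 v)
  obtain ⟨D, hD⟩ : ∃ D, ∀ v, |V v * χ v ^ 2| ≤ D :=
    (hχc.mul_left (f := fun v => V v * χ v)).exists_bound_of_continuous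
      ((hVc.mul hχ.continuous).mul hχ.continuous) |>.imp fun D hD v => by
        have := hD v
        rwa [Real.norm_eq_abs, Pi.mul_apply, mul_assoc, ← sq] at this
  have key : ∀ θ, 0 < θ → θ ≤ θ₀ → ∫ v, χ v ^ 2 * g v * u v ≤ (κ + θ * C₁) * ∫ v, u v ^ 2 := by
    intro θ hθ hθ'
    have step : ∀ n, (∫ v, χ v ^ 2 * mol (ρ n) (fun v => g v + k v) v * mol (ρ n) u v)
        - (∫ v, V v * χ v ^ 2 * mol (ρ n) u v * mol (ρ n) u v)
        ≤ (κ + θ * C₁) * (∫ v, 1 * mol (ρ n) u v * mol (ρ n) u v)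
          + θ⁻¹ * (K * M ^ 2) * ∫ y, meanSqIncr u (1 / ((n : ℝ) + 1)) y := by
      intro n
      obtain ⟨ψ, hψ, hle⟩ := hloc (hε n) (hε1 n) hM.le (hρ n) hum hu θ hθ hθ'
      have hwR : ∀ y, R < ‖y‖ → χ y ^ 2 * mol (ρ n) u y = 0 := fun y hy => by rw [hχR y hy]; ring
      have hUc := (hρ n).continuous_mol (hu.locallyIntegrable (by norm_num))
      have h1 : (∫ v, u v * landau γ ψ v) + (∫ v, u v * (V v * ψ v)) =
          ∫ v, χ v ^ 2 * mol (ρ n) (fun v => g v + k v) v * mol (ρ n) u v := by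
        have e1 : ∀ v, u v * (V v * ψ v) = k v * ψ v := by
          intro v
          by_cases hv : v ∈ B
          · simp only [k, indicator_of_mem hv]
            ring
          · have hv' : R + 1 < ‖v‖ := by simpa [B] using hv
            have : ψ v = 0 := by
              rw [hψ]
              exact (hρ n).mol_zero hwR v (by linarith [hε1 n])
            rw [this]
            ring
        simp_rw [e1]
        have hψ2 : MemLp ψ 2 := ψ.memLp 2 volume
        have i1 : Integrable fun v => g v * ψ v := hg.integrable_mul hψ2
        have i2 : Integrable fun v => k v * ψ v := hk.integrable_mul hψ2
        rw [h ψ, ← integral_add i1 i2]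
        simp_rw [← add_mul]
        rw [hψ, integral_mul_mol (w := fun y => χ y ^ 2 * mol (ρ n) u y) (hρ n).smooth.continuous (hρ n).hasCompactSupport (hρ n).even
          (hgk.locallyIntegrable (by norm_num)) ((hχ.continuous.pow 2).mul hUc) (hasCompactSupport_of_zero hwR)]
        refine integral_congr_ae (ae_of_all _ fun v => ?_)
        dsimp only
        ring
      rw [h1] at hle
      refine le_trans (le_of_eq ?_) (hle.trans (le_of_eq ?_))
      · congr 2
        funext v
        ring
      · simp only [one_mul, sq]
    have hone : ∀ v : V3, |(1 : ℝ)| ≤ 1 := fun _ => by simp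
    have l1 := tendsto_integral_mol_mul_mol (b := fun v => χ v ^ 2) hρ hgkm hgk hum hu (hχ.continuous.pow 2) hχ2
    have l2 := tendsto_integral_mol_mul_mol (b := fun v => V v * χ v ^ 2) hρ hum hu hum hu (hVc.mul (hχ.continuous.pow 2)) hD
    have l3 := tendsto_integral_mol_mul_mol hρ hum hu hum hu (continuous_const (y := (1 : ℝ))) hone
    have l4 := (tendsto_integral_meanSqIncr hum hu).const_mul (θ⁻¹ * (K * M ^ 2))
    have := le_of_tendsto_of_tendsto' (l1.sub l2) ((l3.const_mul (κ + θ * C₁)).add l4) step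
    have i1 : Integrable fun v => χ v ^ 2 * (g v + k v) * u v := by
      have : MemLp (fun v => χ v ^ 2 * (g v + k v)) 2 := by
        refine hgk.mono ((hχ.continuous.pow 2).aestronglyMeasurable.mul hgk.1) (ae_of_all _ fun v => ?_)
        rw [norm_mul]
        exact mul_le_of_le_one_left (norm_nonneg _) (hχ2 v)
      exact this.integrable_mul hu
    have i2 : Integrable fun v => V v * χ v ^ 2 * u v * u v := by
      have : MemLp (fun v => V v * χ v ^ 2 * u v) 2 := by
        refine (hu.const_mul D).mono ((hVc.mul (hχ.continuous.pow 2)).aestronglyMeasurable.mul hu.1)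
          (ae_of_all _ fun v => ?_)
        rw [norm_mul, norm_mul D]
        gcongr
        exact (hD v).trans (le_abs_self D)
      exact this.integrable_mul hu
    rw [mul_zero, add_zero, ← integral_sub i1 i2] at this
    refine le_trans (le_of_eq ?_) (this.trans (le_of_eq ?_))
    -- In the limit the two zeroth order terms cancel, since `k = V u` wherever `χ` does not vanish.
    · refine integral_congr_ae (ae_of_all _ fun v => ?_)
      dsimp only
      by_cases hv : v ∈ B
      · simp only [k, indicator_of_mem hv]
        ring
      · have hv' : R + 1 < ‖v‖ := by simpa [B] using hv
        rw [hχR v (by linarith)]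
        ring
    · simp only [one_mul, sq]
  have hlim : Tendsto (fun θ : ℝ => (κ + θ * C₁) * ∫ v, u v ^ 2) (𝓝[>] 0) (𝓝 (κ * ∫ v, u v ^ 2)) := by
    have : Continuous fun θ : ℝ => (κ + θ * C₁) * ∫ v, u v ^ 2 := by fun_prop
    have h0 := (this.tendsto 0).mono_left (nhdsWithin_le_nhds (s := Ioi 0))
    simpa using h0
  refine ge_of_tendsto hlim ?_
  filter_upwards [Ioc_mem_nhdsGT hθ₀] with θ hθ
  exact key θ hθ.1 hθ.2

/-- The Landau operator, in the sense of distributions, is dissipative on `L²`. -/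
theorem integral_mul_nonpos_of_weak_landau {u g : V3 → ℝ} (hum : Measurable u) (hu : MemLp u 2)
    (hgm : Measurable g) (hg : MemLp g 2)
    (h : ∀ ψ : 𝓢(V3, ℝ), ∫ v, u v * landau γ ψ v = ∫ v, g v * ψ v) :
    ∫ v, g v * u v ≤ 0 := by
  obtain ⟨Ca, hCa, hab⟩ : ∃ C, 0 < C ∧ ∀ i j v, |abar γ i j v| ≤ C * (1 + ‖v‖) ^ (γ + 2) := abar_bound hγ₁ hγ₂
  obtain ⟨C, hC, hcut⟩ := exists_cutoff
  have hR1 : ∀ n : ℕ, (1 : ℝ) ≤ (n : ℝ) + 1 := fun n => by linarith [n.cast_nonneg (α := ℝ)]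
  choose χ hχ hχ01 hχ1 hχ0 hpd hpd1 hpd2 using fun n : ℕ => hcut ((n : ℝ) + 1) (hR1 n)
  -- Nine matrix entries, each of size `R^(γ+2)` on the shell (there `1+|v| ≤ 3R`), times `(C/R)²`.
  -- If `γ + 2 < 0` the entries are bounded just by a constant, hence the exponent `max γ (-2)`. It
  -- is negative, so `κ` tends to zero.
  set κ : ℕ → ℝ := fun n => 9 * (Ca * (3 ^ (γ + 2) + 1)) * C ^ 2 * (((n : ℝ) + 1) ^ (max γ (-2)))
  have hκ : ∀ n v, ∑ i, ∑ j, abar γ i j v * pd i (χ n) v * pd j (χ n) v ≤ κ n := by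
    intro n v
    set R : ℝ := (n : ℝ) + 1
    have hR : 1 ≤ R := hR1 n
    have hR0 : 0 < R := by linarith
    have hκ0 : 0 ≤ κ n := by positivity
    by_cases h1 : ‖v‖ < R
    · simpa [hpd1 n _ v h1] using hκ0
    by_cases h2 : 2 * R < ‖v‖
    · simpa [hpd2 n _ v h2] using hκ0
    have hb : (1 + ‖v‖) ^ (γ + 2) ≤ (3 ^ (γ + 2) + 1) * R ^ (max (γ + 2) 0) := by
      rcases le_or_gt 0 (γ + 2) with h0 | h0
      · calc (1 + ‖v‖) ^ (γ + 2) ≤ (3 * R) ^ (γ + 2) := by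
              refine Real.rpow_le_rpow (by positivity) ?_ h0
              linarith [not_lt.1 h2]
          _ = 3 ^ (γ + 2) * R ^ (γ + 2) := Real.mul_rpow (by norm_num) hR0.le
          _ ≤ _ := by
              rw [max_eq_left h0]
              gcongr
              linarith
      · calc (1 + ‖v‖) ^ (γ + 2) ≤ 1 := Real.rpow_le_one_of_one_le_of_nonpos (by linarith [norm_nonneg v]) h0.le
          _ ≤ _ := by
              rw [max_eq_right h0.le, Real.rpow_zero, mul_one]
              have : (0 : ℝ) ≤ 3 ^ (γ + 2) := by positivity
              linarith
    have hterm : ∀ i j, abar γ i j v * pd i (χ n) v * pd j (χ n) v ≤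
        Ca * ((3 ^ (γ + 2) + 1) * R ^ (max (γ + 2) 0)) * (C / R) * (C / R) := fun i j => by
      refine (le_abs_self _).trans ?_
      rw [abs_mul, abs_mul]
      gcongr
      · exact (hab i j v).trans (by gcongr)
      · exact hpd n i v
      · exact hpd n j v
    calc _ ≤ ∑ i : Fin 3, ∑ j : Fin 3, Ca * ((3 ^ (γ + 2) + 1) * R ^ (max (γ + 2) 0)) * (C / R) * (C / R) :=
          Finset.sum_le_sum fun i _ => Finset.sum_le_sum fun j _ => hterm i j
      _ = κ n := by
          have e : max γ (-2) = max (γ + 2) 0 - 2 := by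
            rw [← max_sub_sub_right]
            congr 1 <;> ring
          simp only [κ, Finset.sum_const, Finset.card_univ, Fintype.card_fin, nsmul_eq_mul]
          rw [e, Real.rpow_sub hR0, Real.rpow_two]
          field_simp
          norm_num
  have hκlim : Tendsto κ atTop (𝓝 0) := by
    have h1 : Tendsto (fun n : ℕ => (n : ℝ) + 1) atTop atTop :=
      tendsto_atTop_add_const_right _ _ tendsto_natCast_atTop_atTop
    have h2 := (tendsto_rpow_neg_atTop (y := -max γ (-2)) (by
      rw [neg_pos]
      exact max_lt hγ₂ (by norm_num))).comp h1
    have h3 := h2.const_mul (9 * (Ca * (3 ^ (γ + 2) + 1)) * C ^ 2)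
    simpa [κ, Function.comp_def] using h3
  have hle : ∀ n, ∫ v, χ n v ^ 2 * g v * u v ≤ κ n * ∫ v, u v ^ 2 := fun n =>
    integral_cutoff_le hγ₁ hγ₂ (hχ n) (fun v => abs_le.2 ⟨by linarith [(hχ01 n v).1], (hχ01 n v).2⟩) (hχ0 n)
      (hκ n) hum hu hgm hg h
  have hlim : Tendsto (fun n => ∫ v, χ n v ^ 2 * g v * u v) atTop (𝓝 (∫ v, g v * u v)) := by
    refine tendsto_integral_of_dominated_convergence (fun v => ‖g v * u v‖)
      (fun n => (((hχ n).continuous.pow 2).measurable.mul hgm).mul hum |>.aestronglyMeasurable)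
      (hg.integrable_mul hu).norm (fun n => ae_of_all _ fun v => ?_) (ae_of_all _ fun v => ?_)
    · rw [mul_assoc, norm_mul]
      refine mul_le_of_le_one_left (norm_nonneg _) ?_
      rw [Real.norm_of_nonneg (sq_nonneg _)]
      exact pow_le_one₀ (hχ01 n v).1 (hχ01 n v).2
    · refine tendsto_const_nhds.congr' ?_
      filter_upwards [eventually_ge_atTop ⌈‖v‖⌉₊] with n hn
      have : ‖v‖ ≤ (n : ℝ) + 1 := by
        have h1 := Nat.le_ceil ‖v‖
        have h2 : (⌈‖v‖⌉₊ : ℝ) ≤ n := by exact_mod_cast hn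
        linarith
      rw [hχ1 n v this]
      ring
  have := le_of_tendsto_of_tendsto' hlim (hκlim.mul_const (∫ v, u v ^ 2)) hle
  simpa using this

end

/-! ### Weak solutions in terms of `L²`-valued functions -/

/-- The embedding of Schwartz functions into `L²`. -/
def toL2 : 𝓢(V3, ℝ) →L[ℝ] L2V := SchwartzMap.toLpCLM ℝ ℝ 2 volume

lemma coeFn_toL2 (ψ : 𝓢(V3, ℝ)) : toL2 ψ =ᵐ[volume] ψ := ψ.coeFn_toLp 2 volume

lemma inner_L2 (F G : L2V) : inner ℝ F G = ∫ v, F v * G v := by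
  rw [L2.inner_def]
  refine integral_congr_ae (ae_of_all _ fun v => ?_)
  simp [mul_comm]

lemma inner_toL2 (F : L2V) (ψ : 𝓢(V3, ℝ)) : inner ℝ F (toL2 ψ) = ∫ v, F v * ψ v := by
  rw [inner_L2]
  refine integral_congr_ae ?_
  filter_upwards [coeFn_toL2 ψ] with v hv
  rw [hv]

section
variable {E F : Type*} [AddCommGroup E] [Module ℝ E] [TopologicalSpace E] [ContinuousSMul ℝ E]
  [AddCommGroup F] [Module ℝ F] [TopologicalSpace F] [ContinuousSMul ℝ F] {s : Set ℝ} {t : ℝ}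

/-- Test functions are curves in the Schwartz space, which is not a normed space. The little-o form
for topological vector spaces lets continuous linear maps carry their derivatives to `L²`. -/
lemma hasDerivWithinAt_iff_isLittleOTVS {f : ℝ → E} {f' : E} : HasDerivWithinAt f f' s t ↔
    Asymptotics.IsLittleOTVS ℝ (𝓝[s] t) (fun x => f x - f t - (x - t) • f') (fun x => x - t) := by
  rw [hasDerivWithinAt_iff_hasFDerivWithinAt, hasFDerivWithinAt_iff_isLittleOTVS]
  rfl

lemma hasDerivWithinAt_clm_comp (L : E →L[ℝ] F) {f : ℝ → E} {f' : E} (h : HasDerivWithinAt f f' s t) :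
    HasDerivWithinAt (fun x => L (f x)) (L f') s t := by
  rw [hasDerivWithinAt_iff_isLittleOTVS] at h ⊢
  exact ((L.isBigOTVS_fun_comp).trans_isLittleOTVS h).congr_left fun x => by simp

lemma hasDerivWithinAt_add_tvs [ContinuousAdd E] {f g : ℝ → E} {f' g' : E} (hf : HasDerivWithinAt f f' s t)
    (hg : HasDerivWithinAt g g' s t) : HasDerivWithinAt (fun x => f x + g x) (f' + g') s t := by
  rw [hasDerivWithinAt_iff_isLittleOTVS] at hf hg ⊢
  refine (hf.add hg).congr_left fun x => ?_
  simp only [Pi.add_apply, smul_add]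
  abel

end

namespace TestFunction
variable {T : ℝ}

/-- The linear operations on test functions make their adjoint sources, paired with their initial
values, a linear subspace for the duality argument. -/
instance : Zero (TestFunction T) := ⟨⟨fun _ _ => 0, fun _ t _ => by
  rw [hasDerivWithinAt_iff_isLittleOTVS]
  exact (Asymptotics.IsLittleOTVS.zero (fun x : ℝ => x - t) _).congr_left fun x => by simp, rfl⟩⟩

instance : Add (TestFunction T) :=
  ⟨fun φ χ => ⟨fun k t => φ.jet k t + χ.jet k t, fun k t ht => hasDerivWithinAt_add_tvs (φ.hasDeriv k t ht) (χ.hasDeriv k t ht), by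
    rw [φ.final, χ.final, add_zero]⟩⟩

instance : SMul ℝ (TestFunction T) :=
  ⟨fun c φ => ⟨fun k t => c • φ.jet k t, fun k t ht => hasDerivWithinAt_clm_comp (c • ContinuousLinearMap.id ℝ 𝓢(V3, ℝ)) (φ.hasDeriv k t ht), by
    rw [φ.final, smul_zero]⟩⟩

lemma jet_zero (k : ℕ) (t : ℝ) : (0 : TestFunction T).jet k t = 0 := rfl

lemma jet_add (φ χ : TestFunction T) (k : ℕ) (t : ℝ) : (φ + χ).jet k t = φ.jet k t + χ.jet k t := rfl

lemma jet_smul (c : ℝ) (φ : TestFunction T) (k : ℕ) (t : ℝ) : (c • φ).jet k t = c • φ.jet k t := rfl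

lemma continuousOn_clm_jet {F : Type*} [NormedAddCommGroup F] [NormedSpace ℝ F] (L : 𝓢(V3, ℝ) →L[ℝ] F)
    (φ : TestFunction T) (k : ℕ) : ContinuousOn (fun t => L (φ.jet k t)) (Icc 0 T) := fun t ht =>
  (hasDerivWithinAt_clm_comp L (φ.hasDeriv k t ht)).continuousWithinAt

end TestFunction

section
variable {γ : ℝ} (hγ₁ : -3 < γ) (hγ₂ : γ < 0) {T : ℝ}
include hγ₁ hγ₂

lemma inner_landauL2 (F : L2V) (ψ : 𝓢(V3, ℝ)) :
    inner ℝ F (landauL2 hγ₁ hγ₂ ψ) = ∫ v, F v * landau γ ψ v := by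
  rw [inner_L2]
  refine integral_congr_ae ?_
  filter_upwards [coeFn_landauL2 hγ₁ hγ₂ ψ] with v hv
  rw [hv]

lemma inner_landauL2_self_nonpos (ψ : 𝓢(V3, ℝ)) : inner ℝ (toL2 ψ) (landauL2 hγ₁ hγ₂ ψ) ≤ 0 := by
  rw [inner_landauL2]
  refine le_trans (le_of_eq ?_) (integral_landau_mul_self_nonpos hγ₁ hγ₂ ψ)
  refine integral_congr_ae ?_
  filter_upwards [coeFn_toL2 ψ] with v hv
  rw [hv, mul_comm]

/-- The function `∂ₜφ + Lφ` with values in `L²`. -/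
def adjointSource (φ : TestFunction T) (t : ℝ) : L2V := toL2 (φ.jet 1 t) + landauL2 hγ₁ hγ₂ (φ.jet 0 t)

lemma continuousOn_adjointSource (φ : TestFunction T) : ContinuousOn (adjointSource hγ₁ hγ₂ φ) (Icc 0 T) :=
  (φ.continuousOn_clm_jet toL2 1).add (φ.continuousOn_clm_jet (landauL2 hγ₁ hγ₂) 0)

lemma memLp_adjointSource (φ : TestFunction T) (p : ℝ≥0∞) :
    MemLp (adjointSource hγ₁ hγ₂ φ) p (volume.restrict (Icc 0 T)) := by
  have hc := continuousOn_adjointSource hγ₁ hγ₂ φ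
  obtain ⟨C, hC⟩ := isCompact_Icc.exists_bound_of_continuousOn hc
  exact MemLp.of_bound (hc.aestronglyMeasurable measurableSet_Icc) C
    ((ae_restrict_iff' measurableSet_Icc).2 (ae_of_all _ hC))

lemma isWeakSolution_iff (f₀ : L2V) (f : Lp L2V ∞ (volume.restrict (Icc 0 T))) :
    IsWeakSolution γ T f₀ f ↔ ∀ φ : TestFunction T,
      (∫ t in Icc 0 T, inner ℝ (f t) (adjointSource hγ₁ hγ₂ φ t)) + inner ℝ f₀ (toL2 (φ.jet 0 0)) = 0 := by
  refine forall_congr' fun φ => ?_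
  have e : ∀ t, inner ℝ (f t) (adjointSource hγ₁ hγ₂ φ t) =
      ∫ v, f t v * (φ.jet 1 t v + landau γ (φ.jet 0 t) v) := by
    intro t
    rw [inner_L2]
    refine integral_congr_ae ?_
    filter_upwards [coeFn_toL2 (φ.jet 1 t), coeFn_landauL2 hγ₁ hγ₂ (φ.jet 0 t),
      Lp.coeFn_add (toL2 (φ.jet 1 t)) (landauL2 hγ₁ hγ₂ (φ.jet 0 t))] with v h1 h2 h3
    rw [adjointSource, h3, Pi.add_apply, h1, h2]
  simp_rw [e, inner_toL2]

/-- The a priori estimate for the backward problem. -/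
lemma norm_initial_le (hT : 0 < T) (φ : TestFunction T) :
    ‖toL2 (φ.jet 0 0)‖ ≤ ∫ t in Icc 0 T, ‖adjointSource hγ₁ hγ₂ φ t‖ := by
  set p : ℝ → L2V := fun t => toL2 (φ.jet 0 t)
  set h := adjointSource hγ₁ hγ₂ φ
  have hp : ∀ t ∈ Icc 0 T, HasDerivWithinAt p (toL2 (φ.jet 1 t)) (Icc 0 T) t := fun t ht =>
    hasDerivWithinAt_clm_comp toL2 (φ.hasDeriv 0 t ht)
  refine le_of_forall_pos_le_add fun δ hδ => ?_
  have hpos : ∀ t, 0 < ‖p t‖ ^ 2 + δ ^ 2 := fun t => by positivity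
  -- The norm is not differentiable where `p` vanishes; `√(‖p‖² + δ²)` is, and `δ → 0` at the end.
  set q : ℝ → ℝ := fun t => Real.sqrt (‖p t‖ ^ 2 + δ ^ 2)
  have hq0 : ∀ t, 0 < q t := fun t => Real.sqrt_pos.2 (hpos t)
  have hpq : ∀ t, ‖p t‖ ≤ q t := fun t => Real.le_sqrt_of_sq_le (by linarith [sq_nonneg δ])
  have hq : ∀ t ∈ Icc 0 T, HasDerivWithinAt q
      (2 * inner ℝ (p t) (toL2 (φ.jet 1 t)) / (2 * q t)) (Icc 0 T) t := fun t ht =>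
    ((hp t ht).norm_sq.add_const (δ ^ 2)).sqrt (hpos t).ne'
  have hqT : q T = δ := by
    simp only [q, p, φ.final, map_zero, norm_zero]
    rw [zero_pow two_ne_zero, zero_add, Real.sqrt_sq hδ.le]
  have hint : IntegrableOn (fun t => ‖h t‖) (Icc 0 T) := (continuousOn_adjointSource hγ₁ hγ₂ φ).norm.integrableOn_Icc
  have := intervalIntegral.sub_le_integral_of_hasDeriv_right_of_le (g := fun t => -q t)
    (g' := fun t => -(2 * inner ℝ (p t) (toL2 (φ.jet 1 t)) / (2 * q t))) hT.le
    (fun t ht => (hq t ht).continuousWithinAt.neg)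
    (fun t ht => ((hq t (Ioo_subset_Icc_self ht)).neg.mono_of_mem_nhdsWithin
      (Icc_mem_nhdsGT_of_mem ⟨ht.1.le, ht.2⟩))) hint ?_
  · rw [intervalIntegral.integral_of_le hT.le, ← integral_Icc_eq_integral_Ioc, hqT] at this
    linarith [hpq 0]
  · intro t _
    -- From `h = p' + Lp` and `(p, Lp) ≤ 0` follows `(p, p') ≥ (p, h) ≥ -‖p‖‖h‖`, so `-q' ≤ ‖h‖`.
    -- Integration from `0` to `T` closes the estimate, as `q(T) = δ`.
    have h1 : inner ℝ (p t) (h t) ≤ inner ℝ (p t) (toL2 (φ.jet 1 t)) := by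
      simp only [h, adjointSource, inner_add_right]
      linarith [inner_landauL2_self_nonpos hγ₁ hγ₂ (φ.jet 0 t)]
    have h2 : -(‖p t‖ * ‖h t‖) ≤ inner ℝ (p t) (h t) :=
      (abs_le.1 (abs_real_inner_le_norm (p t) (h t))).1
    have h3 : ‖p t‖ * ‖h t‖ ≤ q t * ‖h t‖ := by
      gcongr
      exact hpq t
    rw [mul_div_mul_left _ _ two_ne_zero, neg_le, le_div_iff₀ (hq0 t)]
    linarith

/-! ### Existence -/

/-- The weak formulation prescribes a linear functional on the sources `∂ₜφ + Lφ`, namely `-(f₀,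
φ(0))`. By `norm_initial_le` it is bounded by `‖f₀‖` times the `L¹` norm in time. Hahn–Banach is
applied with this `L¹` seminorm on `L²` in time: on a finite interval the extension is
`L²`-continuous and has a Riesz representative, while the sharper `L¹` bound gives the pointwise
estimate. -/
lemma exists_weakSolution (hT : 0 < T) (f₀ : L2V) : ∃ f : Lp L2V ∞ (volume.restrict (Icc 0 T)),
    IsWeakSolution γ T f₀ f ∧ ∀ᵐ t ∂(volume.restrict (Icc 0 T)), ‖f t‖ ≤ ‖f₀‖ := by
  set μ : Measure ℝ := volume.restrict (Icc 0 T)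
  have hint : ∀ x : Lp L2V 2 μ, Integrable x μ := fun x => (Lp.memLp x).integrable (by norm_num)
  -- The functional is introduced through its graph, since different test functions could share a
  -- source; that it is single valued is `hG0`.
  let G : Submodule ℝ (Lp L2V 2 μ × ℝ) :=
    { carrier := {z | ∃ φ : TestFunction T, z.1 =ᵐ[μ] adjointSource hγ₁ hγ₂ φ ∧
        z.2 = -inner ℝ f₀ (toL2 (φ.jet 0 0))}
      zero_mem' := by
        refine ⟨0, ?_, ?_⟩
        · filter_upwards [Lp.coeFn_zero L2V 2 μ] with t ht
          simpa [adjointSource, TestFunction.jet_zero] using ht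
        · simp [TestFunction.jet_zero]
      add_mem' := by
        rintro z w ⟨φ, h1, h2⟩ ⟨χ, h3, h4⟩
        refine ⟨φ + χ, ?_, ?_⟩
        · filter_upwards [Lp.coeFn_add z.1 w.1, h1, h3] with t h5 h6 h7
          rw [Prod.fst_add, h5, Pi.add_apply, h6, h7]
          simp only [adjointSource, TestFunction.jet_add, map_add]
          abel
        · rw [Prod.snd_add, h2, h4, TestFunction.jet_add, map_add, inner_add_right]
          ring
      smul_mem' := by
        rintro c z ⟨φ, h1, h2⟩
        refine ⟨c • φ, ?_, ?_⟩
        · filter_upwards [Lp.coeFn_smul c z.1, h1] with t h5 h6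
          rw [Prod.smul_fst, h5, Pi.smul_apply, h6]
          simp only [adjointSource, TestFunction.jet_smul, map_smul, smul_add]
        · rw [Prod.smul_snd, h2, TestFunction.jet_smul, map_smul, inner_smul_right, smul_eq_mul]
          ring }
  have hG : ∀ z ∈ G, |z.2| ≤ ‖f₀‖ * ∫ t, ‖z.1 t‖ ∂μ := by
    rintro z ⟨φ, h1, h2⟩
    rw [h2, abs_neg]
    refine (abs_real_inner_le_norm _ _).trans ?_
    gcongr
    refine (norm_initial_le hγ₁ hγ₂ hT φ).trans (le_of_eq (integral_congr_ae ?_))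
    filter_upwards [h1] with t ht
    rw [ht]
  have hG0 : ∀ z ∈ G, z.1 = 0 → z.2 = 0 := by
    intro z hz h0
    have h1 : ∫ t, ‖z.1 t‖ ∂μ = 0 := by
      rw [h0]
      refine integral_eq_zero_of_ae ?_
      filter_upwards [Lp.coeFn_zero L2V 2 μ] with t ht
      rw [Pi.zero_apply]
      exact norm_eq_zero.2 ht
    have := hG z hz
    rw [h1, mul_zero] at this
    exact abs_nonpos_iff.1 this
  have hN_smul : ∀ c : ℝ, 0 < c → ∀ x : Lp L2V 2 μ, ‖f₀‖ * ∫ t, ‖(c • x : Lp L2V 2 μ) t‖ ∂μ = c * (‖f₀‖ * ∫ t, ‖x t‖ ∂μ) := by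
    intro c hc x
    have : ∫ t, ‖(c • x : Lp L2V 2 μ) t‖ ∂μ = c * ∫ t, ‖x t‖ ∂μ := by
      rw [← integral_const_mul]
      refine integral_congr_ae ?_
      filter_upwards [Lp.coeFn_smul c x] with t ht
      rw [ht, Pi.smul_apply, norm_smul, Real.norm_of_nonneg hc.le]
    rw [this]
    ring
  have hN_add : ∀ x y : Lp L2V 2 μ, ‖f₀‖ * ∫ t, ‖(x + y : Lp L2V 2 μ) t‖ ∂μ ≤ ‖f₀‖ * ∫ t, ‖x t‖ ∂μ + ‖f₀‖ * ∫ t, ‖y t‖ ∂μ := by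
    intro x y
    rw [← mul_add, ← integral_add (hint x).norm (hint y).norm]
    refine mul_le_mul_of_nonneg_left ?_ (norm_nonneg _)
    refine integral_mono_ae (hint (x + y)).norm ((hint x).norm.add (hint y).norm) ?_
    filter_upwards [Lp.coeFn_add x y] with t ht
    rw [ht]
    exact norm_add_le _ _
  obtain ⟨Λ, hΛ, hΛN⟩ := exists_extension_of_le_sublinear G.toLinearPMap
    (fun x : Lp L2V 2 μ => ‖f₀‖ * ∫ t, ‖x t‖ ∂μ) hN_smul hN_add fun x =>
      (le_abs_self _).trans (hG _ (Submodule.mem_graph_toLinearPMap hG0 x))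
  have hΛb : ∀ x, |Λ x| ≤ ‖f₀‖ * ∫ t, ‖x t‖ ∂μ := by
    intro x
    refine abs_le.2 ⟨?_, hΛN x⟩
    have := hΛN (-x)
    have e : ∫ t, ‖(-x : Lp L2V 2 μ) t‖ ∂μ = ∫ t, ‖x t‖ ∂μ := by
      refine integral_congr_ae ?_
      filter_upwards [Lp.coeFn_neg x] with t ht
      rw [ht, Pi.neg_apply, norm_neg]
    rw [map_neg] at this
    rw [e] at this
    linarith
  have hL1 : ∃ C : ℝ, ∀ x : Lp L2V 2 μ, ∫ t, ‖x t‖ ∂μ ≤ C * ‖x‖ := by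
    refine ⟨‖indicatorConstLp 2 (μ := μ) MeasurableSet.univ (measure_ne_top μ univ) (1 : ℝ)‖, fun x => ?_⟩
    have hx : MemLp (fun t => ‖x t‖) 2 μ := (Lp.memLp x).norm
    have e : ∫ t, ‖x t‖ ∂μ = inner ℝ (indicatorConstLp 2 (μ := μ) MeasurableSet.univ (measure_ne_top μ univ) (1 : ℝ))
        (hx.toLp _) := by
      rw [L2.inner_def]
      refine integral_congr_ae ?_
      filter_upwards [hx.coeFn_toLp, indicatorConstLp_coeFn (p := 2) (μ := μ) (hs := MeasurableSet.univ)
        (hμs := measure_ne_top μ univ) (c := (1 : ℝ))] with t h1 h2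
      rw [h1, h2]
      simp
    rw [e]
    refine (real_inner_le_norm _ _).trans (le_of_eq ?_)
    congr 1
    rw [Lp.norm_toLp, Lp.norm_def, eLpNorm_norm]
  obtain ⟨C, hC⟩ := hL1
  let Λc : StrongDual ℝ (Lp L2V 2 μ) := Λ.mkContinuous (‖f₀‖ * C) fun x => by
    rw [mul_assoc]
    exact (hΛb x).trans (mul_le_mul_of_nonneg_left (hC x) (norm_nonneg _))
  set F : Lp L2V 2 μ := (InnerProductSpace.toDual ℝ _).symm Λc
  have hF : ∀ x : Lp L2V 2 μ, ∫ t, inner ℝ (F t) (x t) ∂μ = Λ x := by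
    intro x
    rw [← L2.inner_def]
    exact InnerProductSpace.toDual_symm_apply
  have hFb : ∀ᵐ t ∂μ, ‖F t‖ ≤ ‖f₀‖ := by
    have hF2 : Integrable (fun t => ‖F t‖ ^ 2) μ := (Lp.memLp F).norm.integrable_sq
    -- Testing the functional on `1_s F` gives `∫_s ‖F‖² ≤ ‖f₀‖ ∫_s ‖F‖` for measurable `s`, which
    -- forces `‖F‖² ≤ ‖f₀‖‖F‖` almost everywhere.
    have := ae_le_of_forall_setIntegral_le (f := fun t => ‖F t‖ ^ 2) (g := fun t => ‖f₀‖ * ‖F t‖) hF2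
      ((hint F).norm.const_mul _) fun s hs _ => by
        have hm : MemLp (s.indicator F) 2 μ := (Lp.memLp F).indicator hs
        have h1 := (le_abs_self _).trans (hΛb (hm.toLp _))
        rw [← hF] at h1
        rw [integral_const_mul, ← integral_indicator hs, ← integral_indicator hs]
        refine (le_of_eq ?_).trans (h1.trans (le_of_eq ?_))
        · refine integral_congr_ae ?_
          filter_upwards [hm.coeFn_toLp] with t ht
          rw [ht]
          by_cases hts : t ∈ s
          · rw [indicator_of_mem hts, indicator_of_mem hts, real_inner_self_eq_norm_sq]
          · rw [indicator_of_notMem hts, indicator_of_notMem hts, inner_zero_right]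
        · congr 1
          refine integral_congr_ae ?_
          filter_upwards [hm.coeFn_toLp] with t ht
          rw [ht]
          exact norm_indicator_eq_indicator_norm _ _
    filter_upwards [this] with t ht
    rcases (norm_nonneg (F t)).eq_or_lt with h0 | h0
    · rw [← h0]
      exact norm_nonneg _
    · rw [sq] at ht
      exact le_of_mul_le_mul_right ht h0
  have hFm : MemLp F ∞ μ := memLp_top_of_bound (Lp.aestronglyMeasurable F) ‖f₀‖ hFb
  refine ⟨hFm.toLp F, (isWeakSolution_iff hγ₁ hγ₂ f₀ _).2 fun φ => ?_, ?_⟩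
  · have hm := memLp_adjointSource hγ₁ hγ₂ φ 2
    have hmem : (hm.toLp _, -inner ℝ f₀ (toL2 (φ.jet 0 0))) ∈ G := ⟨φ, hm.coeFn_toLp, rfl⟩
    have hdom : hm.toLp _ ∈ G.toLinearPMap.domain := ⟨_, hmem, rfl⟩
    have h1 := hΛ ⟨_, hdom⟩
    have h2 := Submodule.mem_graph_toLinearPMap hG0 ⟨_, hdom⟩
    have h3 : G.toLinearPMap ⟨_, hdom⟩ = -inner ℝ f₀ (toL2 (φ.jet 0 0)) := by
      have h4 := hG0 _ (G.sub_mem h2 hmem) (by simp)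
      rw [Prod.snd_sub, sub_eq_zero] at h4
      exact h4
    rw [h3, ← hF] at h1
    rw [← eq_neg_iff_add_eq_zero, ← h1]
    refine integral_congr_ae ?_
    filter_upwards [hm.coeFn_toLp, hFm.coeFn_toLp] with t h4 h5
    rw [h5]
    change _ = inner ℝ (F t) (hm.toLp _ t)
    rw [h4]
  · filter_upwards [hFb, hFm.coeFn_toLp] with t h1 h2
    rw [h2]
    exact h1

end

/-! ### Uniqueness -/

lemma eq_zero_of_inner_toL2 {x : L2V} (h : ∀ ψ : 𝓢(V3, ℝ), inner ℝ (toL2 ψ) x = 0) : x = 0 := by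
  have hd : DenseRange (toL2 : 𝓢(V3, ℝ) → L2V) := SchwartzMap.denseRange_toLpCLM (by norm_num)
  have := DenseRange.equalizer hd (g := fun y : L2V => inner ℝ y x) (h := fun _ => (0 : ℝ))
    (continuous_id.inner continuous_const) continuous_const (funext h)
  exact inner_self_eq_zero.1 (congrFun this x)

/-- The test function `θ(t) ψ` with `θ' = η` and `θ(T) = 0`. -/
def TestFunction.tensor (T : ℝ) {η : ℝ → ℝ} (hη : ContDiff ℝ (⊤ : ℕ∞) η) (ψ : 𝓢(V3, ℝ)) : TestFunction T where
  jet
    | 0, t => (∫ s in T..t, η s) • ψ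
    | k + 1, t => iteratedDeriv k η t • ψ
  hasDeriv k t _ := by
    match k with
    | 0 =>
      have h : HasDerivWithinAt (fun t => ∫ s in T..t, η s) (η t) (Icc 0 T) t :=
        (intervalIntegral.integral_hasDerivAt_right (hη.continuous.intervalIntegrable _ _)
          (hη.continuous.stronglyMeasurableAtFilter _ _) hη.continuous.continuousAt).hasDerivWithinAt
      simpa using hasDerivWithinAt_clm_comp (ContinuousLinearMap.toSpanSingleton ℝ ψ) h
    | k + 1 =>
      have h : HasDerivWithinAt (iteratedDeriv k η) (iteratedDeriv (k + 1) η t) (Icc 0 T) t := by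
        rw [iteratedDeriv_succ]
        exact ((hη.differentiable_iteratedDeriv k (by exact_mod_cast ENat.natCast_lt_top k)) t).hasDerivAt.hasDerivWithinAt
      simpa using hasDerivWithinAt_clm_comp (ContinuousLinearMap.toSpanSingleton ℝ ψ) h
  final := by simp

section
variable {γ : ℝ} (hγ₁ : -3 < γ) (hγ₂ : γ < 0) {T : ℝ}
include hγ₁ hγ₂

/-- The test function `θ(t)ψ` with `θ' = η`, `θ(T) = 0` is inserted and the term with `Lψ` is
integrated by parts in time. The boundary terms vanish, as `θ(T) = 0` and the primitive is zero at
`0`. That primitive is only absolutely continuous. -/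
lemma integral_smul_sub_primitive_eq_zero (hT : 0 < T) {d : ℝ → L2V} (hd : Integrable d)
    (h : ∀ φ : TestFunction T, ∫ t in Icc 0 T, inner ℝ (d t) (adjointSource hγ₁ hγ₂ φ t) = 0)
    (ψ : 𝓢(V3, ℝ)) {η : ℝ → ℝ} (hη : ContDiff ℝ (⊤ : ℕ∞) η) :
    ∫ t in 0..T, η t * (inner ℝ (toL2 ψ) (d t) - ∫ s in 0..t, inner ℝ (landauL2 hγ₁ hγ₂ ψ) (d s)) = 0 := by
  set a : ℝ → ℝ := fun t => inner ℝ (toL2 ψ) (d t)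
  set b : ℝ → ℝ := fun t => inner ℝ (landauL2 hγ₁ hγ₂ ψ) (d t)
  have ha : Integrable a := hd.const_inner _
  have hb : Integrable b := hd.const_inner _
  set θ : ℝ → ℝ := fun t => ∫ s in T..t, η s
  set B : ℝ → ℝ := fun t => ∫ s in 0..t, b s
  have hθ : ∀ t, HasDerivAt θ (η t) t := fun t =>
    intervalIntegral.integral_hasDerivAt_right (hη.continuous.intervalIntegrable _ _)
      (hη.continuous.stronglyMeasurableAtFilter _ _) hη.continuous.continuousAt
  have hθd : deriv θ = η := funext fun t => (hθ t).deriv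
  have hθc : Continuous θ := continuous_iff_continuousAt.2 fun t => (hθ t).continuousAt
  have hBc : Continuous B := intervalIntegral.continuous_primitive (fun _ _ => hb.intervalIntegrable) 0
  have hθac : AbsolutelyContinuousOnInterval θ 0 T :=
    (contDiff_one_iff_deriv.2 ⟨fun t => (hθ t).differentiableAt, by rw [hθd]; exact hη.continuous⟩).contDiffOn
      |>.absolutelyContinuousOnInterval
  have hBac : AbsolutelyContinuousOnInterval B 0 T :=
    hb.intervalIntegrable.absolutelyContinuousOnInterval_intervalIntegral left_mem_uIcc
  have hBd : ∀ᵐ t, deriv B t = b t := by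
    filter_upwards [_root_.LocallyIntegrable.ae_hasDerivAt_integral hb.locallyIntegrable] with t ht
    exact (ht 0).deriv
  have ibp := hθac.integral_mul_deriv_eq_deriv_mul hBac
  have e1 : ∫ t in 0..T, θ t * deriv B t = ∫ t in 0..T, θ t * b t := by
    refine intervalIntegral.integral_congr_ae ?_
    filter_upwards [hBd] with t ht _
    rw [ht]
  have hθT : θ T = 0 := intervalIntegral.integral_same
  have hB0 : B 0 = 0 := intervalIntegral.integral_same
  rw [e1, hθd, hθT, hB0] at ibp
  have h0 := h (TestFunction.tensor T hη ψ)
  have e2 : ∀ t, inner ℝ (d t) (adjointSource hγ₁ hγ₂ (TestFunction.tensor T hη ψ) t) = η t * a t + θ t * b t := by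
    intro t
    have : adjointSource hγ₁ hγ₂ (TestFunction.tensor T hη ψ) t = η t • toL2 ψ + θ t • landauL2 hγ₁ hγ₂ ψ := by
      simp [adjointSource, TestFunction.tensor, θ]
    rw [this, inner_add_right, inner_smul_right, inner_smul_right, real_inner_comm, real_inner_comm (landauL2 hγ₁ hγ₂ ψ)]
  simp_rw [e2] at h0
  rw [integral_Icc_eq_integral_Ioc, ← intervalIntegral.integral_of_le hT.le] at h0
  have i1 : IntervalIntegrable (fun t => η t * a t) volume 0 T :=
    ha.intervalIntegrable.continuousOn_mul hη.continuous.continuousOn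
  have i2 : IntervalIntegrable (fun t => θ t * b t) volume 0 T :=
    hb.intervalIntegrable.continuousOn_mul hθc.continuousOn
  have i3 : IntervalIntegrable (fun t => η t * B t) volume 0 T := (hη.continuous.mul hBc).intervalIntegrable _ _
  rw [intervalIntegral.integral_add i1 i2, ibp] at h0
  simp_rw [mul_sub]
  rw [intervalIntegral.integral_sub i1 i3]
  linarith

/-- The fundamental lemma of the calculus of variations in time. The exceptional null set depends on
`ψ`. -/
lemma ae_inner_eq_inner_primitive (hT : 0 < T) {d : ℝ → L2V} (hd : Integrable d)
    (h : ∀ φ : TestFunction T, ∫ t in Icc 0 T, inner ℝ (d t) (adjointSource hγ₁ hγ₂ φ t) = 0) (ψ : 𝓢(V3, ℝ)) :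
    ∀ᵐ t, t ∈ Ioc 0 T → inner ℝ (toL2 ψ) (d t) = inner ℝ (landauL2 hγ₁ hγ₂ ψ) (∫ s in 0..t, d s) := by
  have hprim : ∀ t, ∫ s in 0..t, inner ℝ (landauL2 hγ₁ hγ₂ ψ) (d s) =
      inner ℝ (landauL2 hγ₁ hγ₂ ψ) (∫ s in 0..t, d s) := fun t =>
    (innerSL ℝ (landauL2 hγ₁ hγ₂ ψ)).intervalIntegral_comp_comm hd.intervalIntegrable
  have hGc : Continuous fun t => ∫ s in 0..t, d s :=
    intervalIntegral.continuous_primitive (fun _ _ => hd.intervalIntegrable) 0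
  set w : ℝ → ℝ := fun t => inner ℝ (toL2 ψ) (d t) - inner ℝ (landauL2 hγ₁ hγ₂ ψ) (∫ s in 0..t, d s)
  have hwi : IntegrableOn w (Ioc 0 T) :=
    ((hd.const_inner _).integrableOn).sub
      ((continuous_const.inner hGc).integrableOn_Icc.mono_set Ioc_subset_Icc_self)
  have := ae_eq_zero_of_integral_contDiff_smul_eq_zero (μ := (volume : Measure ℝ)) (f := (Ioc 0 T).indicator w)
    ((integrable_indicator_iff measurableSet_Ioc).2 hwi).locallyIntegrable fun η hη _ => by
      have e : ∀ t, η t • (Ioc 0 T).indicator w t = (Ioc 0 T).indicator (fun t => η t * w t) t := fun t => by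
        by_cases ht : t ∈ Ioc 0 T <;> simp [ht]
      simp_rw [e]
      rw [integral_indicator measurableSet_Ioc, ← intervalIntegral.integral_of_le hT.le]
      have := integral_smul_sub_primitive_eq_zero hγ₁ hγ₂ hT hd h ψ hη
      simpa only [hprim] using this
  filter_upwards [this] with t ht htm
  rw [indicator_of_mem htm] at ht
  exact sub_eq_zero.1 ht

/-- A weak solution with zero initial datum vanishes. -/
theorem ae_eq_zero_of_weak (hT : 0 < T) {d : ℝ → L2V} (hd : Integrable d)
    (h : ∀ φ : TestFunction T, ∫ t in Icc 0 T, inner ℝ (d t) (adjointSource hγ₁ hγ₂ φ t) = 0) :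
    ∀ᵐ t, t ∈ Ioo 0 T → d t = 0 := by
  set G : ℝ → L2V := fun t => ∫ s in 0..t, d s
  have hGc : Continuous G := intervalIntegral.continuous_primitive (fun _ _ => hd.intervalIntegrable) 0
  -- A second primitive is taken because `K` is differentiable everywhere with derivative `G`, and
  -- because integrating once more in time removes the null sets depending on `ψ`: `LK(t) = G(t)`
  -- holds weakly at every `t`.
  set K : ℝ → L2V := fun t => ∫ s in 0..t, G s
  have hK : ∀ t, HasDerivAt K (G t) t := fun t =>
    intervalIntegral.integral_hasDerivAt_right (hGc.intervalIntegrable _ _)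
      (hGc.stronglyMeasurableAtFilter _ _) hGc.continuousAt
  have hGK : ∀ ψ : 𝓢(V3, ℝ), ∀ t ∈ Icc 0 T, inner ℝ (toL2 ψ) (G t) = inner ℝ (landauL2 hγ₁ hγ₂ ψ) (K t) := by
    intro ψ t ht
    have h1 := (innerSL ℝ (toL2 ψ)).intervalIntegral_comp_comm (μ := volume) (a := 0) (b := t)
      hd.intervalIntegrable
    have h2 := (innerSL ℝ (landauL2 hγ₁ hγ₂ ψ)).intervalIntegral_comp_comm (μ := volume) (a := 0) (b := t)
      (hGc.intervalIntegrable _ _)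
    simp only [innerSL_apply_apply] at h1 h2
    rw [← h1, ← h2]
    refine intervalIntegral.integral_congr_ae ?_
    filter_upwards [ae_inner_eq_inner_primitive hγ₁ hγ₂ hT hd h ψ] with s hs hst
    rw [uIoc_of_le ht.1] at hst
    exact hs ⟨hst.1, hst.2.trans ht.2⟩
  have hdiss : ∀ t ∈ Icc 0 T, inner ℝ (G t) (K t) ≤ 0 := by
    intro t ht
    rw [inner_L2]
    refine integral_mul_nonpos_of_weak_landau hγ₁ hγ₂ (Lp.stronglyMeasurable (K t)).measurable (Lp.memLp (K t))
      (Lp.stronglyMeasurable (G t)).measurable (Lp.memLp (G t)) fun ψ => ?_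
    rw [← inner_landauL2 hγ₁ hγ₂, ← inner_toL2, real_inner_comm, ← hGK ψ t ht, real_inner_comm]
  have hK2 : ∀ t, HasDerivAt (fun t => ‖K t‖ ^ 2) (2 * inner ℝ (K t) (G t)) t := fun t => (hK t).norm_sq
  -- The derivative of `‖K‖²` is `2(K, G) = 2(K, LK) ≤ 0` by weak dissipativity.
  have hanti : AntitoneOn (fun t => ‖K t‖ ^ 2) (Icc 0 T) := by
    refine antitoneOn_of_deriv_nonpos (convex_Icc 0 T) (fun t _ => (hK2 t).continuousAt.continuousWithinAt)
      (fun t _ => (hK2 t).differentiableAt.differentiableWithinAt) fun t ht => ?_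
    rw [(hK2 t).deriv, real_inner_comm]
    linarith [hdiss t (interior_subset ht)]
  have hK0 : ∀ t ∈ Icc 0 T, K t = 0 := by
    intro t ht
    have h1 := hanti (left_mem_Icc.2 hT.le) ht ht.1
    have h2 : K 0 = 0 := intervalIntegral.integral_same
    simp only [h2, norm_zero] at h1
    have h3 : ‖K t‖ ^ 2 = 0 := le_antisymm (by simpa using h1) (sq_nonneg _)
    exact norm_eq_zero.1 (pow_eq_zero_iff two_ne_zero |>.1 h3)
  have hG0 : ∀ t ∈ Icc 0 T, G t = 0 := fun t ht => eq_zero_of_inner_toL2 fun ψ => by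
    rw [hGK ψ t ht, hK0 t ht, inner_zero_right]
  -- By Lebesgue's theorem `G` has derivative `d` almost everywhere, and `G` vanishes on a
  -- neighbourhood of each interior time.
  filter_upwards [_root_.LocallyIntegrable.ae_hasDerivAt_integral hd.locallyIntegrable] with t ht htm
  have h0 : HasDerivAt G 0 t := (hasDerivAt_const t (0 : L2V)).congr_of_eventuallyEq <| by
    filter_upwards [isOpen_Ioo.mem_nhds htm] with s hs
    exact hG0 s (Ioo_subset_Icc_self hs)
  exact (ht 0).unique h0

lemma weakSolution_unique (hT : 0 < T) (f₀ : L2V) {f g : Lp L2V ∞ (volume.restrict (Icc 0 T))}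
    (hf : IsWeakSolution γ T f₀ f) (hg : IsWeakSolution γ T f₀ g) : g = f := by
  rw [isWeakSolution_iff hγ₁ hγ₂] at hf hg
  have hm : ∀ k : Lp L2V ∞ (volume.restrict (Icc 0 T)), MemLp k 2 (volume.restrict (Icc 0 T)) := fun k =>
    (Lp.memLp k).mono_exponent le_top
  have hin : ∀ (k : Lp L2V ∞ (volume.restrict (Icc 0 T))) (φ : TestFunction T),
      Integrable (fun t => inner ℝ (k t) (adjointSource hγ₁ hγ₂ φ t)) (volume.restrict (Icc 0 T)) := fun k φ => by
    have h2 := memLp_adjointSource hγ₁ hγ₂ φ 2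
    refine ((hm k).norm.integrable_mul h2.norm).mono' ((hm k).1.inner h2.1) (ae_of_all _ fun t => ?_)
    exact norm_inner_le_norm _ _
  set d : ℝ → L2V := (Icc 0 T).indicator fun t => g t - f t
  have hd : Integrable d := (integrable_indicator_iff measurableSet_Icc).2
    (((hm g).integrable (by norm_num)).sub ((hm f).integrable (by norm_num)))
  have hw : ∀ φ : TestFunction T, ∫ t in Icc 0 T, inner ℝ (d t) (adjointSource hγ₁ hγ₂ φ t) = 0 := by
    intro φ
    have e : ∫ t in Icc 0 T, inner ℝ (d t) (adjointSource hγ₁ hγ₂ φ t) =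
        ∫ t in Icc 0 T, (inner ℝ (g t) (adjointSource hγ₁ hγ₂ φ t) - inner ℝ (f t) (adjointSource hγ₁ hγ₂ φ t)) :=
      setIntegral_congr_fun measurableSet_Icc fun t ht => by
        simp only [d, indicator_of_mem ht, inner_sub_left]
    rw [e, integral_sub (hin g φ) (hin f φ)]
    linarith [hf φ, hg φ]
  have hae := ae_eq_zero_of_weak hγ₁ hγ₂ hT hd hw
  refine Lp.ext ?_
  change ∀ᵐ t ∂(volume.restrict (Icc 0 T)), g t = f t
  have hae' : ∀ᵐ t ∂(volume.restrict (Icc 0 T)), t ∈ Ioo 0 T → d t = 0 := ae_restrict_of_ae hae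
  have hmem : ∀ᵐ t ∂(volume.restrict (Icc 0 T)), t ∈ Ioo 0 T := by
    rw [← restrict_Ioo_eq_restrict_Icc]
    exact ae_restrict_mem measurableSet_Ioo
  filter_upwards [hae', hmem] with t ht htm
  have := ht htm
  simp only [d, indicator_of_mem (Ioo_subset_Icc_self htm)] at this
  exact sub_eq_zero.1 this

end

end LinearLandau

end

theorem proposition4p1 (γ : ℝ) (hγ₁ : -3 < γ) (hγ₂ : γ < 0) :
    (∃ C₀ : ℝ, 0 < C₀ ∧ LinearLandau.IsEnergyConstant γ C₀) ∧
    ∀ T : ℝ, 0 < T → ∀ f₀ : Lp ℝ 2 (volume : Measure LinearLandau.V3),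
      ∃ f : Lp (Lp ℝ 2 (volume : Measure LinearLandau.V3)) ∞ (volume.restrict (Icc 0 T)),
        LinearLandau.IsWeakSolution γ T f₀ f ∧
        (∀ g, LinearLandau.IsWeakSolution γ T f₀ g → g = f) ∧
        ∀ C₀ : ℝ, 0 < C₀ → LinearLandau.IsEnergyConstant γ C₀ →
          ∀ᵐ t ∂(volume.restrict (Icc 0 T)), ‖f t‖ ≤ 2 * Real.exp (2 * C₀ * T) * ‖f₀‖ := by
  refine ⟨LinearLandau.exists_isEnergyConstant hγ₁ hγ₂, fun T hT f₀ => ?_⟩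
  obtain ⟨f, hf, hb⟩ := LinearLandau.exists_weakSolution hγ₁ hγ₂ hT f₀
  refine ⟨f, hf, fun g hg => LinearLandau.weakSolution_unique hγ₁ hγ₂ hT f₀ hf hg, fun C₀ hC₀ _ => ?_⟩
  filter_upwards [hb] with t ht
  -- The solution already satisfies `‖f(t)‖ ≤ ‖f₀‖`, and the factor `2 exp(2 C₀ T)` is at least 1.
  have h1 : 1 ≤ Real.exp (2 * C₀ * T) := Real.one_le_exp (by positivity)
  exact ht.trans (le_mul_of_one_le_left (norm_nonneg _) (by linarith))
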